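/- Let $d\ge 1$, let $\mathsf v\in\mathbb R^d\setminus\{0\}$, and let $F=(F(x))_{x\in\mathbb R^d}$ be an $\mathbb R^d$-valued random field on a probability space $(\Omega,\mathcal F,\mathbb P)$. For Borel sets $\Lambda\subset\mathbb R^d$ let $\mathcal G_\Lambda=\sigma(F(x);x\in\Lambda)$, and define the mixing rate of $F$ for $u\ge 0$ by $$\alpha(u)=\sup_{\Lambda_1,\Lambda_2}\ \sup_{A_1\in\mathcal G_{\Lambda_1},\,A_2\in\mathcal G_{\Lambda_2}}\big|\mathbb P(A_1\cap A_2)-\mathbb P(A_1)\mathbb P(A_2)\big|,$$ the first supremum being over all Borel sets $\Lambda_1,\Lambda_2$ with $\inf_{\lambda_1\in\Lambda_1,\lambda_2\in\Lambda_2}|\lambda_1-\lambda_2|\ge u$. Assume that (i) $F$ is centered, $\mathbb E[F(x)]=0$ for all $x$, and stationary: $(F(x+h))_{x}$ has the same law as $(F(x))_{x}$ for every $h\in\mathbb R^d$; (ii) almost surely $F$ is of class $C^3$, and $\mathbb E\big[\sum_{k=0}^3\sup_{|x|\le 1}|D^kF(x)|^{2a_0}\big]<\infty$ for some $a_0>\max(3,d)$;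 (iii) $\int_0^\infty\alpha(u)^\kappa\,du<\infty$ for some $\kappa\in\big(0,\min(\tfrac13,\tfrac1d)-\tfrac1{a_0}\big)$. Let $\chi:\mathbb R^d\to\mathbb R$ be smooth, equal to $1$ on the open unit ball $B(0,1)$ and supported in $B(0,2)$. For $R>0$, $\epsilon\in(0,1]$ and $0\le s\le t\le T$, set $\chi^R(x)=\chi(x/R)$, $v^{\epsilon}_u(x)=\epsilon^{-1}F(x+\epsilon^{-2}u\,\mathsf v)$, $v^{\epsilon,R}_u=\chi^R v^\epsilon_u$, and $$V^{\epsilon,R}_{ts}=\chi^R\int_s^t v^\epsilon_u\,du=\int_s^t v^{\epsilon,R}_u\,du,\qquad W^{\epsilon,R}_{ts}=\int_s^t\int_s^{u_1}\big[v^{\epsilon,R}_{u_2},v^{\epsilon,R}_{u_1}\big]\,du_2\,du_1,$$ where $[\cdot,\cdot]$ is the Lie bracket of vector fields. These two vector fields determine the localized driver $\mathbf V^{\epsilon,R}=\big(V^{\epsilon,R},\,W^{\epsilon,R}+\tfrac12(V^{\epsilon,R})^2\big)$. Write $\Delta_\sigma f(y)=f(y+\sigma)-f(y)$ and let $\Delta_\sigma^k$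 be its $k$-th iterate. Fix $T>0$ and $R>0$. Then, with $p=2$, any $r\in(0,1)$, $a=\frac{a_0}{a_0\kappa+1}$ and $k_1=3$, there is a finite constant $C$ such that for all $\epsilon\in(0,1]$ and all $0\le s<t\le T$ one has, with $V=V^{\epsilon,R}_{ts}$ and $W=W^{\epsilon,R}_{ts}$, $$\int_{\mathbb R^d}\left\{\left\|\frac{V(y)}{|t-s|^{1/p}}\right\|^a_{L^{2a}(\Omega)}+\left\|\frac{W(y)}{|t-s|^{2/p}}\right\|^a_{L^{a}(\Omega)}\right\}dy +\iint_{\mathbb R^d\times B(0,1)}\left\|\frac{\Delta^{k_1}_\sigma V(y)}{|t-s|^{1/p}}\right\|^a_{L^{2a}(\Omega)}\frac{dy\,d\sigma}{|\sigma|^{(2+r)a+d}} +\iint_{\mathbb R^d\times B(0,1)}\left\|\frac{\Delta^{k_1-1}_\sigma W(y)}{|t-s|^{2/p}}\right\|^a_{L^{a}(\Omega)}\frac{dy\,d\sigma}{|\sigma|^{(1+r)a+d}}\ \le\ C .$$ -/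

import Mathlib

open MeasureTheory ProbabilityTheory Set
open scoped ENNReal NNReal

noncomputable section

namespace StochTurb

/-- The Euclidean space `ℝ^d`. -/
abbrev E (d : ℕ) : Type := EuclideanSpace ℝ (Fin d)

variable {d : ℕ} {Ω : Type*} [MeasurableSpace Ω]

/-- The σ-algebra generated by the random variables `F x`, for `x ∈ Λ`. -/
abbrev fieldSigma (F : E d → Ω → E d) (Λ : Set (E d)) : MeasurableSpace Ω :=
  ⨆ x ∈ Λ, MeasurableSpace.comap (F x) inferInstance

/-- The strong mixing coefficient `sup |P(A ∩ B) - P(A) P(B)|` of two σ-algebras. -/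
def mixingCoeff (μ : Measure Ω) (𝒜 ℬ : MeasurableSpace Ω) : ℝ≥0∞ :=
  ⨆ (A : Set Ω) (_ : MeasurableSet[𝒜] A) (B : Set Ω) (_ : MeasurableSet[ℬ] B),
    ENNReal.ofReal |μ.real (A ∩ B) - μ.real A * μ.real B|

/-- The mixing rate of `F`: the supremum of the mixing coefficients of the σ-algebras generated
by `F` on two Borel sets at distance at least `u` from each other. -/
def mixingRate (μ : Measure Ω) (F : E d → Ω → E d) (u : ℝ) : ℝ≥0∞ :=
  ⨆ (Λ₁ : Set (E d)) (_ : MeasurableSet Λ₁) (Λ₂ : Set (E d)) (_ : MeasurableSet Λ₂)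
    (_ : ∀ x ∈ Λ₁, ∀ y ∈ Λ₂, u ≤ dist x y),
    mixingCoeff μ (fieldSigma F Λ₁) (fieldSigma F Λ₂)

/-- The space/time rescaled random velocity field `v^ε_u(x) = ε⁻¹ F(x + ε⁻² u v)`. -/
def vel (F : E d → Ω → E d) (v : E d) (ε u : ℝ) (x : E d) (ω : Ω) : E d :=
  ε⁻¹ • F (x + (u / ε ^ 2) • v) ω

/-- The rescaled cutoff function `χ^R(x) = χ(x/R)`. -/
def cutoff (χ : E d → ℝ) (R : ℝ) (x : E d) : ℝ := χ (R⁻¹ • x)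

/-- The localized velocity field `v^{ε,R}_u = χ^R v^ε_u`. -/
def velLoc (F : E d → Ω → E d) (v : E d) (χ : E d → ℝ) (R ε u : ℝ) (x : E d) (ω : Ω) : E d :=
  cutoff χ R x • vel F v ε u x ω

/-- First component of the (unlocalized) driver: `V^ε_{ts}(x) = ∫_s^t v^ε_u(x) du`. -/
def driverV (F : E d → Ω → E d) (v : E d) (ε s t : ℝ) (x : E d) (ω : Ω) : E d :=
  ∫ u in s..t, vel F v ε u x ω

/-- First component of the localized driver: `V^{ε,R}_{ts} = χ^R V^ε_{ts}`. -/
def driverVLoc (F : E d → Ω → E d) (v : E d) (χ : E d → ℝ) (R ε s t : ℝ) (x : E d) (ω : Ω) :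
    E d :=
  cutoff χ R x • driverV F v ε s t x ω

/-- Second component (a vector field) of the localized driver:
`W^{ε,R}_{ts} = ∫_s^t ∫_s^{u₁} [v^{ε,R}_{u₂}, v^{ε,R}_{u₁}] du₂ du₁`, where
`[a, b](x) = D_x b (a(x)) - D_x a (b(x))` is the Lie bracket of vector fields. -/
def driverWLoc (F : E d → Ω → E d) (v : E d) (χ : E d → ℝ) (R ε s t : ℝ) (x : E d) (ω : Ω) :
    E d :=
  ∫ u₁ in s..t, ∫ u₂ in s..u₁,
    VectorField.lieBracket ℝ (fun y => velLoc F v χ R ε u₂ y ω)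
      (fun y => velLoc F v χ R ε u₁ y ω) x

/-- The iterated increment `Δ_σ^k f (y)` of a random field, where `Δ_σ f (y) = f(y + σ) - f(y)`. -/
def incr (k : ℕ) (σ : E d) (f : E d → Ω → E d) (y : E d) (ω : Ω) : E d :=
  (fwdDiff σ)^[k] (fun z => f z ω) y

/-- The moment functional
`∫ { ‖V(y) / |t-s|^{1/p}‖^a_{L^{2a}(Ω)} + ‖W(y) / |t-s|^{2/p}‖^a_{L^a(Ω)} } dy`
`+ ∬ ‖Δ_σ^{k₁} V(y) / |t-s|^{1/p}‖^a_{L^{2a}(Ω)} dy dσ / |σ|^{(2+r)a+d}`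
`+ ∬ ‖Δ_σ^{k₁-1} W(y) / |t-s|^{2/p}‖^a_{L^a(Ω)} dy dσ / |σ|^{(1+r)a+d}`
of a pair `(V, W)` of random vector fields attached to the times `s < t`, with `y` in `ℝ^d` and
`σ` in the unit ball. -/
def momentFunctional (μ : Measure Ω) (p r a : ℝ) (k₁ : ℕ) (s t : ℝ) (V W : E d → Ω → E d) :
    ℝ≥0∞ :=
  (∫⁻ y : E d,
    ((eLpNorm (fun ω => (|t - s| ^ (1 / p))⁻¹ • V y ω) (ENNReal.ofReal (2 * a)) μ) ^ a
      + (eLpNorm (fun ω => (|t - s| ^ (2 / p))⁻¹ • W y ω) (ENNReal.ofReal a) μ) ^ a))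
  + (∫⁻ σ in Metric.ball (0 : E d) 1, ∫⁻ y : E d,
      (eLpNorm (fun ω => (|t - s| ^ (1 / p))⁻¹ • incr k₁ σ V y ω)
        (ENNReal.ofReal (2 * a)) μ) ^ a / ENNReal.ofReal (‖σ‖ ^ ((2 + r) * a + d)))
  + (∫⁻ σ in Metric.ball (0 : E d) 1, ∫⁻ y : E d,
      (eLpNorm (fun ω => (|t - s| ^ (2 / p))⁻¹ • incr (k₁ - 1) σ W y ω)
        (ENNReal.ofReal a) μ) ^ a / ENNReal.ofReal (‖σ‖ ^ ((1 + r) * a + d)))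

/-- The `ε`-uniform moment bounds on `[0, T]`, with parameters `p, r, a, k₁`, for a family
`(V^ε_{ts}, W^ε_{ts})` (written `V ε s t`, `W ε s t`) of random vector fields: the moment
functional is bounded by a finite constant, for all `0 < ε ≤ 1` and `0 ≤ s < t ≤ T`. -/
def UniformMomentBounds (μ : Measure Ω) (T p r a : ℝ) (k₁ : ℕ)
    (V W : ℝ → ℝ → ℝ → E d → Ω → E d) : Prop :=
  ∃ C : ℝ≥0, ∀ ε : ℝ, 0 < ε → ε ≤ 1 → ∀ s t : ℝ, 0 ≤ s → s < t → t ≤ T →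
    momentFunctional μ p r a k₁ s t (V ε s t) (W ε s t) ≤ C

end StochTurb

end

/-! The mechanism is the decorrelation of `F` along the ray `u ↦ y + ε⁻² u v`. The process `X u =
ε⁻¹ g(y + ε⁻² u v)`, where `g` is a centered scalar field determined locally by `F`, has `L^r` norm
`O(ε⁻¹)` but decorrelates over times `O(ε²)`. Its integral over `[s, t]` should therefore be of size
`(t - s)^{1/2}`, and a double integral of size `t - s`, uniformly in `ε`.

To get this in `L^p`, let `S u` be the primitive of `X`. Then `|S|^p` has derivative `p |S|^{p-2} S
X`, and `|S|^{p-2} S` is itself the primitive of `(p-1) |S|^{p-2} X`. So `E[|S u|^{p-2} S u X u]` is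
an integral over `w < u` of covariances between the past `|S w|^{p-2} X w` and the centered present
`X u`. Davydov's inequality (`abs_integral_mul_le_of_mixing`) bounds each by `7 β(u-w)^κ` times two
norms, and the `κ`-th power of the rate is integrable. If `A` is the least bound for the `L^p` norms
of `S` on `[s, t]`, this gives `A^p ≤ const · A^{p-2} K² L (t-s)`, and one divides by `A^{p-2}`.
Hölder's exponents close exactly when `κ + 2/r = 2/p`; here `K² = O(ε⁻²)` and `L = O(ε²)`
compensate. The same scheme for `M u = ∫ S Y`, using the bound for `S` in `L^{2p}`, gives a
quadratic inequality for the least bound of `M` when `κ + 2/r = 1/p`. These are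
`CenteredProcess.momentBound_primitive` and `CenteredProcess.momentBound_iterated`.

With `r = 2a₀` and `1/a = κ + 1/a₀` both balances hold, at `p = 2a` for `V` and `p = a` for `W`, and
`κ < 1/3 - 1/a₀` means `a > 3`, as the differentiations of signed powers require.

Spatial increments commute with time integration and obey a Leibniz rule on iterated integrals. The
increments of `F` and of its first derivatives are again centered local fields, with `L^r` norms
`O(|σ|^i)`: up to order 3 for `F`, and order 2 for its derivatives, which enter `W` through the
bracket. Thus `Δ³V` and `Δ²W` carry the factors `|σ|³` and `|σ|²`. After division by the weights,
both integrands become `|σ|^{(1-r)a-d}`, which is integrable near 0 because `r < 1`; the cutoff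
bounds the domain in `y`. Finally `F` is replaced by a modification with every path `C³`, which does
not increase the mixing rate. -/

namespace StochTurb

/-! ### Calculus of `L^p` bounds for real random variables. -/

section MomentBounds

variable {Ω : Type*} {mΩ : MeasurableSpace Ω} {μ : Measure Ω}

/-- The real random variable `X` has `L^p` norm at most `K`. -/
def MomentBound (μ : Measure Ω) (p : ℝ) (X : Ω → ℝ) (K : ℝ) : Prop :=
  eLpNorm' X p μ ≤ ENNReal.ofReal K

theorem momentBound_iff {p : ℝ} (hp : 0 < p) {X : Ω → ℝ} {K : ℝ} :
    MomentBound μ p X K ↔ ∫⁻ ω, ‖X ω‖ₑ ^ p ∂μ ≤ ENNReal.ofReal K ^ p := by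
  rw [MomentBound, eLpNorm', one_div, ENNReal.rpow_inv_le_iff hp]

theorem MomentBound.mono {p : ℝ} {X : Ω → ℝ} {K K' : ℝ} (h : MomentBound μ p X K) (hK : K ≤ K') :
    MomentBound μ p X K' :=
  h.trans (ENNReal.ofReal_le_ofReal hK)

theorem MomentBound.congr_le {p : ℝ} (hp : 0 < p) {X Y : Ω → ℝ} {K : ℝ} (h : MomentBound μ p X K)
    (hXY : ∀ ω, |Y ω| ≤ |X ω|) : MomentBound μ p Y K := by
  rw [momentBound_iff hp] at h ⊢
  refine (lintegral_mono fun ω => ?_).trans h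
  gcongr
  rw [enorm_le_iff_norm_le]
  exact hXY ω

theorem MomentBound.exponent_mono [IsProbabilityMeasure μ] {p q : ℝ} (hp : 0 < p) (hpq : p ≤ q)
    {X : Ω → ℝ} {K : ℝ} (hX : AEStronglyMeasurable X μ) (h : MomentBound μ q X K) :
    MomentBound μ p X K :=
  (eLpNorm'_le_eLpNorm'_of_exponent_le hp hpq μ hX).trans h

theorem MomentBound.mul {p q r : ℝ} (hp : 0 < p) (hq : 0 < q) (hr : 0 < r)
    (hpqr : 1 / p = 1 / q + 1 / r) {X Y : Ω → ℝ} {K K' : ℝ} (hK : 0 ≤ K)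
    (hX : AEStronglyMeasurable X μ) (hY : AEStronglyMeasurable Y μ)
    (h : MomentBound μ q X K) (h' : MomentBound μ r Y K') :
    MomentBound μ p (fun ω => X ω * Y ω) (K * K') := by
  have hpq : p < q := by
    refine lt_of_one_div_lt_one_div hq ?_
    rw [hpqr]
    have : 0 < 1 / r := by positivity
    linarith
  have := eLpNorm'_smul_le_mul_eLpNorm' hY hX hp hpq hpqr
  refine this.trans ?_
  rw [ENNReal.ofReal_mul hK]
  exact mul_le_mul' h h'

theorem MomentBound.rpow {p θ : ℝ} (hp : 0 < p) (hθ : 0 < θ) {X : Ω → ℝ} {K : ℝ} (hK : 0 ≤ K)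
    (h : MomentBound μ (θ * p) X K) : MomentBound μ p (fun ω => |X ω| ^ θ) (K ^ θ) := by
  rw [momentBound_iff (by positivity)] at h ⊢
  rw [← ENNReal.ofReal_rpow_of_nonneg hK hθ.le, ← ENNReal.rpow_mul]
  refine le_trans (le_of_eq ?_) h
  congr 1 with ω
  rw [Real.enorm_rpow_of_nonneg (abs_nonneg _) hθ.le, ← ENNReal.rpow_mul, Real.enorm_abs]

theorem MomentBound.const_mul {p : ℝ} (hp : 0 < p) {X : Ω → ℝ} {K : ℝ} (c : ℝ)
    (h : MomentBound μ p X K) : MomentBound μ p (fun ω => c * X ω) (|c| * K) := by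
  rw [momentBound_iff hp] at h ⊢
  simp_rw [enorm_mul, ENNReal.mul_rpow_of_nonneg _ _ hp.le]
  rw [lintegral_const_mul' _ _ (by simp [hp.le]), ENNReal.ofReal_mul (abs_nonneg _),
    ENNReal.mul_rpow_of_nonneg _ _ hp.le]
  rw [← Real.norm_eq_abs, ofReal_norm]
  gcongr

theorem MomentBound.add {p : ℝ} (hp : 1 ≤ p) {X Y : Ω → ℝ} {K K' : ℝ} (hK : 0 ≤ K) (hK' : 0 ≤ K')
    (hX : AEStronglyMeasurable X μ) (hY : AEStronglyMeasurable Y μ) (h : MomentBound μ p X K)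
    (h' : MomentBound μ p Y K') : MomentBound μ p (fun ω => X ω + Y ω) (K + K') := by
  rw [MomentBound, ENNReal.ofReal_add hK hK']
  exact (eLpNorm'_add_le hX hY hp).trans (add_le_add h h')

theorem MomentBound.memLp {p : ℝ} (hp : 0 < p) {X : Ω → ℝ} {K : ℝ}
    (hX : AEStronglyMeasurable X μ) (h : MomentBound μ p X K) : MemLp X (ENNReal.ofReal p) μ := by
  refine ⟨hX, ?_⟩
  rw [eLpNorm_eq_eLpNorm' (by simpa using hp) ENNReal.ofReal_ne_top, ENNReal.toReal_ofReal hp.le]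
  exact lt_of_le_of_lt h ENNReal.ofReal_lt_top

theorem MomentBound.integrable [IsFiniteMeasure μ] {p : ℝ} (hp : 1 ≤ p) {X : Ω → ℝ} {K : ℝ}
    (hX : AEStronglyMeasurable X μ) (h : MomentBound μ p X K) : Integrable X μ :=
  (h.memLp (by linarith) hX).integrable (by simpa using hp)

theorem MomentBound.abs_integral_le {X : Ω → ℝ} {K : ℝ} (hK : 0 ≤ K) (h : MomentBound μ 1 X K) :
    |∫ ω, X ω ∂μ| ≤ K := by
  rw [momentBound_iff one_pos] at h
  simp only [ENNReal.rpow_one] at h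
  have := (enorm_integral_le_lintegral_enorm X).trans h
  rwa [← ofReal_norm, ENNReal.ofReal_le_ofReal_iff hK] at this

end MomentBounds

/-! ### Davydov's covariance inequality. -/

section Covariance

variable {Ω : Type*} {𝒜 ℬ : MeasurableSpace Ω} {mΩ : MeasurableSpace Ω} {μ : Measure Ω}

/-- Layer cake: `∫ Z dν` is the integral of `ν{Z ≥ t}` over `0 < t ≤ N`, and each level set lies in
`ℬ`, so the integrand of the difference is at most `δ`. -/
theorem abs_integral_sub_integral_le {ν₁ ν₂ : Measure Ω} [IsFiniteMeasure ν₁] [IsFiniteMeasure ν₂]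
    (hℬ : ℬ ≤ mΩ) {δ N : ℝ} (hN : 0 ≤ N)
    (h : ∀ B, MeasurableSet[ℬ] B → |ν₁.real B - ν₂.real B| ≤ δ)
    {Z : Ω → ℝ} (hZ : Measurable[ℬ] Z) (h0 : ∀ ω, 0 ≤ Z ω) (hZN : ∀ ω, Z ω ≤ N) :
    |∫ ω, Z ω ∂ν₁ - ∫ ω, Z ω ∂ν₂| ≤ δ * N := by
  have hi : ∀ ν : Measure Ω, IsFiniteMeasure ν → Integrable Z ν := fun ν _ =>
    Integrable.of_bound (hZ.mono hℬ le_rfl).aestronglyMeasurable N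
      (.of_forall fun ω => by rw [Real.norm_of_nonneg (h0 ω)]; exact hZN ω)
  have hint : ∀ ν : Measure Ω, IsFiniteMeasure ν →
      IntegrableOn (fun t : ℝ => ν.real {a | t ≤ Z a}) (Ioc 0 N) := by
    intro ν _
    refine Measure.integrableOn_of_bounded (M := ν.real univ) (by simp) ?_ ?_
    · refine (Antitone.measurable fun s t hst => ?_).aestronglyMeasurable
      exact measureReal_mono fun a (ha : t ≤ Z a) => hst.trans ha
    · refine .of_forall fun t => ?_
      rw [Real.norm_of_nonneg measureReal_nonneg]
      exact measureReal_mono (subset_univ _)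
  rw [(hi ν₁ inferInstance).integral_eq_integral_Ioc_meas_le (.of_forall h0) (.of_forall hZN),
    (hi ν₂ inferInstance).integral_eq_integral_Ioc_meas_le (.of_forall h0) (.of_forall hZN),
    ← integral_sub (hint ν₁ inferInstance) (hint ν₂ inferInstance)]
  have := norm_setIntegral_le_of_norm_le_const (μ := volume) (s := Ioc 0 N) (C := δ)
    (f := fun t : ℝ => ν₁.real {a | t ≤ Z a} - ν₂.real {a | t ≤ Z a}) measure_Ioc_lt_top
    fun t _ => h _ (hZ measurableSet_Ici)
  rwa [Real.volume_real_Ioc_of_le hN, sub_zero] at this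

theorem abs_measureReal_inter_sub_le {α : ℝ} (hα : 0 ≤ α)
    (hmix : mixingCoeff μ 𝒜 ℬ ≤ ENNReal.ofReal α) {A B : Set Ω} (hA : MeasurableSet[𝒜] A)
    (hB : MeasurableSet[ℬ] B) : |μ.real (A ∩ B) - μ.real A * μ.real B| ≤ α := by
  rw [← ENNReal.ofReal_le_ofReal_iff hα]
  refine le_trans ?_ hmix
  exact le_iSup₂_of_le (i := A) (j := hA) (le_iSup₂_of_le (i := B) (j := hB) le_rfl)

/-- Two layer cakes, one factor at a time: first for `Y`, comparing `μ` restricted to `B` with `μ(B)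
μ`; then for `Z`, comparing the measure of density `Y` with `E[Y] μ`. -/
theorem abs_integral_mul_sub_le_of_nonneg [IsProbabilityMeasure μ]
    (h𝒜 : 𝒜 ≤ mΩ) (hℬ : ℬ ≤ mΩ) {α M N : ℝ} (hα : 0 ≤ α)
    (hM : 0 ≤ M) (hN : 0 ≤ N) (hmix : mixingCoeff μ 𝒜 ℬ ≤ ENNReal.ofReal α) {Y Z : Ω → ℝ}
    (hY : Measurable[𝒜] Y) (hZ : Measurable[ℬ] Z) (hY0 : ∀ ω, 0 ≤ Y ω) (hYM : ∀ ω, Y ω ≤ M)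
    (hZ0 : ∀ ω, 0 ≤ Z ω) (hZN : ∀ ω, Z ω ≤ N) :
    |∫ ω, Y ω * Z ω ∂μ - (∫ ω, Y ω ∂μ) * ∫ ω, Z ω ∂μ| ≤ α * M * N := by
  have hY' : Measurable Y := hY.mono h𝒜 le_rfl
  have hYi : Integrable Y μ := Integrable.of_bound hY'.aestronglyMeasurable M
    (.of_forall fun ω => by rw [Real.norm_of_nonneg (hY0 ω)]; exact hYM ω)
  have hI0 : 0 ≤ ∫ ω, Y ω ∂μ := integral_nonneg hY0
  have key : ∀ B, MeasurableSet[ℬ] B →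
      |∫ ω in B, Y ω ∂μ - μ.real B * ∫ ω, Y ω ∂μ| ≤ α * M := by
    intro B hB
    have : IsFiniteMeasure ((μ B) • μ) := Measure.smul_finite _ (measure_ne_top _ _)
    have := abs_integral_sub_integral_le (ν₁ := μ.restrict B) (ν₂ := (μ B) • μ) h𝒜 (δ := α) hM
      (fun A hA => ?_) hY hY0 hYM
    · rwa [integral_smul_measure] at this
    · rw [measureReal_restrict_apply (h𝒜 _ hA), measureReal_ennreal_smul_apply, mul_comm]
      exact abs_measureReal_inter_sub_le hα hmix hA hB
  have hfin : IsFiniteMeasure (μ.withDensity fun ω => ENNReal.ofReal (Y ω)) :=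
    isFiniteMeasure_withDensity_ofReal hYi.2
  have : IsFiniteMeasure ((ENNReal.ofReal (∫ ω, Y ω ∂μ)) • μ) :=
    Measure.smul_finite _ ENNReal.ofReal_ne_top
  have := abs_integral_sub_integral_le (ν₁ := μ.withDensity fun ω => ENNReal.ofReal (Y ω))
    (ν₂ := (ENNReal.ofReal (∫ ω, Y ω ∂μ)) • μ) hℬ (δ := α * M) hN (fun B hB => ?_) hZ hZ0 hZN
  · rw [integral_smul_measure, integral_withDensity_eq_integral_toReal_smul
      hY'.ennreal_ofReal (.of_forall fun _ => ENNReal.ofReal_lt_top),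
      ENNReal.toReal_ofReal hI0] at this
    simpa [ENNReal.toReal_ofReal (hY0 _)] using this
  · have h1 : (μ.withDensity fun ω => ENNReal.ofReal (Y ω)).real B = ∫ ω in B, Y ω ∂μ := by
      rw [measureReal_def, withDensity_apply _ (hℬ _ hB),
        integral_eq_lintegral_of_nonneg_ae (.of_forall hY0) hY'.aestronglyMeasurable]
    rw [h1, measureReal_ennreal_smul_apply, ENNReal.toReal_ofReal hI0, mul_comm]
    exact key B hB

/-- A covariance is unchanged by adding constants; `Y + M` and `Z + N` take values in `[0, 2M]` and
`[0, 2N]`, whence the factor 4. -/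
theorem abs_integral_mul_sub_le_of_bounded [IsProbabilityMeasure μ]
    (h𝒜 : 𝒜 ≤ mΩ) (hℬ : ℬ ≤ mΩ) {α M N : ℝ} (hα : 0 ≤ α)
    (hM : 0 ≤ M) (hN : 0 ≤ N) (hmix : mixingCoeff μ 𝒜 ℬ ≤ ENNReal.ofReal α) {Y Z : Ω → ℝ}
    (hY : Measurable[𝒜] Y) (hZ : Measurable[ℬ] Z) (hYM : ∀ ω, |Y ω| ≤ M)
    (hZN : ∀ ω, |Z ω| ≤ N) :
    |∫ ω, Y ω * Z ω ∂μ - (∫ ω, Y ω ∂μ) * ∫ ω, Z ω ∂μ| ≤ 4 * α * M * N := by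
  have hY' : Measurable Y := hY.mono h𝒜 le_rfl
  have hZ' : Measurable Z := hZ.mono hℬ le_rfl
  have hYi : Integrable Y μ := Integrable.of_bound hY'.aestronglyMeasurable M (.of_forall hYM)
  have hZi : Integrable Z μ := Integrable.of_bound hZ'.aestronglyMeasurable N (.of_forall hZN)
  have hYZ : Integrable (fun ω => Y ω * Z ω) μ :=
    Integrable.of_bound (hY'.mul hZ').aestronglyMeasurable (M * N) (.of_forall fun ω => by
      rw [Real.norm_eq_abs, abs_mul]
      exact mul_le_mul (hYM ω) (hZN ω) (abs_nonneg _) hM)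
  have := abs_integral_mul_sub_le_of_nonneg h𝒜 hℬ (M := 2 * M) (N := 2 * N) hα (by linarith)
    (by linarith) hmix (Y := fun ω => Y ω + M) (Z := fun ω => Z ω + N) (hY.add_const _)
    (hZ.add_const _) (fun ω => by linarith [neg_le_of_abs_le (hYM ω)])
    (fun ω => by linarith [le_of_abs_le (hYM ω)])
    (fun ω => by linarith [neg_le_of_abs_le (hZN ω)])
    (fun ω => by linarith [le_of_abs_le (hZN ω)])
  have e1 : ∫ ω, (Y ω + M) * (Z ω + N) ∂μ
      = ∫ ω, Y ω * Z ω ∂μ + N * ∫ ω, Y ω ∂μ + M * ∫ ω, Z ω ∂μ + M * N := by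
    have : ∀ ω, (Y ω + M) * (Z ω + N) = Y ω * Z ω + N * Y ω + M * Z ω + M * N := fun ω => by ring
    simp_rw [this]
    rw [integral_add (by fun_prop) (by fun_prop), integral_add (by fun_prop) (by fun_prop),
      integral_add (by fun_prop) (by fun_prop), integral_const_mul, integral_const_mul]
    simp
  rw [e1, integral_add hYi (by fun_prop), integral_add hZi (by fun_prop)] at this
  simp only [integral_const, probReal_univ, smul_eq_mul, one_mul] at this
  calc _ = _ := by congr 1; ring
    _ ≤ _ := this
    _ = _ := by ring

/-- The tail part of a product is controlled by the truncation level. -/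
theorem integral_tail_mul_le {q r κ : ℝ} (hq : 0 < q) (hr : 0 < r) (hκ : 0 < κ)
    (hqr : 1 / q + 1 / r + κ = 1) {Y Z : Ω → ℝ} (hY : Measurable Y) (hZ : Measurable Z)
    {K K' α : ℝ} (hK : 0 < K) (hK' : 0 ≤ K') (hα : 0 < α) (h : MomentBound μ q Y K)
    (h' : MomentBound μ r Z K') {T U : Ω → ℝ}
    (hT : ∀ ω, |T ω| ≤ |Y ω|) (hT0 : ∀ ω, |Y ω| ≤ K * α ^ (-(1 / q)) → T ω = 0)
    (hU : ∀ ω, |U ω| ≤ |Z ω|) :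
    |∫ ω, T ω * U ω ∂μ| ≤ α ^ κ * K * K' := by
  set M := K * α ^ (-(1 / q)) with hM
  have hMpos : 0 < M := by positivity
  -- Where `|Y| > M` one has `|Y| ≤ M^{-qκ} |Y|^θ`. The power `|Y|^θ` lies in `L^{q/θ}` and `θ/q =
  -- 1/q + κ` is the Hölder conjugate of `1/r`; the level `M` is chosen so that `M^{-qκ} K^θ = α^κ
  -- K`.
  set θ := 1 + q * κ with hθ
  have hθ0 : 0 < θ := by positivity
  have h1 : MomentBound μ (q / θ) (fun ω => |Y ω| ^ θ) (K ^ θ) := by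
    refine MomentBound.rpow (by positivity) hθ0 hK.le ?_
    rwa [mul_div_cancel₀ _ hθ0.ne']
  have h2 : MomentBound μ 1 (fun ω => |Y ω| ^ θ * Z ω) (K ^ θ * K') := by
    refine h1.mul one_pos (by positivity) hr ?_ (by positivity) ?_ hZ.aestronglyMeasurable h'
    · rw [one_div_div, hθ, add_div, mul_div_cancel_left₀ _ hq.ne']
      linarith
    · exact (hY.abs.pow_const _).aestronglyMeasurable
  have h3 := (h2.const_mul one_pos (M ^ (-(q * κ))))
  have h4 : MomentBound μ 1 (fun ω => T ω * U ω) (|M ^ (-(q * κ))| * (K ^ θ * K')) := by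
    refine h3.congr_le one_pos fun ω => ?_
    rw [abs_mul, abs_mul, abs_mul, ← mul_assoc]
    refine mul_le_mul ?_ (hU ω) (abs_nonneg _) (by positivity)
    by_cases hω : |Y ω| ≤ M
    · rw [hT0 ω hω, abs_zero]; positivity
    · push Not at hω
      refine (hT ω).trans ?_
      have hYpos : 0 < |Y ω| := hMpos.trans hω
      rw [abs_of_nonneg (Real.rpow_nonneg hMpos.le _),
        abs_of_nonneg (Real.rpow_nonneg hYpos.le _), hθ, Real.rpow_add hYpos, Real.rpow_one,
          Real.rpow_neg hMpos.le]
      rw [mul_left_comm]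
      refine le_mul_of_one_le_right hYpos.le ?_
      rw [← div_eq_inv_mul, one_le_div (by positivity)]
      exact Real.rpow_le_rpow hMpos.le hω.le (by positivity)
  refine (h4.abs_integral_le (by positivity)).trans_eq ?_
  rw [abs_of_nonneg (by positivity), hM, Real.mul_rpow hK.le (by positivity), ← Real.rpow_mul hα.le,
    hθ, Real.rpow_add hK, Real.rpow_one, Real.rpow_neg hK.le]
  have : -(1 / q) * -(q * κ) = κ := by field_simp
  rw [this]
  field_simp

theorem abs_integral_mul_le_of_mixing_pos [IsProbabilityMeasure μ]
    (h𝒜 : 𝒜 ≤ mΩ) (hℬ : ℬ ≤ mΩ) {α K K' q r κ : ℝ}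
    (hα : 0 < α) (hK : 0 < K) (hK' : 0 < K') (hmix : mixingCoeff μ 𝒜 ℬ ≤ ENNReal.ofReal α)
    (hq : 0 < q) (hr : 0 < r) (hκ : 0 < κ) (hqr : 1 / q + 1 / r + κ = 1) {Y Z : Ω → ℝ}
    (hY : Measurable[𝒜] Y) (hZ : Measurable[ℬ] Z)
    (h : MomentBound μ q Y K) (h' : MomentBound μ r Z K') (hZ0 : ∫ ω, Z ω ∂μ = 0) :
    |∫ ω, Y ω * Z ω ∂μ| ≤ 7 * α ^ κ * K * K' := by
  have hY' : Measurable Y := hY.mono h𝒜 le_rfl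
  have hZ' : Measurable Z := hZ.mono hℬ le_rfl
  have hq1 : 1 ≤ q := by
    have : 1 / q ≤ 1 := by have : 0 < 1 / r := by positivity
                           linarith
    rwa [div_le_one hq] at this
  have hr1 : 1 ≤ r := by
    have : 1 / r ≤ 1 := by have : 0 < 1 / q := by positivity
                           linarith
    rwa [div_le_one hr] at this
  set M := K * α ^ (-(1 / q)) with hM
  set N := K' * α ^ (-(1 / r)) with hN
  have hM0 : 0 < M := by positivity
  have hN0 : 0 < N := by positivity
  have hmeas : ∀ {m : MeasurableSpace Ω} {c : ℝ} {X : Ω → ℝ}, Measurable[m] X →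
      Measurable[m] ({ω | |X ω| ≤ c}.indicator X) := fun {m c X} hX =>
    hX.indicator (measurableSet_le hX.abs measurable_const)
  set Y₁ := {ω | |Y ω| ≤ M}.indicator Y with hY₁
  set Z₁ := {ω | |Z ω| ≤ N}.indicator Z with hZ₁
  have hle : ∀ {c : ℝ} {X : Ω → ℝ} ω, |{ω | |X ω| ≤ c}.indicator X ω| ≤ |X ω| := fun {c X} ω => by
    by_cases hω : |X ω| ≤ c <;> simp [indicator, hω]
  have hbd : ∀ {c : ℝ} {X : Ω → ℝ}, 0 ≤ c → ∀ ω, |{ω | |X ω| ≤ c}.indicator X ω| ≤ c :=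
    fun {c X} hc ω => by by_cases hω : |X ω| ≤ c <;> simp [indicator, hω, hc]
  have htail : ∀ {c : ℝ} {X : Ω → ℝ} ω, |X ω - {ω | |X ω| ≤ c}.indicator X ω| ≤ |X ω| :=
    fun {c X} ω => by by_cases hω : |X ω| ≤ c <;> simp [indicator, hω]
  have htail0 : ∀ {c : ℝ} {X : Ω → ℝ} ω, |X ω| ≤ c →
    X ω - {ω | |X ω| ≤ c}.indicator X ω = 0 := fun {c X} ω hω => by simp [indicator, hω]
  have hYi : Integrable Y μ := h.integrable hq1 hY'.aestronglyMeasurable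
  have hZi : Integrable Z μ := h'.integrable hr1 hZ'.aestronglyMeasurable
  have hZ₁i : Integrable Z₁ μ := hZi.mono (hmeas hZ').aestronglyMeasurable (.of_forall hle)
  have hY₁m : AEStronglyMeasurable Y₁ μ := (hmeas hY').aestronglyMeasurable
  have hprod1 : Integrable (fun ω => Y₁ ω * Z₁ ω) μ :=
    hZ₁i.bdd_mul hY₁m (.of_forall (hbd hM0.le))
  have hprod2 : Integrable (fun ω => Y₁ ω * (Z ω - Z₁ ω)) μ :=
    (hZi.sub hZ₁i).bdd_mul hY₁m (.of_forall (hbd hM0.le))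
  have hYZ : Integrable (fun ω => Y ω * Z ω) μ := by
    set p := 1 / (1 / q + 1 / r) with hp
    have hp1 : 1 ≤ p := by
      rw [hp, one_le_div (by positivity)]; linarith
    refine (h.mul (p := p) (by linarith) hq hr (by rw [hp, one_div_one_div]) hK.le
      hY'.aestronglyMeasurable hZ'.aestronglyMeasurable h').integrable hp1
      (hY'.mul hZ').aestronglyMeasurable
  have hprod3 : Integrable (fun ω => (Y ω - Y₁ ω) * Z ω) μ := by
    have := (hYZ.sub hprod1).sub hprod2
    refine this.congr (.of_forall fun ω => ?_)
    simp only [Pi.sub_apply]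
    ring
  -- As `E[Z] = 0`, the mean of the truncation `Z₁` is minus the mean of the tail. The covariance of
  -- the truncations will cost `4 α^κ K K'` and each of the three tail terms `α^κ K K'`, which makes
  -- 7.
  have key : ∫ ω, Y ω * Z ω ∂μ = (∫ ω, Y₁ ω * Z₁ ω ∂μ - (∫ ω, Y₁ ω ∂μ) * ∫ ω, Z₁ ω ∂μ)
      - (∫ ω, Y₁ ω ∂μ) * (∫ ω, 1 * (Z ω - Z₁ ω) ∂μ) + ∫ ω, Y₁ ω * (Z ω - Z₁ ω) ∂μ
      + ∫ ω, (Y ω - Y₁ ω) * Z ω ∂μ := by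
    simp only [one_mul]
    rw [integral_sub hZi hZ₁i, hZ0]
    have : ∫ ω, Y ω * Z ω ∂μ
        = ∫ ω, (Y₁ ω * Z₁ ω + Y₁ ω * (Z ω - Z₁ ω) + (Y ω - Y₁ ω) * Z ω) ∂μ := by
      congr 1 with ω; ring
    rw [this, integral_add (f := fun ω => Y₁ ω * Z₁ ω + Y₁ ω * (Z ω - Z₁ ω))
      (hprod1.add hprod2) hprod3, integral_add hprod1 hprod2]
    ring
  have b1 : |∫ ω, Y₁ ω * Z₁ ω ∂μ - (∫ ω, Y₁ ω ∂μ) * ∫ ω, Z₁ ω ∂μ| ≤ 4 * (α ^ κ * K * K') := by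
    refine (abs_integral_mul_sub_le_of_bounded h𝒜 hℬ hα.le hM0.le hN0.le hmix (hmeas hY) (hmeas hZ)
      (hbd hM0.le) (hbd hN0.le)).trans_eq ?_
    -- The truncation levels balance the errors: `α M N = α^{1 - 1/q - 1/r} K K' = α^κ K K'`.
    have : α ^ κ = α * α ^ (-(1 / q)) * α ^ (-(1 / r)) := by
      rw [← Real.rpow_one_add' hα.le (by linarith [show 0 < 1 / r by positivity]),
        ← Real.rpow_add hα]
      congr 1; linarith
    rw [hM, hN, this]; ring
  have b3 : |∫ ω, Y₁ ω * (Z ω - Z₁ ω) ∂μ| ≤ α ^ κ * K * K' := by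
    have := integral_tail_mul_le (μ := μ) (T := fun ω => Z ω - Z₁ ω) (U := Y₁) hr hq hκ
      (by linarith) hZ' hY' hK' hK.le hα h' h htail htail0 hle
    calc _ = _ := by simp_rw [mul_comm]
      _ ≤ _ := this
      _ = _ := by ring
  have b4 : |∫ ω, (Y ω - Y₁ ω) * Z ω ∂μ| ≤ α ^ κ * K * K' :=
    integral_tail_mul_le (T := fun ω => Y ω - Y₁ ω) (U := Z) hq hr hκ hqr hY' hZ' hK hK'.le hα
      h h' htail htail0 fun _ => le_rfl
  have b2 : |(∫ ω, Y₁ ω ∂μ) * (∫ ω, 1 * (Z ω - Z₁ ω) ∂μ)| ≤ α ^ κ * K * K' := by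
    have hY1 : |∫ ω, Y₁ ω ∂μ| ≤ K :=
      ((h.congr_le hq hle).exponent_mono one_pos hq1 hY₁m).abs_integral_le hK.le
    have h1 : MomentBound μ q (fun _ : Ω => (1 : ℝ)) 1 := by
      rw [momentBound_iff hq]; simp
    have := integral_tail_mul_le (μ := μ) (T := fun ω => Z ω - Z₁ ω) (U := fun _ => 1) hr hq hκ
      (by linarith) hZ' measurable_const hK' zero_le_one hα h' h1 htail htail0 fun _ => le_rfl
    rw [abs_mul]
    simp only [mul_one, one_mul] at this ⊢
    calc _ ≤ K * (α ^ κ * K') := mul_le_mul hY1 this (abs_nonneg _) hK.le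
      _ = _ := by ring
  rw [key]
  refine (abs_add_le _ _).trans ?_
  refine (add_le_add ((abs_add_le _ _).trans (add_le_add ((abs_sub _ _).trans
    (add_le_add b1 b2)) b3)) b4).trans_eq ?_
  ring

/-- **Davydov's covariance inequality** for a centered factor. -/
theorem abs_integral_mul_le_of_mixing [IsProbabilityMeasure μ]
    (h𝒜 : 𝒜 ≤ mΩ) (hℬ : ℬ ≤ mΩ) {α K K' q r κ : ℝ}
    (hα : 0 ≤ α) (hK : 0 ≤ K) (hK' : 0 ≤ K') (hmix : mixingCoeff μ 𝒜 ℬ ≤ ENNReal.ofReal α)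
    (hq : 0 < q) (hr : 0 < r) (hκ : 0 < κ) (hqr : 1 / q + 1 / r + κ = 1) {Y Z : Ω → ℝ}
    (hY : Measurable[𝒜] Y) (hZ : Measurable[ℬ] Z)
    (h : MomentBound μ q Y K) (h' : MomentBound μ r Z K') (hZ0 : ∫ ω, Z ω ∂μ = 0) :
    |∫ ω, Y ω * Z ω ∂μ| ≤ 7 * α ^ κ * K * K' := by
  -- The truncation levels need `α`, `K`, `K'` positive; increase all three by `δ` and let `δ`
  -- decrease to 0.
  have hc : Continuous fun δ : ℝ => 7 * (α + δ) ^ κ * (K + δ) * (K' + δ) := by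
    have : Continuous fun δ : ℝ => (α + δ) ^ κ :=
      (continuous_const.add continuous_id).rpow_const fun _ => Or.inr hκ.le
    fun_prop
  have ht := (hc.tendsto 0).mono_left (nhdsWithin_le_nhds (s := Ioi 0))
  simp only [add_zero] at ht
  refine ge_of_tendsto ht ?_
  filter_upwards [self_mem_nhdsWithin] with δ (hδ : 0 < δ)
  exact abs_integral_mul_le_of_mixing_pos h𝒜 hℬ (by linarith) (by linarith) (by linarith)
    (hmix.trans (ENNReal.ofReal_le_ofReal (by linarith))) hq hr hκ hqr hY hZ
    (h.mono (by linarith)) (h'.mono (by linarith)) hZ0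

end Covariance

/-! ### Time integrals of random processes with continuous paths. -/

section ParametricIntegrals

variable {Ω : Type*} {mΩ : MeasurableSpace Ω} {μ : Measure Ω}

theorem measurable_uncurry_of_continuous_paths {Y : ℝ → Ω → ℝ} (hY : ∀ u, Measurable (Y u))
    (hc : ∀ ω, Continuous fun u => Y u ω) : Measurable (Function.uncurry Y) :=
  measurable_uncurry_of_continuous_of_measurable hc hY

theorem measurable_intervalIntegral {Y : ℝ → Ω → ℝ} (hY : ∀ u, Measurable (Y u))
    (hc : ∀ ω, Continuous fun u => Y u ω) (s t : ℝ) :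
    Measurable fun ω => ∫ u in s..t, Y u ω := by
  have h := (measurable_uncurry_of_continuous_paths hY hc).stronglyMeasurable
  simp only [intervalIntegral]
  exact (h.integral_prod_left'.sub h.integral_prod_left').measurable

/-- Minkowski's integral inequality for a uniform bound, from the power mean inequality on `[s, t]`
and Tonelli. -/
theorem MomentBound.intervalIntegral [SFinite μ] {p : ℝ} (hp : 1 ≤ p) {Y : ℝ → Ω → ℝ}
    (hY : ∀ u, Measurable (Y u)) (hc : ∀ ω, Continuous fun u => Y u ω) {s t K : ℝ} (hst : s ≤ t)
    (h : ∀ u ∈ Icc s t, MomentBound μ p (Y u) K) :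
    MomentBound μ p (fun ω => ∫ u in s..t, Y u ω) ((t - s) * K) := by
  have hp0 : 0 < p := by linarith
  have hm := measurable_uncurry_of_continuous_paths hY hc
  rw [momentBound_iff hp0]
  have hts : (0 : ℝ) ≤ t - s := by linarith
  have h1 : ∀ ω, ‖∫ u in s..t, Y u ω‖ₑ ^ p ≤
      ENNReal.ofReal (t - s) ^ (p - 1) * ∫⁻ u in Ioc s t, ‖Y u ω‖ₑ ^ p := by
    intro ω
    rw [intervalIntegral.integral_of_le hst]
    have h2 := eLpNorm'_le_eLpNorm'_mul_rpow_measure_univ (p := 1) (q := p) one_pos hp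
      (μ := volume.restrict (Ioc s t)) (f := fun u => Y u ω) (hc ω).aestronglyMeasurable
    simp only [eLpNorm', ENNReal.rpow_one, div_one, Measure.restrict_apply_univ,
      Real.volume_Ioc] at h2
    calc _ ≤ (∫⁻ u in Ioc s t, ‖Y u ω‖ₑ) ^ p := by
          gcongr; exact enorm_integral_le_lintegral_enorm _
      _ ≤ _ := by
          refine (ENNReal.rpow_le_rpow h2 hp0.le).trans_eq ?_
          rw [ENNReal.mul_rpow_of_nonneg _ _ hp0.le, ← ENNReal.rpow_mul, ← ENNReal.rpow_mul,
            one_div_mul_cancel hp0.ne', ENNReal.rpow_one, mul_comm]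
          congr 2
          field_simp
  calc ∫⁻ ω, ‖∫ u in s..t, Y u ω‖ₑ ^ p ∂μ
      ≤ ∫⁻ ω, ENNReal.ofReal (t - s) ^ (p - 1) * (∫⁻ u in Ioc s t, ‖Y u ω‖ₑ ^ p) ∂μ :=
        lintegral_mono h1
    _ = ENNReal.ofReal (t - s) ^ (p - 1) * ∫⁻ u in Ioc s t, ∫⁻ ω, ‖Y u ω‖ₑ ^ p ∂μ := by
        rw [lintegral_const_mul' _ _ (by simp [hp]), lintegral_lintegral_swap]
        exact ((hm.comp measurable_swap).enorm.pow_const p).aemeasurable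
    _ ≤ ENNReal.ofReal (t - s) ^ (p - 1) * ∫⁻ u in Ioc s t, ENNReal.ofReal K ^ p := by
        gcongr ENNReal.ofReal (t - s) ^ (p - 1) * ?_
        refine setLIntegral_mono measurable_const fun u hu => ?_
        exact (momentBound_iff hp0).1 (h u ⟨hu.1.le, hu.2⟩)
    _ = _ := by
        rw [setLIntegral_const, Real.volume_Ioc, ENNReal.ofReal_mul hts,
          ENNReal.mul_rpow_of_nonneg _ _ hp0.le, mul_left_comm, mul_comm]
        congr 1
        nth_rewrite 2 [← ENNReal.rpow_one (ENNReal.ofReal (t - s))]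
        rw [← ENNReal.rpow_add_of_nonneg _ _ (by linarith) zero_le_one]
        congr 1; ring

theorem integral_intervalIntegral [SFinite μ] {Y : ℝ → Ω → ℝ}
    (hY : ∀ u, Measurable (Y u)) (hc : ∀ ω, Continuous fun u => Y u ω) {s t K : ℝ} (hst : s ≤ t)
    (h : ∀ u ∈ Icc s t, MomentBound μ 1 (Y u) K) :
    ∫ ω, (∫ u in s..t, Y u ω) ∂μ = ∫ u in s..t, ∫ ω, Y u ω ∂μ := by
  have hm := measurable_uncurry_of_continuous_paths hY hc
  simp_rw [intervalIntegral.integral_of_le hst]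
  have hm' : Measurable (Function.uncurry fun ω u => Y u ω) := hm.comp measurable_swap
  refine integral_integral_swap ⟨hm'.aestronglyMeasurable, ?_⟩
  rw [hasFiniteIntegral_iff_enorm, lintegral_prod_symm' _ hm'.enorm]
  calc _ ≤ ∫⁻ u in Ioc s t, ENNReal.ofReal K := by
        refine setLIntegral_mono measurable_const fun u hu => ?_
        simpa using (momentBound_iff one_pos).1 (h u ⟨hu.1.le, hu.2⟩)
    _ < ∞ := by
        rw [setLIntegral_const]
        exact ENNReal.mul_lt_top ENNReal.ofReal_lt_top (by simp)

/-- The moment bound `K` only justifies Fubini; the estimate itself uses the expectations, which may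
be far smaller thanks to cancellation. -/
theorem abs_integral_intervalIntegral_le [SFinite μ] {Y : ℝ → Ω → ℝ}
    (hY : ∀ u, Measurable (Y u)) (hc : ∀ ω, Continuous fun u => Y u ω) {s t K C : ℝ} (hst : s ≤ t)
    (h : ∀ u ∈ Icc s t, MomentBound μ 1 (Y u) K) (hC : ∀ u ∈ Icc s t, |∫ ω, Y u ω ∂μ| ≤ C) :
    |∫ ω, (∫ u in s..t, Y u ω) ∂μ| ≤ C * (t - s) := by
  rw [integral_intervalIntegral hY hc hst h]
  have := intervalIntegral.norm_integral_le_of_norm_le_const (a := s) (b := t) (C := C)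
    (f := fun u => ∫ ω, Y u ω ∂μ) fun u hu => by
      rw [uIoc_of_le hst] at hu
      exact hC u ⟨hu.1.le, hu.2⟩
  rwa [abs_of_nonneg (by linarith : (0 : ℝ) ≤ t - s)] at this

theorem momentBound_of_integral_le {p B : ℝ} (hp : 0 < p) {X : Ω → ℝ}
    (hi : Integrable (fun ω => |X ω| ^ p) μ) (h : ∫ ω, |X ω| ^ p ∂μ ≤ B) :
    MomentBound μ p X (B ^ (1 / p)) := by
  have hB : 0 ≤ B := (integral_nonneg fun ω => by positivity).trans h
  rw [momentBound_iff hp, ENNReal.ofReal_rpow_of_nonneg (by positivity) hp.le, ← Real.rpow_mul hB,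
    one_div_mul_cancel hp.ne', Real.rpow_one]
  refine le_trans (le_of_eq ?_) (ENNReal.ofReal_le_ofReal h)
  rw [ofReal_integral_eq_lintegral_ofReal hi (.of_forall fun ω => by positivity)]
  congr 1 with ω
  rw [← ENNReal.ofReal_rpow_of_nonneg (abs_nonneg _) hp.le, ← Real.norm_eq_abs, ofReal_norm]

/-- Prepares the absorption argument: a bound on all of `I` deduced from `K` cannot be smaller than
`K`. The a priori constant `C` only ensures that the supremum is finite. -/
theorem exists_least_momentBound {ι : Type*} {p C : ℝ} {I : Set ι} {S : ι → Ω → ℝ}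
    (h : ∀ u ∈ I, MomentBound μ p (S u) C) :
    ∃ K, 0 ≤ K ∧ (∀ u ∈ I, MomentBound μ p (S u) K) ∧
      ∀ K', 0 ≤ K' → (∀ u ∈ I, MomentBound μ p (S u) K') → K ≤ K' := by
  have hfin : (⨆ u ∈ I, eLpNorm' (S u) p μ) ≠ ∞ :=
    ((iSup₂_le h).trans_lt ENNReal.ofReal_lt_top).ne
  refine ⟨(⨆ u ∈ I, eLpNorm' (S u) p μ).toReal, ENNReal.toReal_nonneg, fun u hu => ?_,
    fun K' hK' h' => ENNReal.toReal_le_of_le_ofReal hK' (iSup₂_le h')⟩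
  rw [MomentBound, ENNReal.ofReal_toReal hfin]
  exact le_iSup₂ (f := fun u _ => eLpNorm' (S u) p μ) u hu

/-- Hölder with exponents indexed by their reciprocals, which then simply add up. -/
theorem MomentBound.mul_one_div {x y : ℝ} (hx : 0 < x) (hy : 0 < y) {X Y : Ω → ℝ} {K K' : ℝ}
    (hK : 0 ≤ K) (hX : AEStronglyMeasurable X μ) (hY : AEStronglyMeasurable Y μ)
    (h : MomentBound μ (1 / x) X K) (h' : MomentBound μ (1 / y) Y K') :
    MomentBound μ (1 / (x + y)) (fun ω => X ω * Y ω) (K * K') :=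
  h.mul (by positivity) (by positivity) (by positivity) (by simp) hK hX hY h'

end ParametricIntegrals

/-- Used with `q = p - 2`; the condition `1 < q` is the source of the requirement `3 < p` below. -/
theorem hasDerivAt_abs_rpow_mul_self (x : ℝ) {q : ℝ} (hq : 1 < q) :
    HasDerivAt (fun x : ℝ => |x| ^ q * x) ((q + 1) * |x| ^ q) x := by
  refine ((hasDerivAt_abs_rpow x hq).mul (hasDerivAt_id x)).congr_deriv ?_
  rcases eq_or_ne x 0 with rfl | hx
  · simp [Real.zero_rpow (by linarith : q ≠ 0)]
  · have h1 : |x| ^ q = |x| ^ (q - 2) * x ^ 2 := by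
      rw [← sq_abs, ← Real.rpow_natCast |x| 2, ← Real.rpow_add (abs_pos.2 hx)]
      simp
    simp only [id_eq, h1]
    ring

/-! ### Mixing filtrations and covariances of the past with the present. -/

section MixingProcesses

variable {Ω : Type*} {mΩ : MeasurableSpace Ω}

theorem mixingCoeff_le_one {Ω : Type*} {𝒜 ℬ : MeasurableSpace Ω} [MeasurableSpace Ω]
    (μ : Measure Ω) [IsProbabilityMeasure μ] :
    mixingCoeff μ 𝒜 ℬ ≤ 1 := by
  refine iSup₂_le fun A _ => iSup₂_le fun B _ => ?_
  rw [ENNReal.ofReal_le_one]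
  have h1 : μ.real (A ∩ B) ≤ 1 := measureReal_le_one
  have h2 : μ.real A ≤ 1 := measureReal_le_one
  have h3 : μ.real B ≤ 1 := measureReal_le_one
  have h4 : 0 ≤ μ.real (A ∩ B) := measureReal_nonneg
  have h5 : 0 ≤ μ.real A := measureReal_nonneg
  have h6 : 0 ≤ μ.real B := measureReal_nonneg
  rw [abs_le]
  constructor <;> nlinarith

/-- An increasing family `𝓕` of σ-algebras (the past), and σ-algebras `𝓗 u` (the present at
time `u`) that become independent of the past at the integrable rate `β ^ κ`. -/
structure MixingFiltration (μ : Measure Ω) (𝓕 𝓗 : ℝ → MeasurableSpace Ω) (β : ℝ → ℝ≥0∞)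
    (κ L : ℝ) : Prop where
  le : ∀ u, 𝓕 u ≤ mΩ
  mono : Monotone 𝓕
  present_le : ∀ u, 𝓗 u ≤ 𝓕 u
  mixing : ∀ w u, w < u → mixingCoeff μ (𝓕 w) (𝓗 u) ≤ β (u - w)
  rate_nonneg : 0 ≤ L
  lintegral_rate : ∫⁻ h in Ioi (0 : ℝ), β h ^ κ ≤ ENNReal.ofReal L

/-- A continuous centered process adapted to `𝓗`, with `L^r` norms bounded by `K`. -/
structure CenteredProcess (μ : Measure Ω) (𝓗 : ℝ → MeasurableSpace Ω) (r : ℝ) (X : ℝ → Ω → ℝ)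
    (K : ℝ) : Prop where
  meas : ∀ u, Measurable[𝓗 u] (X u)
  cont : ∀ ω, Continuous fun u => X u ω
  centered : ∀ u, ∫ ω, X u ω ∂μ = 0
  nonneg : 0 ≤ K
  bound : ∀ u, MomentBound μ r (X u) K

variable {μ : Measure Ω} {𝓕 𝓗 : ℝ → MeasurableSpace Ω} {β : ℝ → ℝ≥0∞}
  {κ L : ℝ}

theorem CenteredProcess.measurable {r K : ℝ} {X : ℝ → Ω → ℝ} (hX : CenteredProcess μ 𝓗 r X K)
    (hM : MixingFiltration μ 𝓕 𝓗 β κ L) (u : ℝ) : Measurable (X u) :=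
  (hX.meas u).mono ((hM.present_le u).trans (hM.le u)) le_rfl

theorem CenteredProcess.adapted {r K : ℝ} {X : ℝ → Ω → ℝ} (hX : CenteredProcess μ 𝓗 r X K)
    (hM : MixingFiltration μ 𝓕 𝓗 β κ L) (u : ℝ) : Measurable[𝓕 u] (X u) :=
  (hX.meas u).mono (hM.present_le u) le_rfl

theorem measurable_primitive (hM : MixingFiltration μ 𝓕 𝓗 β κ L) {Y : ℝ → Ω → ℝ} {s : ℝ}
    (hY : ∀ u, s ≤ u → Measurable[𝓕 u] (Y u)) (hc : ∀ ω, Continuous fun u => Y u ω) {t : ℝ}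
    (hst : s ≤ t) : Measurable[𝓕 t] fun ω => ∫ u in s..t, Y u ω := by
  -- Clamping the time to `[s, t]` leaves the integral unchanged and makes the integrand `𝓕
  -- t`-measurable at every time.
  have h1 : (fun ω => ∫ u in s..t, Y u ω) = fun ω => ∫ u in s..t, Y (max s (min u t)) ω := by
    ext ω
    refine intervalIntegral.integral_congr fun u hu => ?_
    rw [uIcc_of_le hst] at hu
    simp [hu.1, hu.2]
  rw [h1]
  refine measurable_intervalIntegral (mΩ := 𝓕 t) (Y := fun u => Y (max s (min u t)))
    (fun u => (hY _ (le_max_left _ _)).mono (hM.mono ?_) le_rfl) (fun ω => ?_) s t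
  · exact max_le hst (min_le_right _ _)
  · exact (hc ω).comp (by fun_prop)

/-- The covariance of the primitive of an adapted process with the present. -/
theorem abs_integral_primitive_mul_le [IsProbabilityMeasure μ]
    (hM : MixingFiltration μ 𝓕 𝓗 β κ L) {q r : ℝ}
    (hq : 0 < q) (hr : 0 < r) (hκ : 0 < κ) (hqr : 1 / q + 1 / r + κ = 1) {Y : ℝ → Ω → ℝ}
    {Z : Ω → ℝ} {s t K K' : ℝ} (hst : s ≤ t) (hY : ∀ u, Measurable (Y u))
    (hYa : ∀ u, s ≤ u → Measurable[𝓕 u] (Y u))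
    (hc : ∀ ω, Continuous fun u => Y u ω) (hZ : Measurable[𝓗 t] Z) (hZ0 : ∫ ω, Z ω ∂μ = 0)
    (hK : 0 ≤ K) (hK' : 0 ≤ K') (h : ∀ u ∈ Icc s t, MomentBound μ q (Y u) K)
    (h' : MomentBound μ r Z K') :
    |∫ ω, (∫ u in s..t, Y u ω) * Z ω ∂μ| ≤ 7 * K * K' * L := by
  have hZm : Measurable Z := hZ.mono ((hM.present_le t).trans (hM.le t)) le_rfl
  have hL := hM.rate_nonneg
  have h1q : 0 < 1 / q := by positivity
  have h1r : 0 < 1 / r := by positivity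
  -- Since `1/q + 1/r = 1 - κ < 1`, the products are bounded in `L¹`; this serves only to exchange
  -- the integrals.
  have hb : ∀ u ∈ Icc s t, MomentBound μ 1 (fun ω => Y u ω * Z ω) (K * K') := by
    intro u hu
    have := (h u hu).mul (p := 1 / (1 / q + 1 / r)) (by positivity) hq hr (by simp) hK
      (hY u).aestronglyMeasurable hZm.aestronglyMeasurable h'
    refine this.exponent_mono one_pos ?_ ((hY u).mul hZm).aestronglyMeasurable
    rw [one_le_div (by positivity)]
    linarith
  simp_rw [← intervalIntegral.integral_mul_const]
  rw [integral_intervalIntegral (Y := fun u ω => Y u ω * Z ω) (fun u => (hY u).mul hZm)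
    (fun ω => (hc ω).mul continuous_const) hst hb, intervalIntegral.integral_of_le hst,
    ← ENNReal.ofReal_le_ofReal_iff (by positivity), ← Real.norm_eq_abs, ofReal_norm]
  refine (enorm_integral_le_lintegral_enorm _).trans ?_
  have hcov : ∀ u ∈ Ioo s t, ‖∫ ω, Y u ω * Z ω ∂μ‖ₑ ≤
      ENNReal.ofReal (7 * K * K') * β (t - u) ^ κ := by
    intro u hu
    have hfin : mixingCoeff μ (𝓕 u) (𝓗 t) ≠ ∞ :=
      ((mixingCoeff_le_one μ).trans_lt ENNReal.one_lt_top).ne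
    have := abs_integral_mul_le_of_mixing (hM.le u) ((hM.present_le t).trans (hM.le t))
      (α := (mixingCoeff μ (𝓕 u) (𝓗 t)).toReal) ENNReal.toReal_nonneg hK hK'
      (ENNReal.ofReal_toReal hfin).ge hq hr hκ hqr (hYa u hu.1.le) hZ
        (h u ⟨hu.1.le, hu.2.le⟩) h' hZ0
    rw [← ofReal_norm, Real.norm_eq_abs]
    refine (ENNReal.ofReal_le_ofReal this).trans ?_
    rw [show 7 * (mixingCoeff μ (𝓕 u) (𝓗 t)).toReal ^ κ * K * K'
      = 7 * K * K' * (mixingCoeff μ (𝓕 u) (𝓗 t)).toReal ^ κ by ring,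
      ENNReal.ofReal_mul (by positivity),
        ← ENNReal.ofReal_rpow_of_nonneg ENNReal.toReal_nonneg hκ.le,
      ENNReal.ofReal_toReal hfin]
    gcongr
    exact hM.mixing u t hu.2
  -- The mixing bound holds only for `u < t`, so the endpoint, a null set, is discarded.
  rw [← restrict_Ioo_eq_restrict_Ioc]
  calc ∫⁻ u in Ioo s t, ‖∫ ω, Y u ω * Z ω ∂μ‖ₑ
      ≤ ∫⁻ u in Ioo s t, ENNReal.ofReal (7 * K * K') * β (t - u) ^ κ :=
        setLIntegral_mono' measurableSet_Ioo hcov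
    _ = ENNReal.ofReal (7 * K * K') * ∫⁻ u in Ioo s t, β (t - u) ^ κ :=
        lintegral_const_mul' _ _ ENNReal.ofReal_ne_top
    _ ≤ ENNReal.ofReal (7 * K * K') * ∫⁻ h in Ioi (0 : ℝ), β h ^ κ := by
        refine mul_le_mul' le_rfl ?_
        -- Reflection `h = t - u`, which sends `(s, t)` into the positive half-line.
        rw [← lintegral_indicator measurableSet_Ioo, ← lintegral_indicator measurableSet_Ioi,
          ← lintegral_sub_left_eq_self ((Ioi (0 : ℝ)).indicator fun h => β h ^ κ) t]
        refine lintegral_mono fun u => ?_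
        by_cases hu : u ∈ Ioo s t
        · rw [indicator_of_mem hu, indicator_of_mem (by simpa using hu.2)]
        · rw [indicator_of_notMem hu]; exact zero_le
    _ ≤ ENNReal.ofReal (7 * K * K') * ENNReal.ofReal L := by
        gcongr; exact hM.lintegral_rate
    _ = _ := (ENNReal.ofReal_mul (by positivity)).symm

end MixingProcesses

/-! ### Moment bounds for simple and iterated time integrals of mixing processes. -/

section IntegratedMoments

variable {Ω : Type*} {mΩ : MeasurableSpace Ω} {μ : Measure Ω} {𝓕 𝓗 : ℝ → MeasurableSpace Ω}
  {β : ℝ → ℝ≥0∞} {κ L : ℝ}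

theorem continuous_primitive {f : ℝ → ℝ} (hf : Continuous f) (s : ℝ) :
    Continuous fun u => ∫ w in s..u, f w :=
  intervalIntegral.continuous_primitive (fun a b => hf.intervalIntegrable a b) s

theorem hasDerivAt_primitive {f : ℝ → ℝ} (hf : Continuous f) (s u : ℝ) :
    HasDerivAt (fun u => ∫ w in s..u, f w) (f u) u :=
  intervalIntegral.integral_hasDerivAt_right (hf.intervalIntegrable _ _)
    (hf.stronglyMeasurableAtFilter _ _) hf.continuousAt

/-- The fundamental theorem of calculus for `|S|^p`: under the expectation it isolates the present
factor `f u`, against which mixing is used. -/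
theorem abs_rpow_primitive {f : ℝ → ℝ} (hf : Continuous f) {p : ℝ} (hp : 2 < p) (s t : ℝ) :
    |∫ w in s..t, f w| ^ p
      = ∫ u in s..t, p * ((|∫ w in s..u, f w| ^ (p - 2) * ∫ w in s..u, f w) * f u) := by
  have hc := continuous_primitive hf s
  have hp' := hc.abs.rpow_const (p := p - 2) fun _ => Or.inr (by linarith)
  have h := intervalIntegral.integral_eq_sub_of_hasDerivAt (a := s) (b := t)
    (f := fun u => |∫ w in s..u, f w| ^ p)
    (f' := fun u => p * ((|∫ w in s..u, f w| ^ (p - 2) * ∫ w in s..u, f w) * f u))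
    (fun u _ => ((hasDerivAt_abs_rpow _ (by linarith)).comp u
      (hasDerivAt_primitive hf s u)).congr_deriv (by ring))
    ((continuous_const.mul ((hp'.mul hc).mul hf)).intervalIntegrable _ _)
  rw [h]
  simp [Real.zero_rpow (by linarith : p ≠ 0)]

/-- Product rule for a signed power of one primitive times another. It exhibits the cofactor of the
present in the iterated integral as a primitive of past quantities. -/
theorem signed_rpow_mul_primitive {f g : ℝ → ℝ} (hf : Continuous f) (hg : Continuous g) {q : ℝ}
    (hq : 1 < q) (s t : ℝ) :
    (|∫ w in s..t, f w| ^ q * ∫ w in s..t, f w) * (∫ w in s..t, g w)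
      = ∫ u in s..t, ((q + 1) * |∫ w in s..u, f w| ^ q * f u * (∫ w in s..u, g w)
        + (|∫ w in s..u, f w| ^ q * ∫ w in s..u, f w) * g u) := by
  have hcf := continuous_primitive hf s
  have hcg := continuous_primitive hg s
  have hpf := hcf.abs.rpow_const (p := q) fun _ => Or.inr (by linarith)
  have h := intervalIntegral.integral_eq_sub_of_hasDerivAt (a := s) (b := t)
    (f := fun u => (|∫ w in s..u, f w| ^ q * ∫ w in s..u, f w) * (∫ w in s..u, g w))
    (f' := fun u => (q + 1) * |∫ w in s..u, f w| ^ q * f u * (∫ w in s..u, g w)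
        + (|∫ w in s..u, f w| ^ q * ∫ w in s..u, f w) * g u)
    (fun u _ => ((hasDerivAt_abs_rpow_mul_self _ hq).comp u
      (hasDerivAt_primitive hf s u)).mul (hasDerivAt_primitive hg s u))
    (((((continuous_const.mul hpf).mul hf).mul hcg).add
      ((hpf.mul hcf).mul hg)).intervalIntegrable _ _)
  rw [h]
  simp

theorem signed_rpow_primitive {f : ℝ → ℝ} (hf : Continuous f) {q : ℝ}
    (hq : 1 < q) (s t : ℝ) :
    |∫ w in s..t, f w| ^ q * ∫ w in s..t, f w
      = ∫ u in s..t, (q + 1) * |∫ w in s..u, f w| ^ q * f u := by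
  have hcf := continuous_primitive hf s
  have hpf := hcf.abs.rpow_const (p := q) fun _ => Or.inr (by linarith)
  have h := intervalIntegral.integral_eq_sub_of_hasDerivAt (a := s) (b := t)
    (f := fun u => |∫ w in s..u, f w| ^ q * ∫ w in s..u, f w)
    (f' := fun u => (q + 1) * |∫ w in s..u, f w| ^ q * f u)
    (fun u _ => (hasDerivAt_abs_rpow_mul_self _ hq).comp u (hasDerivAt_primitive hf s u))
    (((continuous_const.mul hpf).mul hf).intervalIntegrable _ _)
  rw [h]
  simp

theorem measurable_signed_rpow {Ω : Type*} {m : MeasurableSpace Ω} {f g : Ω → ℝ} (c q : ℝ)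
    (hf : Measurable f) (hg : Measurable g) : Measurable fun ω => c * |f ω| ^ q * g ω :=
  ((hf.abs.pow_const _).const_mul _).mul hg

theorem MomentBound.rpow_one_div {p θ : ℝ} (hp : 0 < p) (hθ : 0 < θ) {X : Ω → ℝ} {K : ℝ}
    (hK : 0 ≤ K) (h : MomentBound μ p X K) :
    MomentBound μ (1 / (θ / p)) (fun ω => |X ω| ^ θ) (K ^ θ) := by
  refine MomentBound.rpow (by positivity) hθ hK ?_
  rwa [show θ * (1 / (θ / p)) = p by field_simp]

theorem MomentBound.signed_rpow {p θ : ℝ} (hp : 0 < p) (hθ : 1 < θ) {X : Ω → ℝ} {K : ℝ}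
    (hK : 0 ≤ K) (h : MomentBound μ p X K) :
    MomentBound μ (1 / (θ / p)) (fun ω => |X ω| ^ (θ - 1) * X ω) (K ^ θ) := by
  refine (h.rpow_one_div hp (by linarith : 0 < θ) hK).congr_le (by positivity) fun ω => ?_
  have h0 : |X ω| ^ θ = |X ω| ^ (θ - 1) * |X ω| := by
    rcases eq_or_ne (X ω) 0 with h | h
    · simp [h, Real.zero_rpow (by linarith : θ ≠ 0)]
    · rw [← Real.rpow_add_one (abs_pos.2 h).ne']; simp
  rw [h0, abs_mul, abs_mul, abs_abs]

theorem CenteredProcess.primitive_measurable {r K : ℝ} {X : ℝ → Ω → ℝ}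
    (hX : CenteredProcess μ 𝓗 r X K) (hM : MixingFiltration μ 𝓕 𝓗 β κ L) (s t : ℝ) :
    Measurable fun ω => ∫ u in s..t, X u ω :=
  measurable_intervalIntegral (hX.measurable hM) hX.cont s t

/-- If the `p`-th moments of the primitive of `Y` are controlled, in terms of the least bound `K`
for these moments, by the expectations of the derivatives, then they are bounded. -/
theorem rpow_le_of_least_momentBound [IsProbabilityMeasure μ] {p : ℝ} (hp : 2 < p) {Y : ℝ → Ω → ℝ}
    (hY : ∀ u, Measurable (Y u)) (hc : ∀ ω, Continuous fun u => Y u ω) {s T K C D : ℝ}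
    (hT : s ≤ T) (hK : 0 ≤ K) (hbY : ∀ u ∈ Icc s T, MomentBound μ p (Y u) C)
    (hbd : ∀ t ∈ Icc s T, MomentBound μ p (fun ω => ∫ u in s..t, Y u ω) K)
    (hleast : ∀ K', 0 ≤ K' →
      (∀ t ∈ Icc s T, MomentBound μ p (fun ω => ∫ u in s..t, Y u ω) K') → K ≤ K')
    (hD0 : 0 ≤ D)
    (hD : ∀ u ∈ Icc s T, |∫ ω, (|∫ w in s..u, Y w ω| ^ (p - 2) * ∫ w in s..u, Y w ω) * Y u ω ∂μ|
      ≤ D) :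
    K ^ p ≤ p * D * (T - s) := by
  have hp0 : 0 < p := by linarith
  have hSm : ∀ u, Measurable fun ω => ∫ w in s..u, Y w ω :=
    fun u => measurable_intervalIntegral hY hc s u
  have hB : 0 ≤ p * D * (T - s) := mul_nonneg (by positivity) (by linarith)
  -- By minimality of `K` it suffices that `(p D (T-s))^{1/p}` bounds the primitive at every time of
  -- `[s, T]`.
  have hle := hleast ((p * D * (T - s)) ^ (1 / p)) (by positivity) fun t ht => ?_
  · calc K ^ p ≤ ((p * D * (T - s)) ^ (1 / p)) ^ p := Real.rpow_le_rpow hK hle hp0.le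
      _ = _ := by rw [← Real.rpow_mul hB, one_div_mul_cancel hp0.ne', Real.rpow_one]
  have hi : Integrable (fun ω => |∫ u in s..t, Y u ω| ^ p) μ := by
    have := ((hbd t ht).memLp hp0 (hSm t).aestronglyMeasurable).integrable_norm_rpow
      (by simpa using hp0) ENNReal.ofReal_ne_top
    simpa [ENNReal.toReal_ofReal hp0.le] using this
  refine momentBound_of_integral_le hp0 hi ?_
  simp_rw [abs_rpow_primitive (hc _) hp s t]
  refine (le_abs_self _).trans ?_
  have := abs_integral_intervalIntegral_le (μ := μ) (s := s) (t := t) (C := p * D)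
    (K := |p| * (K ^ (p - 1) * C))
    (Y := fun u ω => p * ((|∫ w in s..u, Y w ω| ^ (p - 2) * ∫ w in s..u, Y w ω) * Y u ω))
    (fun u => ((((hSm u).abs.pow_const _).mul (hSm u)).mul (hY u)).const_mul p)
    (fun ω => ?_) ht.1 (fun u hu => ?_) (fun u hu => ?_)
  · refine this.trans (mul_le_mul_of_nonneg_left (by linarith [ht.2]) (by positivity))
  · have hcf := continuous_primitive (hc ω) s
    have hpf := hcf.abs.rpow_const (p := p - 2) fun _ => Or.inr (by linarith)
    exact continuous_const.mul ((hpf.mul hcf).mul (hc ω))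
  · refine MomentBound.const_mul one_pos p ?_
    have h1 := (hbd u ⟨hu.1, hu.2.trans ht.2⟩).signed_rpow hp0 (θ := p - 1) (by linarith) hK
    have h2 := hbY u ⟨hu.1, hu.2.trans ht.2⟩
    rw [← one_div_one_div p] at h2
    have h3 := h1.mul_one_div (div_pos (by linarith) hp0) (by positivity) (by positivity)
      (((hSm u).abs.pow_const _).mul (hSm u)).aestronglyMeasurable (hY u).aestronglyMeasurable h2
    rw [show (p - 1) / p + 1 / p = 1 by field_simp; ring, div_one] at h3
    rwa [show p - 1 - 1 = p - 2 by ring] at h3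
  · rw [integral_const_mul, abs_mul, abs_of_pos hp0]
    exact mul_le_mul_of_nonneg_left (hD u ⟨hu.1, hu.2.trans ht.2⟩) hp0.le

/-- Moments of the time integral of a centered mixing process. -/
theorem CenteredProcess.momentBound_primitive [IsProbabilityMeasure μ] {r K p : ℝ} {X : ℝ → Ω → ℝ}
    (hX : CenteredProcess μ 𝓗 r X K) (hM : MixingFiltration μ 𝓕 𝓗 β κ L) (hκ : 0 < κ)
    (hr : 0 < r) (hp : 3 < p) (hpr : κ + 2 / r = 2 / p) {s t : ℝ} (hst : s ≤ t) :
    MomentBound μ p (fun ω => ∫ u in s..t, X u ω)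
      (√(7 * p * (p - 1) * K ^ 2 * L * (t - s))) := by
  have hL := hM.rate_nonneg
  have hK := hX.nonneg
  have hp0 : 0 < p := by linarith
  have hpr' : p ≤ r := by
    have : 2 / r ≤ 2 / p := by linarith
    rwa [div_le_div_iff_of_pos_left two_pos hr hp0] at this
  have hXm := hX.measurable hM
  have hSm := hX.primitive_measurable hM s
  have hXb : ∀ u, MomentBound μ p (X u) K := fun u =>
    (hX.bound u).exponent_mono hp0 hpr' (hXm u).aestronglyMeasurable
  obtain ⟨A, hA0, hA, hleast⟩ := exists_least_momentBound (μ := μ) (p := p) (I := Icc s t)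
    (S := fun u ω => ∫ w in s..u, X w ω) (C := (t - s) * K) fun u hu =>
      (MomentBound.intervalIntegral (by linarith) hXm hX.cont hu.1 fun w _ => hXb w).mono
        (mul_le_mul_of_nonneg_right (by linarith [hu.2]) hK)
  -- In `D`, the factor `(p-1) A^{p-2} K` bounds the differentiated signed power by Hölder; `7 K L`
  -- comes from its covariance with the present.
  have key := rpow_le_of_least_momentBound (μ := μ) (by linarith) hXm hX.cont hst hA0
    (fun u _ => hXb u) hA hleast (D := 7 * ((p - 1) * (A ^ (p - 2) * K)) * K * L)
    (mul_nonneg (mul_nonneg (mul_nonneg (by norm_num) (mul_nonneg (by linarith)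
      (mul_nonneg (by positivity) hK))) hK) hL) fun u hu => ?_
  · refine (hA t ⟨hst, le_rfl⟩).mono (Real.le_sqrt_of_sq_le ?_)
    -- Dividing by `A^{p-2}` requires `A > 0`; for `A = 0` the claim is trivial.
    rcases hA0.eq_or_lt with h0 | h0
    · rw [← h0, zero_pow two_ne_zero]
      exact mul_nonneg (mul_nonneg (mul_nonneg (mul_nonneg (by linarith) (by linarith))
        (by positivity)) hL) (by linarith)
    · have h1 : A ^ p = A ^ (p - 2) * A ^ 2 := by
        rw [← Real.rpow_natCast A 2, ← Real.rpow_add h0]; simp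
      have h2 : 0 < A ^ (p - 2) := by positivity
      rw [h1] at key
      refine le_of_mul_le_mul_left (key.trans_eq ?_) h2
      ring
  -- Second differentiation: the cofactor of `X u` becomes the primitive of a process adapted to the
  -- past.
  · simp_rw [signed_rpow_primitive (hX.cont _) (by linarith : 1 < p - 2)]
    have hq : 0 < (p - 2) / p + 1 / r := by
      have : 0 < (p - 2) / p := div_pos (by linarith) hp0
      positivity
    have hm : ∀ u, Measurable fun ω => |∫ w in s..u, X w ω| ^ (p - 2) :=
      fun u => (hSm u).abs.pow_const _
    -- The exponent `q` is that of a product of `|S|^{p-2}`, with `S` in `L^p`, and `X` in `L^r`;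
    -- then `1/q + 1/r + κ = 1` is exactly `κ + 2/r = 2/p`.
    refine abs_integral_primitive_mul_le hM (q := 1 / ((p - 2) / p + 1 / r)) (r := r)
      (Y := fun u ω => (p - 2 + 1) * |∫ w in s..u, X w ω| ^ (p - 2) * X u ω)
      (by positivity) hr hκ ?_ hu.1 (fun w => ((hm w).const_mul _).mul (hXm w)) (fun w hw => ?_)
      (fun ω => ?_) (hX.meas u) (hX.centered u)
      (mul_nonneg (by linarith) (mul_nonneg (by positivity) hK)) hK (fun w hw => ?_) (hX.bound u)
    · rw [one_div_one_div, sub_div, div_self hp0.ne']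
      linear_combination hpr
    · have h1 := measurable_primitive hM (fun u _ => hX.adapted hM u) hX.cont hw
      exact measurable_signed_rpow _ _ h1 (hX.adapted hM w)
    · have hcf := continuous_primitive (hX.cont ω) s
      have hpf := hcf.abs.rpow_const (p := p - 2) fun _ => Or.inr (by linarith)
      exact (continuous_const.mul hpf).mul (hX.cont ω)
    · have h1 := (hA w ⟨hw.1, hw.2.trans hu.2⟩).rpow_one_div hp0
        (by linarith : 0 < p - 2) hA0
      have h2 := hX.bound w
      rw [← one_div_one_div r] at h2
      have h3 := h1.mul_one_div (div_pos (by linarith) hp0) (by positivity) (by positivity)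
        (hm w).aestronglyMeasurable (hXm w).aestronglyMeasurable h2
      have h4 := h3.const_mul (by positivity) (p - 1)
      rw [abs_of_nonneg (by linarith)] at h4
      convert h4 using 2 with ω
      ring

set_option maxHeartbeats 1000000 in
/-- Moments of the iterated time integral of two centered mixing processes. -/
theorem CenteredProcess.momentBound_iterated [IsProbabilityMeasure μ] {r K K' p : ℝ}
    {X Y : ℝ → Ω → ℝ} (hX : CenteredProcess μ 𝓗 r X K) (hY : CenteredProcess μ 𝓗 r Y K')
    (hM : MixingFiltration μ 𝓕 𝓗 β κ L) (hκ : 0 < κ)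
    (hr : 0 < r) (hp : 3 < p) (hpr : κ + 2 / r = 1 / p) {s t : ℝ} (hst : s ≤ t) :
    MomentBound μ p (fun ω => ∫ u in s..t, (∫ w in s..u, X w ω) * Y u ω)
      ((98 * p ^ 2 * (p - 1) * (2 * p - 1) + 7 * p + 1) * (K * K' * L * (t - s))) := by
  have hL := hM.rate_nonneg
  have hK := hX.nonneg
  have hK' := hY.nonneg
  have hp0 : 0 < p := by linarith
  have hts : 0 ≤ t - s := by linarith
  have h2pr : 2 * p ≤ r := by
    have : 1 / r * 2 ≤ 1 / p := by rw [← hpr]; ring_nf; linarith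
    rw [div_mul_eq_mul_div, div_le_div_iff₀ hr hp0] at this
    linarith
  have hXm := hX.measurable hM
  have hYm := hY.measurable hM
  have hSm := hX.primitive_measurable hM s
  have hXb : ∀ u, MomentBound μ (1 / (1 / r)) (X u) K := fun u => by
    rw [one_div_one_div]; exact hX.bound u
  have hYb : ∀ u, MomentBound μ (1 / (1 / r)) (Y u) K' := fun u => by
    rw [one_div_one_div]; exact hY.bound u
  -- `D₀` bounds the inner primitive in `L^{2p}`: the present condition `κ + 2/r = 1/p` is that of
  -- the simple integral at exponent `2p`.
  set D₀ := √(7 * (2 * p) * (2 * p - 1) * K ^ 2 * L * (t - s)) with hD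
  have hD0 : 0 ≤ D₀ := Real.sqrt_nonneg _
  have hD2 : D₀ ^ 2 = 7 * (2 * p) * (2 * p - 1) * K ^ 2 * L * (t - s) := by
    refine Real.sq_sqrt (mul_nonneg (mul_nonneg (mul_nonneg (mul_nonneg ?_ ?_) ?_) hL) hts)
    · linarith
    · linarith
    · positivity
  have hSb : ∀ u ∈ Icc s t, MomentBound μ (1 / (1 / (2 * p))) (fun ω => ∫ w in s..u, X w ω) D₀ := by
    intro u hu
    rw [one_div_one_div]
    refine (hX.momentBound_primitive hM hκ hr (by linarith) ?_ hu.1).mono (Real.sqrt_le_sqrt ?_)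
    · rw [hpr]; field_simp
    · refine mul_le_mul_of_nonneg_left (by linarith [hu.2])
        (mul_nonneg (mul_nonneg (mul_nonneg ?_ ?_) ?_) hL)
      · linarith
      · linarith
      · positivity
  have hZm : ∀ u, Measurable fun ω => (∫ w in s..u, X w ω) * Y u ω := fun u => (hSm u).mul (hYm u)
  have hZc : ∀ ω, Continuous fun u => (∫ w in s..u, X w ω) * Y u ω := fun ω =>
    (continuous_primitive (hX.cont ω) s).mul (hY.cont ω)
  have hZb : ∀ u ∈ Icc s t, MomentBound μ (1 / (1 / (2 * p) + 1 / r))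
      (fun ω => (∫ w in s..u, X w ω) * Y u ω) (D₀ * K') := fun u hu =>
    (hSb u hu).mul_one_div (by positivity) (by positivity) hD0 (hSm u).aestronglyMeasurable
      (hYm u).aestronglyMeasurable (hYb u)
  have hZb' : ∀ u ∈ Icc s t, MomentBound μ p
      (fun ω => (∫ w in s..u, X w ω) * Y u ω) (D₀ * K') := fun u hu => by
    refine (hZb u hu).exponent_mono hp0 ?_ (hZm u).aestronglyMeasurable
    rw [le_one_div hp0 (by positivity)]
    have : 1 / r ≤ 1 / (2 * p) := one_div_le_one_div_of_le (by positivity) h2pr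
    have h2 : 1 / p = 1 / (2 * p) + 1 / (2 * p) := by field_simp; norm_num
    linarith
  set M : ℝ → Ω → ℝ := fun u ω => ∫ w in s..u, (∫ w' in s..w, X w' ω) * Y w ω with hMdef
  have hMm : ∀ u, Measurable (M u) := fun u => measurable_intervalIntegral hZm hZc s u
  obtain ⟨A, hA0, hA, hleast⟩ := exists_least_momentBound (μ := μ) (p := p) (I := Icc s t)
    (S := M) (C := (t - s) * (D₀ * K')) fun u hu =>
      (MomentBound.intervalIntegral (by linarith) hZm hZc hu.1 fun w hw =>
        hZb' w ⟨hw.1, hw.2.trans hu.2⟩).mono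
        (mul_le_mul_of_nonneg_right (by linarith [hu.2]) (by positivity))
  -- The two terms of `Q` correspond to those of the product rule for `|M|^{p-2} M S`:
  -- differentiating the signed power yields `|M|^{p-2} (S Y) S`, differentiating `S` yields
  -- `|M|^{p-2} M X`.
  set Q := (p - 1) * (A ^ (p - 2) * D₀ * K' * D₀) + A ^ (p - 1) * K with hQ
  have hQ0 : 0 ≤ Q := add_nonneg (mul_nonneg (by linarith) (by positivity)) (by positivity)
  have key := rpow_le_of_least_momentBound (μ := μ) (by linarith) hZm hZc hst hA0
    hZb' hA hleast (D := 7 * Q * K' * L) (by positivity) fun u hu => ?_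
  · set w := K * K' * L * (t - s) with hw
    have hw0 : 0 ≤ w := by positivity
    have hc1 : 0 ≤ 98 * p ^ 2 * (p - 1) * (2 * p - 1) :=
      mul_nonneg (mul_nonneg (by positivity) (by linarith)) (by linarith)
    refine (hA t ⟨hst, le_rfl⟩).mono ?_
    rcases hA0.eq_or_lt with h0 | h0
    · rw [← h0]; positivity
    have h1 : A ^ p = A ^ (p - 2) * A ^ 2 := by
      rw [← Real.rpow_natCast A 2, ← Real.rpow_add h0]; simp
    have h1' : A ^ (p - 1) = A ^ (p - 2) * A := by
      rw [← Real.rpow_add_one h0.ne']; congr 1; ring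
    have h2 : 0 < A ^ (p - 2) := by positivity
    -- Divide by `A^{p-2}` and insert `D₀²`; the constant is `98 = 7 · 7 · 2`. What remains is
    -- quadratic in `A`.
    have h3 : A ^ 2 ≤ (98 * p ^ 2 * (p - 1) * (2 * p - 1)) * w ^ 2 + 7 * p * w * A := by
      rw [h1] at key
      refine le_of_mul_le_mul_left (key.trans_eq ?_) h2
      rw [hQ, h1', hw]
      linear_combination (p * 7 * (p - 1) * A ^ (p - 2) * K' ^ 2 * L * (t - s)) * hD2
    -- If the bound failed, then `w ≤ A`, so `w²` may be replaced by `w A`; dividing by `A`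
    -- contradicts the failure.
    by_contra! hlt
    have hAw : w ≤ A := by nlinarith
    have h4 : A * A ≤ ((98 * p ^ 2 * (p - 1) * (2 * p - 1) + 7 * p) * w) * A := by
      have : (98 * p ^ 2 * (p - 1) * (2 * p - 1)) * w * w
          ≤ (98 * p ^ 2 * (p - 1) * (2 * p - 1)) * w * A :=
        mul_le_mul_of_nonneg_left hAw (mul_nonneg hc1 hw0)
      nlinarith
    have h5 := le_of_mul_le_mul_right h4 h0
    nlinarith
  -- Only `Y u` is kept as the present; the factor `S u` is absorbed, with the signed power of `M
  -- u`, into the primitive of a past process.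
  · have e : ∀ ω, (|M u ω| ^ (p - 2) * M u ω) * ((∫ w in s..u, X w ω) * Y u ω)
        = (∫ v in s..u, ((p - 2 + 1) * |M v ω| ^ (p - 2) * ((∫ w in s..v, X w ω) * Y v ω)
          * (∫ w in s..v, X w ω) + (|M v ω| ^ (p - 2) * M v ω) * X v ω)) * Y u ω := fun ω => by
      rw [← mul_assoc, hMdef, signed_rpow_mul_primitive (hZc ω) (hX.cont ω) (by linarith)]
    refine le_of_eq_of_le (congrArg abs (integral_congr_ae (.of_forall e))) ?_
    have hq : 0 < (p - 1) / p + 1 / r := by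
      have : 0 < (p - 1) / p := div_pos (by linarith) hp0
      positivity
    have hMp : ∀ u, Measurable fun ω => |M u ω| ^ (p - 2) := fun u => (hMm u).abs.pow_const _
    have hm1 : ∀ v, Measurable fun ω => (p - 2 + 1) * |M v ω| ^ (p - 2)
        * ((∫ w in s..v, X w ω) * Y v ω) * (∫ w in s..v, X w ω) := fun v =>
      (((hMp v).const_mul _).mul (hZm v)).mul (hSm v)
    have hm2 : ∀ v, Measurable fun ω => (|M v ω| ^ (p - 2) * M v ω) * X v ω := fun v =>
      ((hMp v).mul (hMm v)).mul (hXm v)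
    refine abs_integral_primitive_mul_le hM (q := 1 / ((p - 1) / p + 1 / r)) (r := r)
      (K := Q) (Y := fun v ω => (p - 2 + 1) * |M v ω| ^ (p - 2) * ((∫ w in s..v, X w ω) * Y v ω)
          * (∫ w in s..v, X w ω) + (|M v ω| ^ (p - 2) * M v ω) * X v ω)
      (by positivity) hr hκ ?_ hu.1 (fun w => (hm1 w).add (hm2 w)) (fun v hv => ?_)
      (fun ω => ?_) (hY.meas u) (hY.centered u) hQ0 hK' (fun v hv => ?_) (hY.bound u)
    · rw [one_div_one_div, sub_div, div_self hp0.ne']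
      linear_combination hpr
    · have h1 : ∀ v, s ≤ v → Measurable[𝓕 v] fun ω => ∫ w in s..v, X w ω := fun v hv =>
        measurable_primitive hM (fun u _ => hX.adapted hM u) hX.cont hv
      have h2 : ∀ v, s ≤ v → Measurable[𝓕 v] fun ω => (∫ w in s..v, X w ω) * Y v ω :=
        fun v hv => Measurable.mul (h1 v hv) (hY.adapted hM v)
      have h3 : Measurable[𝓕 v] (M v) := measurable_primitive hM h2 hZc hv
      have h4 : Measurable[𝓕 v] fun ω => |M v ω| ^ (p - 2) * M v ω := by
        simpa using measurable_signed_rpow 1 (p - 2) h3 h3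
      exact Measurable.add (Measurable.mul (measurable_signed_rpow _ _ h3 (h2 v hv)) (h1 v hv))
        (Measurable.mul h4 (hX.adapted hM v))
    · have hcf := continuous_primitive (hZc ω) s
      have hpf := hcf.abs.rpow_const (p := p - 2) fun _ => Or.inr (by linarith)
      exact (((continuous_const.mul hpf).mul (hZc ω)).mul (continuous_primitive (hX.cont ω) s)).add
        ((hpf.mul hcf).mul (hX.cont ω))
    · have hv' : v ∈ Icc s t := ⟨hv.1, hv.2.trans hu.2⟩
      have hQ' : 1 ≤ 1 / ((p - 1) / p + 1 / r) := by
        rw [one_le_div hq, sub_div, div_self hp0.ne']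
        have : 1 / r ≤ 1 / p := one_div_le_one_div_of_le hp0 (by linarith)
        linarith
      refine MomentBound.add hQ' (mul_nonneg (by linarith) (by positivity)) (by positivity)
        (hm1 v).aestronglyMeasurable (hm2 v).aestronglyMeasurable ?_ ?_
      · have h1 := (hA v hv').rpow_one_div hp0 (by linarith : 0 < p - 2) hA0
        have h2 := h1.mul_one_div (div_pos (by linarith) hp0) (by positivity) (by positivity)
          (hMp v).aestronglyMeasurable (hZm v).aestronglyMeasurable (hZb v hv')
        have h3 := h2.mul_one_div (add_pos (div_pos (by linarith) hp0) (by positivity))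
          (by positivity) (by positivity) ((hMp v).mul (hZm v)).aestronglyMeasurable
          (hSm v).aestronglyMeasurable (hSb v hv')
        have h4 := h3.const_mul (one_div_pos.2 (add_pos (add_pos (div_pos (by linarith) hp0)
          (by positivity)) (by positivity))) (p - 1)
        rw [abs_of_nonneg (by linarith)] at h4
        convert h4 using 2 with ω
        · field_simp; ring
        · simp only [Pi.mul_apply]; ring
        · ring
      · have h1 := (hA v hv').signed_rpow hp0 (θ := p - 1) (by linarith) hA0
        have h2 := h1.mul_one_div (div_pos (by linarith) hp0) (by positivity) (by positivity)
          (((hMm v).abs.pow_const _).mul (hMm v)).aestronglyMeasurable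
          (hXm v).aestronglyMeasurable (hXb v)
        rwa [show p - 1 - 1 = p - 2 by ring] at h2

end IntegratedMoments

/-! ### Iterated finite differences of functions and random fields. -/

section FiniteDifferences

variable {d : ℕ}

/-- Peel off one difference: the mean value inequality bounds the `n`-th derivative of `Δ_σ f` at `x
+ tσ` by `C |σ|`, using the derivative of order `n + 1` on the segment up to `x + (t+1)σ`. Only
points between `x` and `x + nσ` are ever used. -/
theorem norm_fwdDiff_iter_le {G : Type*} [NormedAddCommGroup G] [NormedSpace ℝ G] (σ : E d)
    (n : ℕ) {f : E d → G} (hf : ContDiff ℝ n f) (x : E d) {C : ℝ}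
    (hC : ∀ t ∈ Icc (0 : ℝ) n, ‖iteratedFDeriv ℝ n f (x + t • σ)‖ ≤ C) :
    ‖(fwdDiff σ)^[n] f x‖ ≤ C * ‖σ‖ ^ n := by
  induction n generalizing f C with
  | zero => simpa using hC 0 (by simp)
  | succ n ih =>
    have hf' : ContDiff ℝ n f := hf.of_le (by norm_cast; omega)
    have hfs : ContDiff ℝ n (fun y => f (y + σ)) := hf'.comp (contDiff_id.add contDiff_const)
    rw [Function.iterate_succ_apply, pow_succ', ← mul_assoc]
    refine ih (f := fwdDiff σ f) (hfs.sub hf') fun t ht => ?_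
    have e : iteratedFDeriv ℝ n (fwdDiff σ f) (x + t • σ)
        = iteratedFDeriv ℝ n f (x + (t + 1) • σ) - iteratedFDeriv ℝ n f (x + t • σ) := by
      have h1 := iteratedFDeriv_sub_apply (x := x + t • σ) hfs.contDiffAt hf'.contDiffAt
      rw [iteratedFDeriv_comp_add_right, add_assoc,
        show t • σ + σ = (t + 1) • σ by module] at h1
      exact h1
    rw [e]
    have hd : Differentiable ℝ (iteratedFDeriv ℝ n f) :=
      hf.differentiable_iteratedFDeriv (by norm_cast; omega)
    have hmv := (convex_segment (x + t • σ) (x + (t + 1) • σ)).norm_image_sub_le_of_norm_fderiv_le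
      (𝕜 := ℝ) (f := iteratedFDeriv ℝ n f) (C := C) (fun y _ => hd y) (fun y hy => ?_)
      (left_mem_segment _ _ _) (right_mem_segment _ _ _)
    · refine hmv.trans_eq ?_
      congr 2
      module
    · rw [norm_fderiv_iteratedFDeriv]
      rw [segment_eq_image'] at hy
      obtain ⟨θ, hθ, rfl⟩ := hy
      have := hC (t + θ) ⟨by linarith [ht.1, hθ.1], by push_cast; linarith [ht.2, hθ.2]⟩
      convert this using 3
      module

variable {Ω : Type*}

theorem fwdDiff_iter_apply_apply (σ : E d) (n : ℕ) (g : E d → Ω → ℝ) (x : E d) (ω : Ω) :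
    (fwdDiff σ)^[n] g x ω = (fwdDiff σ)^[n] (fun z => g z ω) x := by
  induction n generalizing g with
  | zero => rfl
  | succ n ih => rw [Function.iterate_succ_apply, Function.iterate_succ_apply, ih]; rfl

theorem fwdDiff_iter_euclidean_apply (σ : E d) (n : ℕ) (f : E d → E d) (x : E d) (i : Fin d) :
    (fwdDiff σ)^[n] f x i = (fwdDiff σ)^[n] (fun z => f z i) x := by
  induction n generalizing f with
  | zero => rfl
  | succ n ih => rw [Function.iterate_succ_apply, Function.iterate_succ_apply, ih]; rfl

theorem measurable_fwdDiff_iter {m : MeasurableSpace Ω} (σ : E d) (n : ℕ) {g : E d → Ω → ℝ}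
    (x : E d) (h : ∀ i : ℕ, i ≤ n → Measurable (g (x + (i : ℝ) • σ))) :
    Measurable ((fwdDiff σ)^[n] g x) := by
  induction n generalizing x with
  | zero => simpa using h 0 le_rfl
  | succ n ih =>
    rw [Function.iterate_succ_apply']
    refine (ih (x + σ) fun i hi => ?_).sub (ih x fun i hi => h i (by omega))
    have := h (i + 1) (by omega)
    convert this using 2
    push_cast
    module

theorem continuous_fwdDiff_iter (σ : E d) (n : ℕ) {g : E d → Ω → ℝ} {ω : Ω}
    (h : Continuous fun x => g x ω) : Continuous fun x => (fwdDiff σ)^[n] g x ω := by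
  induction n with
  | zero => exact h
  | succ n ih =>
    simp_rw [Function.iterate_succ_apply']
    exact (ih.comp (continuous_add_const σ)).sub ih

theorem momentBound_fwdDiff_iter {mΩ : MeasurableSpace Ω} {μ : Measure Ω} (σ : E d) (n : ℕ)
    {r K : ℝ} (hr : 1 ≤ r) (hK : 0 ≤ K) {g : E d → Ω → ℝ} (hg : ∀ x, Measurable (g x))
    (h : ∀ x, MomentBound μ r (g x) K) (x : E d) :
    MomentBound μ r ((fwdDiff σ)^[n] g x) (2 ^ n * K) := by
  induction n generalizing x with
  | zero => simpa using h x
  | succ n ih =>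
    rw [Function.iterate_succ_apply']
    have hm : ∀ x, Measurable ((fwdDiff σ)^[n] g x) := fun x =>
      measurable_fwdDiff_iter σ n x fun i _ => hg _
    have h2 := (ih x).const_mul (by linarith) (-1)
    have := (ih (x + σ)).add hr (by positivity) (by positivity) (hm _).aestronglyMeasurable
      ((hm x).const_mul _).aestronglyMeasurable h2
    convert this using 1
    · ext ω; simp [fwdDiff, sub_eq_add_neg]
    · rw [abs_neg, abs_one]; ring

theorem integral_fwdDiff_iter {mΩ : MeasurableSpace Ω} {μ : Measure Ω} (σ : E d) (n : ℕ)
    {g : E d → Ω → ℝ} (hg : ∀ x, Integrable (g x) μ) (h : ∀ x, ∫ ω, g x ω ∂μ = 0) (x : E d) :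
    Integrable ((fwdDiff σ)^[n] g x) μ ∧ ∫ ω, (fwdDiff σ)^[n] g x ω ∂μ = 0 := by
  induction n generalizing x with
  | zero => exact ⟨hg x, h x⟩
  | succ n ih =>
    rw [Function.iterate_succ_apply']
    refine ⟨(ih (x + σ)).1.sub (ih x).1, ?_⟩
    have := integral_sub (ih (x + σ)).1 (ih x).1
    rw [(ih (x + σ)).2, (ih x).2, sub_zero] at this
    exact this

/-- Leibniz-type bound: products of a deterministic function with a random field. -/
theorem momentBound_fwdDiff_iter_mul {mΩ : MeasurableSpace Ω} {μ : Measure Ω} {σ : E d} (n : ℕ)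
    {p B D : ℝ} (hp : 1 ≤ p) (hB : 0 ≤ B) (hD : 0 ≤ D) {b : E d → ℝ} {X : E d → Ω → ℝ}
    (hX : ∀ x, Measurable (X x))
    (hb : ∀ i ≤ n, ∀ x, |(fwdDiff σ)^[i] b x| ≤ B * ‖σ‖ ^ i)
    (h : ∀ i ≤ n, ∀ x, MomentBound μ p ((fwdDiff σ)^[i] X x) (D * ‖σ‖ ^ i)) (x : E d) :
    MomentBound μ p ((fwdDiff σ)^[n] (fun z ω => b z * X z ω) x) (2 ^ n * B * D * ‖σ‖ ^ n) := by
  induction n generalizing b X B D with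
  | zero =>
    have h0 := (h 0 le_rfl x).const_mul (by linarith) (b x)
    refine h0.mono ?_
    simpa using mul_le_mul_of_nonneg_right (by simpa using hb 0 le_rfl x) hD
  | succ n ih =>
    rw [Function.iterate_succ_apply]
    -- Discrete Leibniz rule, with a shift of `X` in one term; the two terms per step produce the
    -- factor `2^n`.
    have e : fwdDiff σ (fun z ω => b z * X z ω)
        = (fun z ω => fwdDiff σ b z * X (z + σ) ω) + fun z ω => b z * fwdDiff σ X z ω := by
      ext z ω
      simp only [fwdDiff, Pi.add_apply, Pi.sub_apply]
      ring
    rw [e, fwdDiff_iter_add]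
    have hm : ∀ {b : E d → ℝ} {X : E d → Ω → ℝ}, (∀ x, Measurable (X x)) →
        Measurable ((fwdDiff σ)^[n] (fun z ω => b z * X z ω) x) := fun hX =>
      measurable_fwdDiff_iter σ n x fun i _ => (hX _).const_mul _
    have hX1 : ∀ z, Measurable (fwdDiff σ X z) := fun z => (hX (z + σ)).sub (hX z)
    have h1 := ih (b := fwdDiff σ b) (X := fun z => X (z + σ)) (B := B * ‖σ‖) (D := D)
      (by positivity) hD (fun z => hX _) (fun i hi z => ?_) fun i hi z => ?_
    · have h2 := ih (b := b) (X := fwdDiff σ X) (B := B) (D := D * ‖σ‖) hB (by positivity) hX1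
        (fun i hi => hb i (by omega)) fun i hi z => ?_
      · have := h1.add hp (by positivity) (by positivity) (hm fun z => hX _).aestronglyMeasurable
          (hm hX1).aestronglyMeasurable h2
        refine MomentBound.mono this (le_of_eq ?_)
        ring
      · have := h (i + 1) (by omega) z
        rwa [Function.iterate_succ_apply, pow_succ', ← mul_assoc] at this
    · have := hb (i + 1) (by omega) z
      rwa [Function.iterate_succ_apply, pow_succ', ← mul_assoc] at this
    · rw [fwdDiff_iter_comp_add]
      exact h i (by omega) _

end FiniteDifferences

/-! ### Centered local fields built from `F` and its first derivatives. -/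

section Fields

variable {d : ℕ} {Ω : Type*}

theorem fieldSigma_mono (F : E d → Ω → E d) {A B : Set (E d)} (h : A ⊆ B) :
    fieldSigma F A ≤ fieldSigma F B :=
  biSup_mono h

theorem measurable_fieldSigma (F : E d → Ω → E d) {A : Set (E d)} {x : E d} (hx : x ∈ A) :
    Measurable[fieldSigma F A] (F x) := by
  rw [measurable_iff_comap_le]
  exact le_iSup₂_of_le (f := fun x (_ : x ∈ A) => MeasurableSpace.comap (F x) inferInstance) x hx
    le_rfl

/-- The partial derivative `∂_i F_k`. -/
noncomputable def partialField (F : E d → Ω → E d) (i k : Fin d) (x : E d) (ω : Ω) : ℝ :=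
  fderiv ℝ (fun z => F z ω) x (EuclideanSpace.single i 1) k

/-- The step `1/(m+2)` is strictly below 1, so that these quotients involve `F` only in the open
unit ball around `x`. -/
theorem tendsto_partialField {F : E d → Ω → E d}
    (hF : ∀ ω, ContDiff ℝ 3 fun x => F x ω) (i k : Fin d) (x : E d)
    (ω : Ω) : Filter.Tendsto (fun m : ℕ => ((m : ℝ) + 2) *
      (F (x + ((m : ℝ) + 2)⁻¹ • EuclideanSpace.single i 1) ω k - F x ω k)) Filter.atTop
      (nhds (partialField F i k x ω)) := by
  have hd : HasFDerivAt (fun z => F z ω) (fderiv ℝ (fun z => F z ω) x) x :=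
    ((hF ω).differentiable (by norm_num) x).hasFDerivAt
  have h1 : Filter.Tendsto (fun m : ℕ => (m : ℝ) + 2) Filter.atTop Filter.atTop :=
    Filter.tendsto_atTop_add_const_right _ _ tendsto_natCast_atTop_atTop
  have h2 := hd.lim_real (EuclideanSpace.single i 1)
  have h3 := ((EuclideanSpace.proj k : E d →L[ℝ] ℝ).continuous.tendsto _).comp (h2.comp h1)
  refine h3.congr fun m => ?_
  simp

theorem measurable_coord (F : E d → Ω → E d) {A : Set (E d)} {x : E d} (hx : x ∈ A) (i : Fin d) :
    Measurable[fieldSigma F A] fun ω => F x ω i :=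
  (EuclideanSpace.proj i : E d →L[ℝ] ℝ).measurable.comp (measurable_fieldSigma F hx)

theorem measurable_partialField {F : E d → Ω → E d}
    (hF : ∀ ω, ContDiff ℝ 3 fun x => F x ω) (i k : Fin d) (x : E d) :
    Measurable[fieldSigma F (Metric.ball x 1)] (partialField F i k x) := by
  refine @measurable_of_tendsto_metrizable Ω ℝ (fieldSigma F (Metric.ball x 1)) _ _ _ _ _ _
    (fun m : ℕ => ?_) (tendsto_pi_nhds.2 fun ω => tendsto_partialField hF i k x ω)
  refine Measurable.const_mul (Measurable.sub ?_ ?_) _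
  · refine measurable_coord F ?_ k
    have : (0 : ℝ) ≤ m := m.cast_nonneg
    simp only [Metric.mem_ball, dist_self_add_left, norm_smul, norm_inv, PiLp.norm_single, norm_one,
      mul_one]
    rw [Real.norm_of_nonneg (by linarith)]
    exact inv_lt_one_of_one_lt₀ (by linarith)
  · exact measurable_coord F (Metric.mem_ball_self one_pos) k

variable [mΩ : MeasurableSpace Ω] {μ : Measure Ω}

/-- A centered scalar field, determined by `F` within distance `ρ`, with `L^r` norms at most `K`. -/
structure CenteredField (F : E d → Ω → E d) (μ : Measure Ω) (r ρ : ℝ) (g : E d → Ω → ℝ)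
    (K : ℝ) : Prop where
  meas : ∀ x, Measurable[fieldSigma F (Metric.ball x ρ)] (g x)
  cont : ∀ ω, Continuous fun x => g x ω
  centered : ∀ x, ∫ ω, g x ω ∂μ = 0
  nonneg : 0 ≤ K
  bound : ∀ x, MomentBound μ r (g x) K

/-- The iterated increments of `g` in the direction `σ` are centered fields, bounded by powers
of `‖σ‖`. -/
def IncrementBounds (F : E d → Ω → E d) (μ : Measure Ω) (r : ℝ) (σ : E d) (n : ℕ) (ρ : ℝ)
    (g : E d → Ω → ℝ) (K : ℝ) : Prop :=
  ∀ i ≤ n, CenteredField F μ r (ρ + i) ((fwdDiff σ)^[i] g) (K * ‖σ‖ ^ i)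

theorem fieldSigma_le {F : E d → Ω → E d} (hF : ∀ x, Measurable (F x)) (A : Set (E d)) :
    fieldSigma F A ≤ mΩ :=
  iSup₂_le fun x _ => (hF x).comap_le

variable {F : E d → Ω → E d} {r : ℝ}

theorem CenteredField.mono_radius {ρ ρ' K : ℝ} {g : E d → Ω → ℝ}
    (h : CenteredField F μ r ρ g K) (hρ : ρ ≤ ρ') : CenteredField F μ r ρ' g K :=
  { h with
    meas := fun x => (h.meas x).mono (fieldSigma_mono F (Metric.ball_subset_ball hρ)) le_rfl }

theorem CenteredField.shift {ρ K : ℝ} {g : E d → Ω → ℝ} (h : CenteredField F μ r ρ g K) {σ : E d}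
    (hσ : ‖σ‖ ≤ 1) : CenteredField F μ r (ρ + 1) (fun x => g (x + σ)) K where
  meas x := (h.meas _).mono (fieldSigma_mono F (Metric.ball_subset_ball' (by simpa))) le_rfl
  cont ω := (h.cont ω).comp (continuous_add_const σ)
  centered x := h.centered _
  nonneg := h.nonneg
  bound x := h.bound _

theorem IncrementBounds.mono {σ : E d} {n m : ℕ} {ρ ρ' K : ℝ} {g : E d → Ω → ℝ}
    (h : IncrementBounds F μ r σ n ρ g K) (hmn : m ≤ n) (hρ : ρ ≤ ρ') :
    IncrementBounds F μ r σ m ρ' g K := fun i hi =>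
  (h i (hi.trans hmn)).mono_radius (by linarith)

theorem IncrementBounds.shift {σ : E d} (hσ : ‖σ‖ ≤ 1) {n : ℕ} {ρ K : ℝ} {g : E d → Ω → ℝ}
    (h : IncrementBounds F μ r σ n ρ g K) :
    IncrementBounds F μ r σ n (ρ + 1) (fun x => g (x + σ)) K := fun i hi => by
  have := (h i hi).shift hσ
  rw [show (fwdDiff σ)^[i] (fun x => g (x + σ)) = fun x => (fwdDiff σ)^[i] g (x + σ) from
    funext fun x => fwdDiff_iter_comp_add σ g σ i x, add_right_comm]
  exact this

/-- One difference trades an order for a factor `|σ|` and one unit of radius, so the sum of radius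
and order is preserved. This drives the inductions on `n` for iterated integrals. -/
theorem IncrementBounds.of_succ {σ : E d} {n : ℕ} {ρ K : ℝ} {g : E d → Ω → ℝ}
    (h : IncrementBounds F μ r σ (n + 1) ρ g K) :
    IncrementBounds F μ r σ n (ρ + 1) (fwdDiff σ g) (K * ‖σ‖) := fun i hi => by
  have := h (i + 1) (by omega)
  rw [Function.iterate_succ_apply, pow_succ', ← mul_assoc] at this
  convert this using 1
  push_cast; ring

/-- A random field whose law is invariant under translations. -/
def Stationary {G : Type*} [MeasurableSpace G] (μ : Measure Ω) (g : E d → Ω → G) : Prop :=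
  ∀ h, IdentDistrib (fun ω x => g (x + h) ω) (fun ω x => g x ω) μ μ

theorem measurable_eval_fwdDiff_iter (σ : E d) (n : ℕ) (x : E d) :
    Measurable fun f : E d → ℝ => (fwdDiff σ)^[n] f x := by
  have := measurable_fwdDiff_iter σ n (g := fun (x : E d) (f : E d → ℝ) => f x) x
    fun i _ => measurable_pi_apply _
  convert this using 2 with f
  exact (fwdDiff_iter_apply_apply σ n (fun (x : E d) (f : E d → ℝ) => f x) x f).symm

theorem Stationary.identDistrib_fwdDiff_iter {g : E d → Ω → ℝ} (hg : Stationary μ g) (σ : E d)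
    (n : ℕ) (x : E d) : IdentDistrib ((fwdDiff σ)^[n] g x) ((fwdDiff σ)^[n] g 0) μ μ := by
  have := (hg x).comp (measurable_eval_fwdDiff_iter σ n 0)
  convert this using 1
  · ext ω
    simp only [Function.comp_apply]
    rw [fwdDiff_iter_comp_add σ (fun z => g z ω) x n 0, zero_add, fwdDiff_iter_apply_apply]
  · ext ω
    simp only [Function.comp_apply, fwdDiff_iter_apply_apply]

theorem MomentBound.of_identDistrib {X Y : Ω → ℝ} {K : ℝ} (hr : 0 < r) (h : MomentBound μ r X K)
    (hXY : IdentDistrib Y X μ μ) : MomentBound μ r Y K := by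
  have := hXY.eLpNorm_eq (p := ENNReal.ofReal r)
  rw [eLpNorm_eq_eLpNorm' (by simpa using hr) ENNReal.ofReal_ne_top,
    eLpNorm_eq_eLpNorm' (by simpa using hr) ENNReal.ofReal_ne_top, ENNReal.toReal_ofReal hr.le]
    at this
  rw [MomentBound, this]
  exact h

/-- For a stationary field, it suffices to bound short increments at the origin. -/
theorem Stationary.incrementBounds [IsProbabilityMeasure μ] (hr : 1 ≤ r) {g : E d → Ω → ℝ}
    (hF : ∀ x, Measurable (F x))
    (hstat : Stationary μ g) (hmeas : ∀ x, Measurable[fieldSigma F (Metric.ball x 1)] (g x))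
    (hcont : ∀ ω, Continuous fun x => g x ω) (hcent : ∀ x, ∫ ω, g x ω ∂μ = 0) {n : ℕ} {C : ℝ}
    (hC : 0 ≤ C)
    (h : ∀ i ≤ n, ∀ σ : E d, n * ‖σ‖ ≤ 1 → MomentBound μ r ((fwdDiff σ)^[i] g 0) (C * ‖σ‖ ^ i))
    {σ : E d} (hσ : ‖σ‖ ≤ 1) : IncrementBounds F μ r σ n 1 g ((2 * (n + 1)) ^ n * C) := by
  have hr0 : 0 < r := by linarith
  have hg : ∀ x, Measurable (g x) := fun x => (hmeas x).mono (fieldSigma_le hF _) le_rfl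
  have h0 : ∀ x, MomentBound μ r (g x) C := fun x => by
    have h1 := h 0 (Nat.zero_le _) 0 (by simp)
    exact MomentBound.of_identDistrib hr0 (by simpa using h1)
      (hstat.identDistrib_fwdDiff_iter 0 0 x)
  intro i hi
  have hone : (1 : ℝ) ≤ 2 * (n + 1) := by have : (0 : ℝ) ≤ n := n.cast_nonneg
                                          linarith
  refine ⟨fun x => ?_, fun ω => continuous_fwdDiff_iter σ i (hcont ω), fun x => ?_, by positivity,
    fun x => ?_⟩
  · refine measurable_fwdDiff_iter σ i x fun j hj => (hmeas _).mono (fieldSigma_mono F ?_) le_rfl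
    refine Metric.ball_subset_ball' ?_
    rw [dist_self_add_left, norm_smul, Real.norm_natCast]
    have h1 : (j : ℝ) * ‖σ‖ ≤ j * 1 := by gcongr
    have h2 : (j : ℝ) ≤ i := by exact_mod_cast hj
    linarith
  · exact (integral_fwdDiff_iter σ i (fun x => (h0 x).integrable hr (hg x).aestronglyMeasurable)
      hcent x).2
  -- Short increments are moved to the origin by stationarity. For long ones `(n+1)|σ| ≥ 1`, so the
  -- triangle inequality bound `2^i C` is already of order `|σ|^i`.
  · by_cases hn : n * ‖σ‖ ≤ 1
    · refine MomentBound.of_identDistrib hr0 ?_ (hstat.identDistrib_fwdDiff_iter σ i x)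
      refine (h i hi σ hn).mono ?_
      gcongr
      exact le_mul_of_one_le_left hC (one_le_pow₀ hone)
    · push Not at hn
      refine (momentBound_fwdDiff_iter σ i hr hC hg h0 x).mono ?_
      have h1 : 1 ≤ (n + 1) * ‖σ‖ := by nlinarith [norm_nonneg σ]
      have h2 : (2 * ((n + 1) * ‖σ‖)) ^ i ≤ (2 * (n + 1)) ^ n * ‖σ‖ ^ i := by
        rw [← mul_assoc, mul_pow]
        gcongr
      calc 2 ^ i * C ≤ (2 * ((n + 1) * ‖σ‖)) ^ i * C := by
            gcongr; linarith
        _ ≤ ((2 * (n + 1)) ^ n * ‖σ‖ ^ i) * C := by gcongr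
        _ = _ := by ring

/-- The measurable functional recovering the partial derivative of a function from its values. -/
noncomputable def partialLimsup (i k : Fin d) (f : E d → E d) (x : E d) : ℝ :=
  Filter.limsup (fun m : ℕ => ((m : ℝ) + 2) *
      (f (x + ((m : ℝ) + 2)⁻¹ • EuclideanSpace.single i 1) k - f x k)) Filter.atTop

theorem measurable_partialLimsup (i k : Fin d) :
    Measurable (partialLimsup i k : (E d → E d) → E d → ℝ) := by
  refine measurable_pi_lambda _ fun x => Measurable.limsup fun m => ?_
  have hk : ∀ y : E d, Measurable fun f : E d → E d => f y k := fun y =>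
    (EuclideanSpace.proj k : E d →L[ℝ] ℝ).measurable.comp (measurable_pi_apply y)
  exact ((hk _).sub (hk _)).const_mul _

/-- Stationarity concerns laws on the product σ-algebra, so the derivative must be a measurable
functional of the whole path; the limsup of difference quotients is one, and agrees with the
derivative on smooth paths. -/
theorem stationary_partialField (hF : ∀ ω, ContDiff ℝ 3 fun x => F x ω) (hstat : Stationary μ F)
    (i k : Fin d) : Stationary μ (partialField F i k) := by
  intro h
  have := (hstat h).comp (measurable_partialLimsup i k)
  convert this using 1
  · ext ω x
    simp only [Function.comp_apply, partialLimsup]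
    rw [← (tendsto_partialField hF i k (x + h) ω).limsup_eq]
    simp_rw [add_right_comm x h]
  · ext ω x
    simp only [Function.comp_apply, partialLimsup]
    rw [← (tendsto_partialField hF i k x ω).limsup_eq]

theorem stationary_coord (hstat : Stationary μ F) (i : Fin d) :
    Stationary μ fun x ω => F x ω i := fun h => by
  have hm : Measurable fun (f : E d → E d) (x : E d) => f x i :=
    measurable_pi_lambda _ fun x =>
      (EuclideanSpace.proj i : E d →L[ℝ] ℝ).measurable.comp (measurable_pi_apply x)
  exact (hstat h).comp hm

theorem norm_iteratedFDeriv_coord_le {f : E d → E d} {n : ℕ} (hf : ContDiff ℝ n f) (k : Fin d)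
    (x : E d) : ‖iteratedFDeriv ℝ n (fun z => f z k) x‖ ≤ ‖iteratedFDeriv ℝ n f x‖ := by
  refine ((EuclideanSpace.proj k : E d →L[ℝ] ℝ).norm_iteratedFDeriv_comp_left
    (hf.contDiffAt (x := x)) le_rfl).trans ?_
  refine mul_le_of_le_one_left (norm_nonneg _) (ContinuousLinearMap.opNorm_le_bound _ zero_le_one
    fun y => ?_)
  rw [one_mul]
  exact PiLp.norm_apply_le y k

theorem norm_iteratedFDeriv_partial_le {f : E d → E d} {n : ℕ} (hf : ContDiff ℝ (n + 1) f)
    (i k : Fin d) (x : E d) :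
    ‖iteratedFDeriv ℝ n (fun z => fderiv ℝ f z (EuclideanSpace.single i 1) k) x‖
      ≤ ‖iteratedFDeriv ℝ (n + 1) f x‖ := by
  have hf' : ContDiff ℝ n (fderiv ℝ f) := hf.fderiv_right le_rfl
  refine (norm_iteratedFDeriv_coord_le (hf'.clm_apply contDiff_const) k x).trans ?_
  refine (norm_iteratedFDeriv_clm_apply_const hf'.contDiffAt le_rfl).trans ?_
  rw [norm_iteratedFDeriv_fderiv, PiLp.norm_single, norm_one, one_mul]

/-- The `L^r` norm of the sum of the suprema of the derivatives on the unit ball. -/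
noncomputable def derivMoment (F : E d → Ω → E d) (μ : Measure Ω) (r : ℝ) : ℝ :=
  (∫⁻ ω, ∑ k ∈ Finset.range 4, ⨆ x ∈ Metric.closedBall (0 : E d) 1,
    ‖iteratedFDeriv ℝ k (fun z => F z ω) x‖ₑ ^ r ∂μ).toReal ^ (1 / r)

theorem momentBound_fwdDiff_iter_zero (hr : 0 < r)
    (hmom : ∫⁻ ω, ∑ k ∈ Finset.range 4, ⨆ x ∈ Metric.closedBall (0 : E d) 1,
      ‖iteratedFDeriv ℝ k (fun z => F z ω) x‖ₑ ^ r ∂μ < ∞) {i k : ℕ} (hk : k < 4)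
    {g : E d → Ω → ℝ} (hg : ∀ ω, ContDiff ℝ i fun x => g x ω)
    (hgF : ∀ x ω, ‖iteratedFDeriv ℝ i (fun z => g z ω) x‖ ≤ ‖iteratedFDeriv ℝ k (fun z => F z ω) x‖)
    {σ : E d} (hσ : i * ‖σ‖ ≤ 1) :
    MomentBound μ r ((fwdDiff σ)^[i] g 0) (derivMoment F μ r * ‖σ‖ ^ i) := by
  rw [momentBound_iff hr, derivMoment, ENNReal.ofReal_mul (by positivity),
    ENNReal.mul_rpow_of_nonneg _ _ hr.le, ENNReal.ofReal_rpow_of_nonneg (by positivity) hr.le,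
    ← Real.rpow_mul ENNReal.toReal_nonneg, one_div_mul_cancel hr.ne', Real.rpow_one,
    ENNReal.ofReal_toReal hmom.ne, ← lintegral_mul_const' _ _ (by simp [hr.le])]
  refine lintegral_mono fun ω => ?_
  have hle : ∀ {C : ℝ}, (∀ t ∈ Icc (0 : ℝ) i,
      ‖iteratedFDeriv ℝ i (fun z => g z ω) (0 + t • σ)‖ ≤ C) →
      ‖(fwdDiff σ)^[i] g 0 ω‖ ≤ C * ‖σ‖ ^ i := fun h => by
    rw [fwdDiff_iter_apply_apply]
    exact norm_fwdDiff_iter_le σ i (hg ω) 0 h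
  set S := ∑ k ∈ Finset.range 4, ⨆ x ∈ Metric.closedBall (0 : E d) 1,
    ‖iteratedFDeriv ℝ k (fun z => F z ω) x‖ₑ ^ r with hS
  -- When `|σ|^i = 0` the right-hand side vanishes even if `S = ∞`, so the difference must be shown
  -- to vanish separately.
  rcases eq_or_ne (‖σ‖ ^ i) 0 with h0 | h0
  · have hσ0 : σ = 0 := by
      by_contra h
      exact pow_ne_zero i (norm_ne_zero_iff.2 h) h0
    have h1 := hle (C := ‖iteratedFDeriv ℝ i (fun z => g z ω) 0‖) fun t _ => by simp [hσ0]
    rw [h0, mul_zero] at h1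
    rw [norm_le_zero_iff.1 h1, enorm_zero, ENNReal.zero_rpow_of_pos hr]
    exact zero_le
  rcases eq_or_ne S ∞ with hS' | hS'
  · rw [hS', ENNReal.top_mul]
    · exact le_top
    · have : 0 < ENNReal.ofReal (‖σ‖ ^ i) := by
        rw [ENNReal.ofReal_pos]
        exact lt_of_le_of_ne (by positivity) h0.symm
      exact (ENNReal.rpow_pos this ENNReal.ofReal_ne_top).ne'
  have hC : ∀ t ∈ Icc (0 : ℝ) i,
      ‖iteratedFDeriv ℝ i (fun z => g z ω) (0 + t • σ)‖ ≤ (S ^ (1 / r)).toReal := by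
    intro t ht
    refine (hgF _ _).trans ?_
    rw [← toReal_enorm]
    refine ENNReal.toReal_mono (ENNReal.rpow_ne_top_of_nonneg (by positivity) hS') ?_
    rw [one_div, ENNReal.le_rpow_inv_iff hr]
    have hmem : 0 + t • σ ∈ Metric.closedBall (0 : E d) 1 := by
      rw [zero_add, mem_closedBall_zero_iff, norm_smul, Real.norm_of_nonneg ht.1]
      exact (mul_le_mul_of_nonneg_right ht.2 (norm_nonneg _)).trans hσ
    refine le_trans ?_ (Finset.single_le_sum (f := fun k => ⨆ x ∈ Metric.closedBall (0 : E d) 1,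
      ‖iteratedFDeriv ℝ k (fun z => F z ω) x‖ₑ ^ r) (fun _ _ => zero_le)
      (Finset.mem_range.2 hk))
    exact le_iSup₂ (f := fun x (_ : x ∈ Metric.closedBall (0 : E d) 1) =>
      ‖iteratedFDeriv ℝ k (fun z => F z ω) x‖ₑ ^ r) _ hmem
  have h1 := ENNReal.ofReal_le_ofReal (hle hC)
  rw [ofReal_norm, ENNReal.ofReal_mul ENNReal.toReal_nonneg,
    ENNReal.ofReal_toReal (ENNReal.rpow_ne_top_of_nonneg (by positivity) hS')] at h1
  refine (ENNReal.rpow_le_rpow h1 hr.le).trans_eq ?_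
  rw [ENNReal.mul_rpow_of_nonneg _ _ hr.le, ← ENNReal.rpow_mul, one_div_mul_cancel hr.ne',
    ENNReal.rpow_one]

/-- The standing assumptions on the velocity field, with all the sample paths of class `C^3`. -/
structure RegularField (F : E d → Ω → E d) (μ : Measure Ω) (r : ℝ) : Prop where
  meas : ∀ x, Measurable (F x)
  smooth : ∀ ω, ContDiff ℝ 3 fun x => F x ω
  centered : ∀ x, ∫ ω, F x ω ∂μ = 0
  stationary : Stationary μ F
  one_le : 1 ≤ r
  moment : ∫⁻ ω, ∑ k ∈ Finset.range 4, ⨆ x ∈ Metric.closedBall (0 : E d) 1,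
    ‖iteratedFDeriv ℝ k (fun z => F z ω) x‖ₑ ^ r ∂μ < ∞

theorem derivMoment_nonneg : 0 ≤ derivMoment F μ r := Real.rpow_nonneg ENNReal.toReal_nonneg _

theorem RegularField.incrementBounds_coord [IsProbabilityMeasure μ] (hF : RegularField F μ r)
    (k : Fin d) {σ : E d} (hσ : ‖σ‖ ≤ 1) :
    IncrementBounds F μ r σ 3 1 (fun x ω => F x ω k) (8 ^ 3 * derivMoment F μ r) := by
  have hr := hF.one_le
  have hmeas : ∀ x, Measurable[fieldSigma F (Metric.ball x 1)] fun ω => F x ω k := fun x =>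
    measurable_coord F (Metric.mem_ball_self one_pos) k
  have hcont : ∀ ω, Continuous fun x => F x ω k := fun ω =>
    (EuclideanSpace.proj k : E d →L[ℝ] ℝ).continuous.comp (hF.smooth ω).continuous
  have hstat := stationary_coord hF.stationary k
  have hsmooth : ∀ ω, ContDiff ℝ 3 fun x => F x ω k := fun ω =>
    (EuclideanSpace.proj k : E d →L[ℝ] ℝ).contDiff.comp (hF.smooth ω)
  have hb : ∀ i ≤ 3, ∀ σ : E d, ((3 : ℕ) : ℝ) * ‖σ‖ ≤ 1 →
      MomentBound μ r ((fwdDiff σ)^[i] (fun x ω => F x ω k) 0)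
        (derivMoment F μ r * ‖σ‖ ^ i) := by
    intro i hi σ hσ
    refine momentBound_fwdDiff_iter_zero (by linarith) hF.moment (k := i) (by omega)
      (fun ω => (hsmooth ω).of_le (by exact_mod_cast hi))
      (fun x ω => norm_iteratedFDeriv_coord_le ((hF.smooth ω).of_le (by exact_mod_cast hi)) k x) ?_
    refine le_trans ?_ hσ
    gcongr
  have hint : ∀ x k, Integrable (fun ω => F x ω k) μ := by
    intro x k
    have h1 : MomentBound μ r (fun ω => F 0 ω k) (derivMoment F μ r) := by
      have := momentBound_fwdDiff_iter_zero (by linarith) hF.moment (k := 0) (i := 0) (by omega)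
        (g := fun x ω => F x ω k) (σ := 0)
        (fun ω => ((EuclideanSpace.proj k : E d →L[ℝ] ℝ).contDiff.comp (hF.smooth ω)).of_le
          (by simp))
        (fun x ω => norm_iteratedFDeriv_coord_le ((hF.smooth ω).of_le (by simp)) k x)
        (by simp)
      simpa using this
    have h2 : IdentDistrib (fun ω => F x ω k) (fun ω => F 0 ω k) μ μ :=
      (stationary_coord hF.stationary k).identDistrib_fwdDiff_iter 0 0 x
    exact (MomentBound.of_identDistrib (by linarith) h1 h2).integrable hr
      h2.aemeasurable_fst.aestronglyMeasurable
  refine Stationary.incrementBounds (n := 3) hr hF.meas hstat hmeas hcont (fun x => ?_)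
    derivMoment_nonneg hb hσ
    |> fun h => by convert h using 2; norm_num
  rw [← eval_integral_piLp (hint x) k, hF.centered x]
  rfl

theorem RegularField.incrementBounds_partial [IsProbabilityMeasure μ] (hF : RegularField F μ r)
    (i k : Fin d) {σ : E d} (hσ : ‖σ‖ ≤ 1) :
    IncrementBounds F μ r σ 2 1 (partialField F i k) (6 ^ 2 * derivMoment F μ r) := by
  have hr := hF.one_le
  have hstat := stationary_partialField hF.smooth hF.stationary i k
  have hmeas := measurable_partialField hF.smooth i k
  have hcont : ∀ ω, Continuous fun x => partialField F i k x ω := fun ω =>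
    (EuclideanSpace.proj k : E d →L[ℝ] ℝ).continuous.comp
      (((hF.smooth ω).continuous_fderiv (by norm_num)).clm_apply continuous_const)
  have hfd : ∀ ω, ContDiff ℝ 2 (fderiv ℝ fun x => F x ω) := fun ω =>
    (hF.smooth ω).fderiv_right (by norm_num)
  have hsmooth : ∀ ω, ContDiff ℝ 2 fun x => partialField F i k x ω := fun ω =>
    (EuclideanSpace.proj k : E d →L[ℝ] ℝ).contDiff.comp ((hfd ω).clm_apply contDiff_const)
  have hb : ∀ j ≤ 2, ∀ σ : E d, ((2 : ℕ) : ℝ) * ‖σ‖ ≤ 1 →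
      MomentBound μ r ((fwdDiff σ)^[j] (partialField F i k) 0)
        (derivMoment F μ r * ‖σ‖ ^ j) := by
    intro j hj σ hσ
    refine momentBound_fwdDiff_iter_zero (by linarith) hF.moment (k := j + 1) (by omega)
      (fun ω => (hsmooth ω).of_le (by exact_mod_cast hj))
      (fun x ω => norm_iteratedFDeriv_partial_le
        ((hF.smooth ω).of_le (by exact_mod_cast (by omega : j + 1 ≤ 3))) i k x) ?_
    refine le_trans ?_ hσ
    gcongr
  have hm : ∀ x, Measurable (partialField F i k x) := fun x =>
    (hmeas x).mono (fieldSigma_le hF.meas _) le_rfl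
  have hb0 : ∀ x, MomentBound μ r (partialField F i k x) (derivMoment F μ r) := fun x => by
    have h1 := hb 0 (by omega) 0 (by simp)
    exact MomentBound.of_identDistrib (by linarith) (by simpa using h1)
      (hstat.identDistrib_fwdDiff_iter 0 0 x)
  have hcent0 : ∀ x, ∫ ω, partialField F i k x ω ∂μ = ∫ ω, partialField F i k 0 ω ∂μ := fun x =>
    (hstat.identDistrib_fwdDiff_iter 0 0 x).integral_eq
  have hzero : ∫ ω, partialField F i k 0 ω ∂μ = 0 := by
    -- The mean of `∂_i F_k` is constant by stationarity, and integrated over the unit segment it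
    -- equals `E[F_k(e)] - E[F_k(0)] = 0`.
    set e : E d := EuclideanSpace.single i 1
    have hftc : ∀ ω, ∫ s in (0 : ℝ)..1, partialField F i k (s • e) ω = F e ω k - F 0 ω k := by
      intro ω
      have hd : ∀ s ∈ uIcc (0 : ℝ) 1, HasDerivAt (fun s : ℝ => F (s • e) ω k)
          (partialField F i k (s • e) ω) s := by
        intro s _
        have h1 : HasFDerivAt (fun z => F z ω) (fderiv ℝ (fun z => F z ω) (s • e)) (s • e) :=
          ((hF.smooth ω).differentiable (by norm_num) _).hasFDerivAt
        have h2 : HasDerivAt (fun s : ℝ => s • e) e s := by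
          simpa using (hasDerivAt_id s).smul_const e
        have h3 : HasDerivAt (fun s : ℝ => F (s • e) ω)
            (fderiv ℝ (fun z => F z ω) (s • e) e) s :=
          HasFDerivAt.comp_hasDerivAt (f := fun s : ℝ => s • e) s h1 h2
        exact (EuclideanSpace.proj k : E d →L[ℝ] ℝ).hasFDerivAt.comp_hasDerivAt s h3
      rw [intervalIntegral.integral_eq_sub_of_hasDerivAt hd]
      · simp
      · exact ((hcont ω).comp (continuous_id.smul continuous_const)).intervalIntegrable _ _
    have h1 := integral_intervalIntegral (μ := μ) (Y := fun s ω => partialField F i k (s • e) ω)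
      (s := 0) (t := 1) (fun s => hm _)
      (fun ω => (hcont ω).comp (continuous_id.smul continuous_const)) zero_le_one
      (fun s _ => (hb0 _).exponent_mono one_pos hr (hm _).aestronglyMeasurable)
    simp_rw [hftc, hcent0 (_ • e)] at h1
    have hc := hF.incrementBounds_coord k (σ := 0) (by simp)
    have hc0 := hc 0 (by omega)
    have hi : ∀ x, Integrable (fun ω => F x ω k) μ := fun x =>
      (hc0.bound x).integrable hr ((hc0.meas x).mono (fieldSigma_le hF.meas _)
        le_rfl).aestronglyMeasurable
    rw [integral_sub (hi _) (hi _)] at h1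
    have h2 : ∀ x, ∫ ω, F x ω k ∂μ = 0 := hc0.centered
    rw [h2, h2] at h1
    simpa using h1.symm
  refine Stationary.incrementBounds (n := 2) hr hF.meas hstat hmeas hcont
    (fun x => (hcent0 x).trans hzero) derivMoment_nonneg hb hσ
    |> fun h => by convert h using 2; norm_num

end Fields

/-! ### Sampling the field along a ray: mixing in rescaled time. -/

section TimeIntegrals

variable {d : ℕ} {Ω : Type*}

theorem mixingRate_le_one [MeasurableSpace Ω] (μ : Measure Ω) [IsProbabilityMeasure μ]
    (F : E d → Ω → E d) (u : ℝ) : mixingRate μ F u ≤ 1 :=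
  iSup₂_le fun _ _ => iSup₂_le fun _ _ => iSup_le fun _ => mixingCoeff_le_one μ

/-- The correlation length of the field along the direction `v`. -/
noncomputable def mixingLength [MeasurableSpace Ω] (μ : Measure Ω) (F : E d → Ω → E d) (v : E d)
    (κ : ℝ) : ℝ :=
  (10 + (∫⁻ u in Ioi (0 : ℝ), mixingRate μ F u ^ κ).toReal) / ‖v‖

/-- Change of variables `u = hc - b`; on `(-b, 0]` the bound `φ ≤ 1` costs at most `b`. -/
theorem lintegral_affine_le {φ : ℝ → ℝ≥0∞} (hφ : ∀ x, φ x ≤ 1) {b c : ℝ} (hb : 0 ≤ b) (hc : 0 < c) :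
    ∫⁻ h in Ioi (0 : ℝ), φ (h * c - b) ≤
      ENNReal.ofReal c⁻¹ * (ENNReal.ofReal b + ∫⁻ u in Ioi (0 : ℝ), φ u) := by
  have h1 := lintegral_image_eq_lintegral_abs_deriv_mul (s := Ioi (0 : ℝ))
    (f := fun h => h * c - b) (f' := fun _ => c) measurableSet_Ioi
    (fun x _ => by simpa using (((hasDerivAt_id x).mul_const c).sub_const b).hasDerivWithinAt)
    (fun x _ y _ hxy => by
      have : x * c = y * c := by simpa using hxy
      exact mul_right_cancel₀ hc.ne' this) φ
  rw [lintegral_const_mul' _ _ ENNReal.ofReal_ne_top, abs_of_pos hc] at h1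
  have h2 : ∫⁻ x in (fun h => h * c - b) '' Ioi (0 : ℝ), φ x
      ≤ ENNReal.ofReal b + ∫⁻ u in Ioi (0 : ℝ), φ u := by
    calc _ ≤ ∫⁻ x in Ioc (-b) 0 ∪ Ioi 0, φ x := by
          refine lintegral_mono_set ?_
          rintro _ ⟨x, hx, rfl⟩
          have : 0 < x * c := mul_pos hx hc
          rw [Ioc_union_Ioi_eq_Ioi (by linarith)]
          simp only [mem_Ioi]
          linarith
      _ ≤ (∫⁻ x in Ioc (-b) 0, φ x) + ∫⁻ u in Ioi (0 : ℝ), φ u := lintegral_union_le _ _ _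
      _ ≤ _ := by
          gcongr
          refine (lintegral_mono hφ).trans ?_
          simp
  calc _ = ENNReal.ofReal c⁻¹ * (ENNReal.ofReal c * ∫⁻ h in Ioi (0 : ℝ), φ (h * c - b)) := by
        rw [← mul_assoc, ← ENNReal.ofReal_mul (by positivity), inv_mul_cancel₀ hc.ne',
          ENNReal.ofReal_one, one_mul]
    _ ≤ _ := by rw [← h1]; gcongr

variable [mΩ : MeasurableSpace Ω] {μ : Measure Ω} {F : E d → Ω → E d}

/-- The past is a tube of radius 5 around a half-ray and the present a ball of radius 5. The value 5
leaves room for fields seen from distance 1 together with up to three unit shifts. The two radii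
cost 10 in the separation, and the time change contributes the factor `ε²/|v|`, which cancels `ε⁻²`
later. -/
theorem mixingFiltration_ray [IsProbabilityMeasure μ]
    (hF : ∀ x, Measurable (F x)) {v : E d} (hv : v ≠ 0) {κ : ℝ}
    (hκ : 0 < κ) (hmix : ∫⁻ u in Ioi (0 : ℝ), mixingRate μ F u ^ κ < ∞) {ε : ℝ} (hε : 0 < ε)
    (y : E d) :
    MixingFiltration μ
      (fun u => fieldSigma F (⋃ w ∈ Iic u, Metric.ball (y + (w / ε ^ 2) • v) 5))
      (fun u => fieldSigma F (Metric.ball (y + (u / ε ^ 2) • v) 5))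
      (fun h => mixingRate μ F (h * (‖v‖ / ε ^ 2) - 10)) κ (ε ^ 2 * mixingLength μ F v κ) where
  le u := fieldSigma_le hF _
  mono u u' h := fieldSigma_mono F (biUnion_subset_biUnion_left (Iic_subset_Iic.2 h))
  present_le u := fieldSigma_mono F (subset_biUnion_of_mem (u := fun w =>
    Metric.ball (y + (w / ε ^ 2) • v) 5) (mem_Iic.2 le_rfl))
  mixing w u hwu := by
    have h1 : MeasurableSet (⋃ w' ∈ Iic w, Metric.ball (y + (w' / ε ^ 2) • v) 5) :=
      (isOpen_biUnion fun _ _ => Metric.isOpen_ball).measurableSet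
    have h2 : MeasurableSet (Metric.ball (y + (u / ε ^ 2) • v) 5) :=
      Metric.isOpen_ball.measurableSet
    refine le_iSup₂_of_le (i := _) (j := h1) (le_iSup₂_of_le (i := _) (j := h2)
      (le_iSup_of_le (i := ?_) le_rfl))
    intro p hp q hq
    obtain ⟨w', hw', hp'⟩ := mem_iUnion₂.1 hp
    have hw'' : w' ≤ w := hw'
    have h1 : dist (y + (w' / ε ^ 2) • v) (y + (u / ε ^ 2) • v) = (u - w') * (‖v‖ / ε ^ 2) := by
      rw [dist_add_left, dist_eq_norm, ← sub_smul, norm_smul, ← sub_div, Real.norm_eq_abs, abs_div,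
        abs_of_nonpos (by linarith), abs_of_pos (by positivity : 0 < ε ^ 2)]
      ring
    have h2 : (u - w) * (‖v‖ / ε ^ 2) ≤ (u - w') * (‖v‖ / ε ^ 2) := by gcongr
    have h3 := dist_triangle4 (y + (w' / ε ^ 2) • v) p q (y + (u / ε ^ 2) • v)
    rw [Metric.mem_ball] at hp' hq
    rw [dist_comm] at hp'
    linarith
  rate_nonneg := mul_nonneg (by positivity) (div_nonneg (by positivity) (norm_nonneg _))
  lintegral_rate := by
    have hv' : 0 < ‖v‖ := norm_pos_iff.2 hv
    refine (lintegral_affine_le (φ := fun u => mixingRate μ F u ^ κ)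
      (fun x => ENNReal.rpow_le_one (mixingRate_le_one μ F x) hκ.le)
      (by norm_num : (0 : ℝ) ≤ 10) (by positivity)).trans_eq ?_
    rw [mixingLength, inv_div, ← ENNReal.ofReal_toReal hmix.ne,
      ← ENNReal.ofReal_add (by norm_num) ENNReal.toReal_nonneg,
      ← ENNReal.ofReal_mul (by positivity), ENNReal.toReal_ofReal ENNReal.toReal_nonneg]
    congr 1
    ring

theorem mixingLength_nonneg (v : E d) (κ : ℝ) : 0 ≤ mixingLength μ F v κ :=
  div_nonneg (by positivity) (norm_nonneg _)

theorem CenteredField.centeredProcess {r ρ K : ℝ} {g : E d → Ω → ℝ} (hr : 0 < r)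
    (hg : CenteredField F μ r ρ g K) (hρ : ρ ≤ 5) (v y : E d) {ε : ℝ} (hε : 0 < ε) :
    CenteredProcess μ (fun u => fieldSigma F (Metric.ball (y + (u / ε ^ 2) • v) 5)) r
      (fun u ω => ε⁻¹ * g (y + (u / ε ^ 2) • v) ω) (ε⁻¹ * K) where
  meas u := Measurable.const_mul ((hg.mono_radius hρ).meas _) _
  cont ω := continuous_const.mul ((hg.cont ω).comp (by fun_prop))
  centered u := by rw [integral_const_mul, hg.centered, mul_zero]
  nonneg := mul_nonneg (by positivity) hg.nonneg
  bound u := by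
    have := (hg.bound (y + (u / ε ^ 2) • v)).const_mul hr ε⁻¹
    rwa [abs_of_pos (by positivity)] at this

/-- The rescaled time integral of the scalar field `g` along the direction `v`. -/
noncomputable def timeInt (v : E d) (ε s t : ℝ) (g : E d → Ω → ℝ) (y : E d) (ω : Ω) : ℝ :=
  ∫ u in s..t, ε⁻¹ * g (y + (u / ε ^ 2) • v) ω

/-- The rescaled iterated time integral of the scalar fields `f` and `g`. -/
noncomputable def timeInt₂ (v : E d) (ε s t : ℝ) (f g : E d → Ω → ℝ) (y : E d) (ω : Ω) : ℝ :=
  ∫ u in s..t, timeInt v ε s u f y ω * (ε⁻¹ * g (y + (u / ε ^ 2) • v) ω)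

end TimeIntegrals

/-! ### Pathwise rules for spatial increments of time integrals. -/

section PathIdentities

variable {d : ℕ} {Ω : Type*} {v : E d} {ε s t : ℝ} {f g : E d → Ω → ℝ}

theorem continuous_ray {ω : Ω} (hg : Continuous fun x => g x ω) (v y : E d) (ε : ℝ) :
    Continuous fun u : ℝ => ε⁻¹ * g (y + (u / ε ^ 2) • v) ω :=
  continuous_const.mul (hg.comp (by fun_prop))

theorem continuous_timeInt {ω : Ω} (hg : Continuous fun x => g x ω) (v y : E d) (ε s : ℝ) :
    Continuous fun u : ℝ => timeInt v ε s u g y ω :=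
  continuous_primitive (continuous_ray hg v y ε) s

theorem fwdDiff_timeInt (hg : ∀ ω, Continuous fun x => g x ω) (σ : E d) :
    fwdDiff σ (timeInt v ε s t g) = timeInt v ε s t (fwdDiff σ g) := by
  ext y ω
  simp only [fwdDiff, Pi.sub_apply, timeInt]
  rw [← intervalIntegral.integral_sub ((continuous_ray (hg ω) _ _ _).intervalIntegrable _ _)
    ((continuous_ray (hg ω) _ _ _).intervalIntegrable _ _)]
  refine intervalIntegral.integral_congr fun u _ => ?_
  simp only [← mul_sub, add_right_comm]

/-- Bilinearity of the iterated integral and the discrete Leibniz rule; both terms are again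
iterated integrals of local centered fields, so the moment bounds apply to them. -/
theorem fwdDiff_timeInt₂ (hf : ∀ ω, Continuous fun x => f x ω)
    (hg : ∀ ω, Continuous fun x => g x ω) (σ : E d) :
    fwdDiff σ (timeInt₂ v ε s t f g) = timeInt₂ v ε s t (fwdDiff σ f) (fun x => g (x + σ))
      + timeInt₂ v ε s t f (fwdDiff σ g) := by
  ext y ω
  have hfs : ∀ ω, Continuous fun x => fwdDiff σ f x ω := fun ω =>
    ((hf ω).comp (continuous_add_const σ)).sub (hf ω)
  have hgs : ∀ ω, Continuous fun x => fwdDiff σ g x ω := fun ω =>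
    ((hg ω).comp (continuous_add_const σ)).sub (hg ω)
  have hgt : Continuous fun x => g (x + σ) ω := (hg ω).comp (continuous_add_const σ)
  have hd : fwdDiff σ (timeInt₂ v ε s t f g) y ω
      = timeInt₂ v ε s t f g (y + σ) ω - timeInt₂ v ε s t f g y ω := rfl
  rw [hd, Pi.add_apply, Pi.add_apply]
  have hint : ∀ {f g : E d → Ω → ℝ} (y : E d), (Continuous fun x => f x ω) →
      (Continuous fun x => g x ω) → IntervalIntegrable
      (fun u => timeInt v ε s u f y ω * (ε⁻¹ * g (y + (u / ε ^ 2) • v) ω)) volume s t :=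
    fun y hf hg => ((continuous_timeInt hf v y ε s).mul
      (continuous_ray hg v y ε)).intervalIntegrable _ _
  simp only [timeInt₂]
  rw [← intervalIntegral.integral_sub (hint _ (hf ω) (hg ω)) (hint _ (hf ω) (hg ω)),
    ← intervalIntegral.integral_add (hint (g := fun x => g (x + σ)) _ (hfs ω) hgt)
      (hint _ (hf ω) (hgs ω))]
  refine intervalIntegral.integral_congr fun u _ => ?_
  simp only [← fwdDiff_timeInt hf]
  simp only [fwdDiff, Pi.sub_apply, add_right_comm y σ]
  ring

end PathIdentities

/-! ### Bounds, uniform in `ε`, for increments of time integrals. -/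

section TimeIntegralBounds

variable {d : ℕ} {Ω : Type*} [mΩ : MeasurableSpace Ω] {μ : Measure Ω}
  {F : E d → Ω → E d} {v : E d} {κ r p ρ K K' : ℝ} {f g : E d → Ω → ℝ}

theorem CenteredField.momentBound_timeInt [IsProbabilityMeasure μ]
    (hF : ∀ x, Measurable (F x)) (hv : v ≠ 0)
    (hκ : 0 < κ) (hmix : ∫⁻ u in Ioi (0 : ℝ), mixingRate μ F u ^ κ < ∞) (hr : 0 < r) (hp : 3 < p)
    (hpr : κ + 2 / r = 2 / p) (hg : CenteredField F μ r ρ g K) (hρ : ρ ≤ 5) {ε s t : ℝ}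
    (hε : 0 < ε) (hst : s ≤ t) (y : E d) :
    MomentBound μ p (timeInt v ε s t g y)
      (√(7 * p * (p - 1) * mixingLength μ F v κ) * K * √(t - s)) := by
  refine ((hg.centeredProcess hr hρ v y hε).momentBound_primitive
    (mixingFiltration_ray hF hv hκ hmix hε y) hκ hr hp hpr hst).mono (le_of_eq ?_)
  have h0 : 0 ≤ 7 * p * (p - 1) * mixingLength μ F v κ :=
    mul_nonneg (mul_nonneg (by linarith) (by linarith)) (mixingLength_nonneg v κ)
  rw [show 7 * p * (p - 1) * (ε⁻¹ * K) ^ 2 * (ε ^ 2 * mixingLength μ F v κ) * (t - s)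
    = (7 * p * (p - 1) * mixingLength μ F v κ) * K ^ 2 * (t - s) by field_simp]
  rw [Real.sqrt_mul (by positivity), Real.sqrt_mul h0, Real.sqrt_sq hg.nonneg]

theorem CenteredField.momentBound_timeInt₂ [IsProbabilityMeasure μ]
    (hF : ∀ x, Measurable (F x)) (hv : v ≠ 0)
    (hκ : 0 < κ) (hmix : ∫⁻ u in Ioi (0 : ℝ), mixingRate μ F u ^ κ < ∞) (hr : 0 < r) (hp : 3 < p)
    (hpr : κ + 2 / r = 1 / p) (hf : CenteredField F μ r ρ f K) (hg : CenteredField F μ r ρ g K')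
    (hρ : ρ ≤ 5) {ε s t : ℝ} (hε : 0 < ε) (hst : s ≤ t) (y : E d) :
    MomentBound μ p (timeInt₂ v ε s t f g y)
      ((98 * p ^ 2 * (p - 1) * (2 * p - 1) + 7 * p + 1) * mixingLength μ F v κ * K * K'
        * (t - s)) := by
  refine ((hf.centeredProcess hr hρ v y hε).momentBound_iterated
    (hg.centeredProcess hr hρ v y hε)
    (mixingFiltration_ray hF hv hκ hmix hε y) hκ hr hp hpr hst).mono (le_of_eq ?_)
  field_simp

theorem CenteredField.measurable (hF : ∀ x, Measurable (F x)) (hg : CenteredField F μ r ρ g K)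
    (x : E d) : Measurable (g x) :=
  (hg.meas x).mono (fieldSigma_le hF _) le_rfl

theorem measurable_timeInt (hg : ∀ x, Measurable (g x)) (hc : ∀ ω, Continuous fun x => g x ω)
    (v : E d) (ε s t : ℝ) (y : E d) : Measurable (timeInt v ε s t g y) :=
  measurable_intervalIntegral (fun _ => (hg _).const_mul _)
    (fun ω => continuous_ray (hc ω) v y ε) s t

theorem measurable_timeInt₂ (hf : ∀ x, Measurable (f x)) (hcf : ∀ ω, Continuous fun x => f x ω)
    (hg : ∀ x, Measurable (g x)) (hc : ∀ ω, Continuous fun x => g x ω)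
    (v : E d) (ε s t : ℝ) (y : E d) : Measurable (timeInt₂ v ε s t f g y) :=
  measurable_intervalIntegral
    (fun _ => (measurable_timeInt hf hcf v ε s _ y).mul ((hg _).const_mul _))
    (fun ω => (continuous_timeInt (hcf ω) v y ε s).mul (continuous_ray (hc ω) v y ε)) s t

theorem IncrementBounds.momentBound_timeInt [IsProbabilityMeasure μ]
    (hF : ∀ x, Measurable (F x)) (hv : v ≠ 0)
    (hκ : 0 < κ) (hmix : ∫⁻ u in Ioi (0 : ℝ), mixingRate μ F u ^ κ < ∞) (hr : 0 < r) (hp : 3 < p)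
    (hpr : κ + 2 / r = 2 / p) {σ : E d} {n : ℕ}
    (hg : IncrementBounds F μ r σ n ρ g K) (hρ : ρ + n ≤ 5) {ε s t : ℝ}
    (hε : 0 < ε) (hst : s ≤ t) (y : E d) :
    MomentBound μ p ((fwdDiff σ)^[n] (timeInt v ε s t g) y)
      (√(7 * p * (p - 1) * mixingLength μ F v κ) * K * √(t - s) * ‖σ‖ ^ n) := by
  have e : ∀ i ≤ n, (fwdDiff σ)^[i] (timeInt v ε s t g)
      = timeInt v ε s t ((fwdDiff σ)^[i] g) := by
    intro i
    induction i with
    | zero => simp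
    | succ i ih =>
      intro hi
      rw [Function.iterate_succ_apply', Function.iterate_succ_apply', ih (by omega),
        fwdDiff_timeInt (hg i (by omega)).cont]
  rw [e n le_rfl]
  refine ((hg n le_rfl).momentBound_timeInt hF hv hκ hmix hr hp hpr hρ hε hst y).mono
    (le_of_eq ?_)
  ring

/-- Induction through the Leibniz rule: each difference falls on one of the two fields, giving a
factor `|σ|` and two terms, hence `2^n`; radius plus order stays at most 5. -/
theorem IncrementBounds.momentBound_timeInt₂ [IsProbabilityMeasure μ]
    (hF : ∀ x, Measurable (F x)) (hv : v ≠ 0)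
    (hκ : 0 < κ) (hmix : ∫⁻ u in Ioi (0 : ℝ), mixingRate μ F u ^ κ < ∞) (hr : 0 < r) (hp : 3 < p)
    (hpr : κ + 2 / r = 1 / p) {σ : E d} (hσ : ‖σ‖ ≤ 1) {n : ℕ}
    (hf : IncrementBounds F μ r σ n ρ f K) (hg : IncrementBounds F μ r σ n ρ g K')
    (hρ : ρ + n ≤ 5) {ε s t : ℝ} (hε : 0 < ε) (hst : s ≤ t) (y : E d) :
    MomentBound μ p ((fwdDiff σ)^[n] (timeInt₂ v ε s t f g) y)
      (2 ^ n * ((98 * p ^ 2 * (p - 1) * (2 * p - 1) + 7 * p + 1) * mixingLength μ F v κ * K * K'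
        * (t - s)) * ‖σ‖ ^ n) := by
  have hts : 0 ≤ t - s := by linarith
  have hℓ : 0 ≤ mixingLength μ F v κ := mixingLength_nonneg v κ
  have hc : 0 ≤ 98 * p ^ 2 * (p - 1) * (2 * p - 1) + 7 * p + 1 :=
    add_nonneg (add_nonneg (mul_nonneg (mul_nonneg (by positivity) (by linarith)) (by linarith))
      (by linarith)) zero_le_one
  induction n generalizing f g ρ K K' with
  | zero =>
    have hf0 := hf 0 le_rfl
    have hg0 := hg 0 le_rfl
    simp only [Nat.cast_zero, add_zero, pow_zero, mul_one, Function.iterate_zero, id_eq] at *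
    simpa using hf0.momentBound_timeInt₂ hF hv hκ hmix hr hp hpr hg0 hρ hε hst y
  | succ n ih =>
    push_cast at hρ
    have hf0 := hf 0 (by omega)
    have hg0 := hg 0 (by omega)
    have hK : 0 ≤ K := by simpa using hf0.nonneg
    have hK' : 0 ≤ K' := by simpa using hg0.nonneg
    have hfc : ∀ ω, Continuous fun x => f x ω := hf0.cont
    have hgc : ∀ ω, Continuous fun x => g x ω := hg0.cont
    have hfm : ∀ x, Measurable (f x) := hf0.measurable hF
    have hgm : ∀ x, Measurable (g x) := hg0.measurable hF
    rw [Function.iterate_succ_apply, fwdDiff_timeInt₂ hfc hgc, fwdDiff_iter_add]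
    have h1 := ih hf.of_succ ((hg.shift hσ).mono (by omega) le_rfl) (by linarith)
    have h2 := ih (hf.mono (by omega) (by linarith : ρ ≤ ρ + 1)) hg.of_succ (by linarith)
    have hdm : ∀ {g : E d → Ω → ℝ}, (∀ x, Measurable (g x)) → ∀ x,
      Measurable (fwdDiff σ g x) := fun hg x => (hg _).sub (hg _)
    have hdc : ∀ {g : E d → Ω → ℝ}, (∀ ω, Continuous fun x => g x ω) → ∀ ω,
      Continuous fun x => fwdDiff σ g x ω := fun hg ω =>
        ((hg ω).comp (continuous_add_const σ)).sub (hg ω)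
    have hm1 : Measurable ((fwdDiff σ)^[n]
        (timeInt₂ v ε s t (fwdDiff σ f) fun x => g (x + σ)) y) :=
      measurable_fwdDiff_iter σ n y fun i _ => measurable_timeInt₂ (hdm hfm) (hdc hfc)
        (fun x => hgm _) (fun ω => (hgc ω).comp (continuous_add_const σ)) _ _ _ _ _
    have hm2 : Measurable ((fwdDiff σ)^[n]
        (timeInt₂ v ε s t f (fwdDiff σ g)) y) :=
      measurable_fwdDiff_iter σ n y fun i _ => measurable_timeInt₂ hfm hfc
        (hdm hgm) (hdc hgc) _ _ _ _ _
    have h3 := h1.add (by linarith) (by positivity) (by positivity) hm1.aestronglyMeasurable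
      hm2.aestronglyMeasurable h2
    refine MomentBound.mono h3 (le_of_eq ?_)
    ring

end TimeIntegralBounds

/-! ### From pointwise bounds to the moment functional. -/

section Functional

variable {d : ℕ} {Ω : Type*}

theorem incr_eq_zero {n : ℕ} {ρ : ℝ} {σ : E d} (hσ : ‖σ‖ ≤ 1) {V : E d → Ω → E d} {ω : Ω}
    (hV : ∀ y, ρ ≤ ‖y‖ → V y ω = 0) {y : E d} (hy : ρ + n ≤ ‖y‖) : incr n σ V y ω = 0 := by
  rw [incr, fwdDiff_iter_eq_sum_shift]
  refine Finset.sum_eq_zero fun k hk => ?_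
  have hk' : (k : ℝ) ≤ n := by exact_mod_cast Nat.lt_succ_iff.1 (Finset.mem_range.1 hk)
  rw [hV _ ?_, smul_zero]
  have h1 : ‖k • σ‖ ≤ k := by
    rw [← Nat.cast_smul_eq_nsmul ℝ, norm_smul, Real.norm_natCast]
    exact mul_le_of_le_one_right k.cast_nonneg hσ
  have h2 := norm_sub_le (y + k • σ) (k • σ)
  rw [add_sub_cancel_right] at h2
  linarith

theorem lintegral_ball_norm_rpow_lt_top (hd : 1 ≤ d) {γ : ℝ} (hγ : 0 < γ) :
    ∫⁻ σ in Metric.ball (0 : E d) 1, ENNReal.ofReal (‖σ‖ ^ (γ - d)) < ∞ := by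
  have hm : Measurable fun σ : E d => ‖σ‖ ^ (γ - d) := measurable_norm.pow_const _
  have := integrableOn_ball_of_norm_le_rpow (E := E d) (μ := volume) (r := 1) (C := 1)
    (α := d - γ) (f := fun σ : E d => ‖σ‖ ^ (γ - d)) (by simpa using hd) (by simpa using hγ)
    (.of_forall fun σ => by
      rw [neg_sub, one_mul, Real.norm_of_nonneg (by positivity)]) hm.aestronglyMeasurable
  exact this.lintegral_lt_top

variable [MeasurableSpace Ω] {μ : Measure Ω}

/-- The contribution of the increments of order `n` to the moment functional. -/
theorem lintegral_increments_le (hd : 1 ≤ d) {n : ℕ} {r a C ρ : ℝ} (ha : 0 < a) (hC : 0 ≤ C)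
    {X : E d → E d → ℝ≥0∞}
    (hX : ∀ σ : E d, ‖σ‖ < 1 → ∀ y, X σ y ≤ ENNReal.ofReal (C * ‖σ‖ ^ n))
    (hX0 : ∀ σ : E d, ‖σ‖ < 1 → ∀ y, ρ ≤ ‖y‖ → X σ y = 0) :
    ∫⁻ σ in Metric.ball (0 : E d) 1, ∫⁻ y : E d,
        X σ y ^ a / ENNReal.ofReal (‖σ‖ ^ ((n - 1 + r) * a + d))
      ≤ ENNReal.ofReal (C ^ a) * volume (Metric.ball (0 : E d) ρ)
        * ∫⁻ σ in Metric.ball (0 : E d) 1, ENNReal.ofReal (‖σ‖ ^ ((1 - r) * a - d)) := by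
  have hnz : ∀ᵐ σ ∂(volume.restrict (Metric.ball (0 : E d) 1)), σ ∈ Metric.ball (0 : E d) 1 :=
    ae_restrict_mem Metric.isOpen_ball.measurableSet
  have : Nontrivial (E d) :=
    Module.nontrivial_of_finrank_pos (R := ℝ) (by rwa [finrank_euclideanSpace_fin])
  rw [← lintegral_const_mul' _ _ (ENNReal.mul_ne_top ENNReal.ofReal_ne_top
    measure_ball_lt_top.ne)]
  refine lintegral_mono_ae ?_
  -- The weight degenerates at `σ = 0`, which is a null set because `d ≥ 1`.
  have hne : ∀ᵐ σ ∂(volume.restrict (Metric.ball (0 : E d) 1)), σ ≠ 0 :=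
    ae_restrict_of_ae (Measure.ae_ne volume 0)
  filter_upwards [hnz, hne] with σ hσ hσ0
  have hσ' : ‖σ‖ < 1 := by simpa using hσ
  have hpos : 0 < ‖σ‖ := norm_pos_iff.2 hσ0
  have key : ENNReal.ofReal (C * ‖σ‖ ^ n) ^ a / ENNReal.ofReal (‖σ‖ ^ ((n - 1 + r) * a + d))
      = ENNReal.ofReal (C ^ a) * ENNReal.ofReal (‖σ‖ ^ ((1 - r) * a - d)) := by
    rw [ENNReal.ofReal_rpow_of_nonneg (by positivity) ha.le,
      ← ENNReal.ofReal_div_of_pos (by positivity), ← ENNReal.ofReal_mul (by positivity),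
      Real.mul_rpow hC (by positivity), ← Real.rpow_natCast ‖σ‖ n, ← Real.rpow_mul hpos.le,
      mul_div_assoc, ← Real.rpow_sub hpos]
    congr 3
    ring
  calc _ ≤ ∫⁻ y in Metric.ball (0 : E d) ρ,
        ENNReal.ofReal (C * ‖σ‖ ^ n) ^ a / ENNReal.ofReal (‖σ‖ ^ ((n - 1 + r) * a + d)) := by
        rw [← lintegral_indicator Metric.isOpen_ball.measurableSet]
        refine lintegral_mono fun y => ?_
        by_cases hy : y ∈ Metric.ball (0 : E d) ρ
        · rw [indicator_of_mem hy]
          gcongr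
          exact hX σ hσ' y
        · rw [hX0 σ hσ' y (by simpa using hy), ENNReal.zero_rpow_of_pos ha, ENNReal.zero_div]
          exact zero_le
    _ = _ := by
        rw [setLIntegral_const, key]
        ring

theorem eLpNorm_inv_rpow_smul_le {q C τ θ : ℝ} (hτ : 0 < τ) {X : Ω → E d} {p : ℝ≥0∞}
    (h : eLpNorm X p μ ≤ ENNReal.ofReal (C * τ ^ θ)) (hq : q = θ) :
    eLpNorm (fun ω => (|τ| ^ q)⁻¹ • X ω) p μ ≤ ENNReal.ofReal C := by
  have h1 : (fun ω => (|τ| ^ q)⁻¹ • X ω) = (|τ| ^ q)⁻¹ • X := rfl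
  have hpos : 0 < τ ^ θ := by positivity
  rw [h1, eLpNorm_const_smul, hq, abs_of_pos hτ, Real.enorm_of_nonneg (by positivity)]
  refine (mul_le_mul' le_rfl h).trans_eq ?_
  rw [← ENNReal.ofReal_mul (by positivity)]
  congr 1
  field_simp

/-- Pointwise bounds on a compactly supported pair of random vector fields, and on its increments,
control the moment functional. -/
theorem exists_momentFunctional_le (hd : 1 ≤ d) {r a C ρ : ℝ} (ha : 0 < a) (hr : r < 1)
    (hC : 0 ≤ C) (μ : Measure Ω) :
    ∃ C' : ℝ≥0, ∀ (V W : E d → Ω → E d) (s t : ℝ), s < t →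
      (∀ y, eLpNorm (V y) (ENNReal.ofReal (2 * a)) μ
        ≤ ENNReal.ofReal (C * (t - s) ^ (1 / 2 : ℝ))) →
      (∀ σ : E d, ‖σ‖ < 1 → ∀ y, eLpNorm (incr 3 σ V y) (ENNReal.ofReal (2 * a)) μ
        ≤ ENNReal.ofReal (C * ‖σ‖ ^ 3 * (t - s) ^ (1 / 2 : ℝ))) →
      (∀ y, eLpNorm (W y) (ENNReal.ofReal a) μ ≤ ENNReal.ofReal (C * (t - s) ^ (1 : ℝ))) →
      (∀ σ : E d, ‖σ‖ < 1 → ∀ y, eLpNorm (incr 2 σ W y) (ENNReal.ofReal a) μ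
        ≤ ENNReal.ofReal (C * ‖σ‖ ^ 2 * (t - s) ^ (1 : ℝ))) →
      (∀ y ω, ρ ≤ ‖y‖ → V y ω = 0 ∧ W y ω = 0) →
      momentFunctional μ 2 r a 3 s t V W ≤ C' := by
  set I := ∫⁻ σ in Metric.ball (0 : E d) 1, ENNReal.ofReal (‖σ‖ ^ ((1 - r) * a - d)) with hI
  set vol := volume (Metric.ball (0 : E d) (ρ + 3)) with hvol
  have hIfin : I < ∞ := lintegral_ball_norm_rpow_lt_top hd (mul_pos (by linarith) ha)
  have hvfin : vol < ∞ := measure_ball_lt_top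
  set D := ENNReal.ofReal (C ^ a) with hD
  have hfin : (D + D) * vol + D * vol * I + D * vol * I ≠ ∞ := by
    have : D < ∞ := ENNReal.ofReal_lt_top
    finiteness
  refine ⟨((D + D) * vol + D * vol * I + D * vol * I).toNNReal, ?_⟩
  intro V W s t hst hV hV3 hW hW2 h0
  rw [ENNReal.coe_toNNReal hfin]
  have hts : 0 < t - s := by linarith
  have hVi0 : ∀ σ : E d, ‖σ‖ < 1 → ∀ y, ρ + 3 ≤ ‖y‖ → incr 3 σ V y = fun _ => 0 := by
    intro σ hσ y hy
    ext1 ω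
    exact incr_eq_zero hσ.le (fun y hy => (h0 y ω hy).1) (by exact_mod_cast hy)
  have hWi0 : ∀ σ : E d, ‖σ‖ < 1 → ∀ y, ρ + 3 ≤ ‖y‖ → incr 2 σ W y = fun _ => 0 := by
    intro σ hσ y hy
    ext1 ω
    refine incr_eq_zero hσ.le (fun y hy => (h0 y ω hy).2) ?_
    push_cast
    linarith
  refine add_le_add (add_le_add ?_ ?_) ?_
  · calc _ ≤ ∫⁻ y in Metric.ball (0 : E d) (ρ + 3), (D + D) := by
          rw [← lintegral_indicator Metric.isOpen_ball.measurableSet]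
          refine lintegral_mono fun y => ?_
          by_cases hy : y ∈ Metric.ball (0 : E d) (ρ + 3)
          · rw [indicator_of_mem hy, hD, ← ENNReal.ofReal_rpow_of_nonneg hC ha.le]
            gcongr
            · exact eLpNorm_inv_rpow_smul_le hts (hV y) rfl
            · exact eLpNorm_inv_rpow_smul_le hts (hW y) (by norm_num)
          · have hy' : ρ ≤ ‖y‖ := by
              have : ρ + 3 ≤ ‖y‖ := by simpa using hy
              linarith
            simp [fun ω => (h0 y ω hy').1, fun ω => (h0 y ω hy').2, ha]
      _ = _ := by rw [setLIntegral_const]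
  · have := lintegral_increments_le hd (n := 3) (r := r) (ρ := ρ + 3) ha hC
      (X := fun σ y => eLpNorm (fun ω => (|t - s| ^ (1 / 2 : ℝ))⁻¹ • incr 3 σ V y ω)
        (ENNReal.ofReal (2 * a)) μ)
      (fun σ hσ y => eLpNorm_inv_rpow_smul_le hts (hV3 σ hσ y) rfl)
      (fun σ hσ y hy => by simp [hVi0 σ hσ y hy])
    norm_num at this ⊢
    exact this
  · have := lintegral_increments_le hd (n := 2) (r := r) (ρ := ρ + 3) ha hC
      (X := fun σ y => eLpNorm (fun ω => (|t - s| ^ (2 / 2 : ℝ))⁻¹ • incr 2 σ W y ω)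
        (ENNReal.ofReal a) μ)
      (fun σ hσ y => eLpNorm_inv_rpow_smul_le hts (hW2 σ hσ y) (by norm_num))
      (fun σ hσ y hy => by simp [hWi0 σ hσ y hy])
    norm_num at this ⊢
    exact this

end Functional

/-! ### Stability of uniform increment bounds under sums and deterministic factors. -/

section UniformIncrements

variable {d : ℕ} {Ω : Type*} [mΩ : MeasurableSpace Ω] {μ : Measure Ω} {p θ : ℝ} {n : ℕ}
  {X Y : ℝ → ℝ → ℝ → E d → Ω → ℝ}

/-- Uniform moment bounds, of size `(t - s)^θ`, on the increments up to order `n` of a family of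
scalar random fields indexed by `ε`, `s` and `t`. -/
structure UniformIncrements (μ : Measure Ω) (p θ : ℝ) (n : ℕ)
    (X : ℝ → ℝ → ℝ → E d → Ω → ℝ) : Prop where
  meas : ∀ ε s t y, Measurable (X ε s t y)
  bound : ∃ C : ℝ, 0 ≤ C ∧ ∀ ε s t : ℝ, 0 < ε → s ≤ t → ∀ σ : E d, ‖σ‖ ≤ 1 → ∀ i ≤ n, ∀ y,
    MomentBound μ p ((fwdDiff σ)^[i] (X ε s t) y) (C * (t - s) ^ θ * ‖σ‖ ^ i)

theorem UniformIncrements.add (hp : 1 ≤ p) (hX : UniformIncrements μ p θ n X)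
    (hY : UniformIncrements μ p θ n Y) :
    UniformIncrements μ p θ n fun ε s t y ω => X ε s t y ω + Y ε s t y ω where
  meas ε s t y := (hX.meas ε s t y).add (hY.meas ε s t y)
  bound := by
    obtain ⟨C, hC, hCX⟩ := hX.bound
    obtain ⟨D, hD, hDY⟩ := hY.bound
    refine ⟨C + D, by positivity, fun ε s t hε hst σ hσ i hi y => ?_⟩
    have hts : 0 ≤ (t - s) ^ θ := Real.rpow_nonneg (by linarith) _
    change MomentBound μ p ((fwdDiff σ)^[i] (X ε s t + Y ε s t) y) _
    rw [fwdDiff_iter_add, add_mul, add_mul]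
    exact (hCX ε s t hε hst σ hσ i hi y).add hp (by positivity) (by positivity)
      (measurable_fwdDiff_iter σ i y fun _ _ => hX.meas ε s t _).aestronglyMeasurable
      (measurable_fwdDiff_iter σ i y fun _ _ => hY.meas ε s t _).aestronglyMeasurable
      (hDY ε s t hε hst σ hσ i hi y)

theorem UniformIncrements.zero (hp : 0 < p) :
    UniformIncrements μ p θ n (0 : ℝ → ℝ → ℝ → E d → Ω → ℝ) where
  meas _ _ _ _ := measurable_const
  bound := by
    refine ⟨0, le_rfl, fun ε s t _ _ σ _ i _ y => ?_⟩
    have h : (fwdDiff σ)^[i] (0 : E d → Ω → ℝ) = 0 := by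
      induction i with
      | zero => rfl
      | succ i ih =>
        rw [Function.iterate_succ_apply', ih (by omega)]
        ext
        simp [fwdDiff]
    change MomentBound μ p ((fwdDiff σ)^[i] (0 : E d → Ω → ℝ) y) _
    rw [h, MomentBound]
    simp only [Pi.zero_apply, eLpNorm'_zero hp]
    exact zero_le

theorem UniformIncrements.sum (hp : 1 ≤ p) {ι : Type*} {S : Finset ι}
    {X : ι → ℝ → ℝ → ℝ → E d → Ω → ℝ} (hX : ∀ i ∈ S, UniformIncrements μ p θ n (X i)) :
    UniformIncrements μ p θ n fun ε s t y ω => ∑ i ∈ S, X i ε s t y ω := by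
  classical
  induction S using Finset.induction_on with
  | empty => simpa using! UniformIncrements.zero (by linarith)
  | insert i S hi ih =>
    simp_rw [Finset.sum_insert hi]
    exact (hX i (Finset.mem_insert_self i S)).add hp
      (ih fun j hj => hX j (Finset.mem_insert_of_mem hj))

theorem UniformIncrements.mul_left (hp : 1 ≤ p) (hX : UniformIncrements μ p θ n X)
    {b : E d → ℝ} {B : ℝ} (hB : 0 ≤ B)
    (hb : ∀ σ, ∀ i ≤ n, ∀ x, |(fwdDiff σ)^[i] b x| ≤ B * ‖σ‖ ^ i) :
    UniformIncrements μ p θ n fun ε s t y ω => b y * X ε s t y ω where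
  meas ε s t y := (hX.meas ε s t y).const_mul _
  bound := by
    obtain ⟨C, hC, hCX⟩ := hX.bound
    refine ⟨2 ^ n * B * C, by positivity, fun ε s t hε hst σ hσ i hi y => ?_⟩
    have hts : 0 ≤ (t - s) ^ θ := Real.rpow_nonneg (by linarith) _
    refine (momentBound_fwdDiff_iter_mul (D := C * (t - s) ^ θ) i hp hB (by positivity)
      (hX.meas ε s t)
      (fun j hj => hb σ j (hj.trans hi))
      (fun j hj => hCX ε s t hε hst σ hσ j (hj.trans hi)) y).mono ?_
    calc _ = 2 ^ i * (B * C * (t - s) ^ θ * ‖σ‖ ^ i) := by ring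
      _ ≤ 2 ^ n * (B * C * (t - s) ^ θ * ‖σ‖ ^ i) := by
        gcongr
        norm_num
      _ = _ := by ring

theorem UniformIncrements.sub (hp : 1 ≤ p) (hX : UniformIncrements μ p θ n X)
    (hY : UniformIncrements μ p θ n Y) :
    UniformIncrements μ p θ n fun ε s t y ω => X ε s t y ω - Y ε s t y ω := by
  have h : ∀ σ : E d, ∀ i ≤ n, ∀ x, |(fwdDiff σ)^[i] (fun _ => (-1 : ℝ)) x| ≤ 1 * ‖σ‖ ^ i := by
    intro σ i _ x
    cases i with
    | zero => simp
    | succ i =>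
      have h0 : ∀ i, (fwdDiff σ)^[i] (fun _ => (0 : ℝ)) = fun _ => 0 := fun i =>
        Function.iterate_fixed (by ext; simp [fwdDiff]) i
      have h1 : fwdDiff σ (fun _ => (-1 : ℝ)) = fun _ => 0 := by ext; simp [fwdDiff]
      rw [Function.iterate_succ_apply, h1, h0]
      simp only [abs_zero]
      positivity
  simpa [sub_eq_add_neg] using hX.add hp (hY.mul_left hp zero_le_one h)

/-- Triangle inequality over the coordinates in the standard basis, whence the factor `d`. -/
theorem eLpNorm_incr_le (hp : 1 ≤ p) {X : E d → Ω → E d} {K : ℝ} {σ y : E d}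
    (hX : ∀ y k, Measurable fun ω => X y ω k)
    (h : ∀ k, MomentBound μ p ((fwdDiff σ)^[n] (fun z ω => X z ω k) y) K) :
    eLpNorm (incr n σ X y) (ENNReal.ofReal p) μ ≤ ENNReal.ofReal (d * K) := by
  have hp0 : 0 < p := by linarith
  have e : incr n σ X y = ∑ k : Fin d, fun ω =>
      ((fwdDiff σ)^[n] (fun z ω => X z ω k) y ω) • (EuclideanSpace.single k (1 : ℝ) : E d) := by
    ext ω j
    simp [incr, fwdDiff_iter_euclidean_apply, fwdDiff_iter_apply_apply, Finset.sum_apply,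
      Pi.single_apply]
  have hm : ∀ k, Measurable ((fwdDiff σ)^[n] (fun z ω => X z ω k) y) := fun k =>
    measurable_fwdDiff_iter σ n y fun i _ => hX _ k
  rw [e]
  refine (eLpNorm_sum_le (fun k _ => ((hm k).smul_const _).aestronglyMeasurable)
    (by simpa using hp)).trans ?_
  calc _ ≤ ∑ k : Fin d, ENNReal.ofReal K := by
        refine Finset.sum_le_sum fun k _ => le_trans (eLpNorm_mono (g :=
          (fwdDiff σ)^[n] (fun z ω => X z ω k) y) fun ω => ?_) ?_
        · simp [norm_smul]
        · rw [eLpNorm_eq_eLpNorm' (by simpa using hp0) ENNReal.ofReal_ne_top,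
            ENNReal.toReal_ofReal hp0.le]
          exact h k
    _ = _ := by
        rw [Finset.sum_const, Finset.card_univ, Fintype.card_fin, nsmul_eq_mul,
          ENNReal.ofReal_mul (by positivity), ENNReal.ofReal_natCast]

theorem UniformIncrements.eLpNorm_incr_le (hp : 1 ≤ p)
    {X : ℝ → ℝ → ℝ → E d → Ω → E d}
    (hX : ∀ k, UniformIncrements μ p θ n fun ε s t y ω => X ε s t y ω k) :
    ∃ C : ℝ, 0 ≤ C ∧ ∀ ε s t : ℝ, 0 < ε → s ≤ t → ∀ σ : E d, ‖σ‖ ≤ 1 → ∀ i ≤ n, ∀ y,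
      eLpNorm (incr i σ (X ε s t) y) (ENNReal.ofReal p) μ
        ≤ ENNReal.ofReal (C * ‖σ‖ ^ i * (t - s) ^ θ) := by
  choose C hC h using fun k => (hX k).bound
  refine ⟨d * ∑ k, C k, mul_nonneg d.cast_nonneg (Finset.sum_nonneg fun k _ => hC k),
    fun ε s t hε hst σ hσ i hi y => ?_⟩
  have hts : 0 ≤ (t - s) ^ θ := Real.rpow_nonneg (by linarith) _
  refine (StochTurb.eLpNorm_incr_le (K := (∑ k, C k) * (t - s) ^ θ * ‖σ‖ ^ i) hp
    (fun y k => (hX k).meas ε s t y)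
    fun k => (h k ε s t hε hst σ hσ i hi y).mono ?_).trans_eq ?_
  · gcongr
    exact Finset.single_le_sum (f := C) (fun k _ => hC k) (Finset.mem_univ k)
  · congr 1
    ring

end UniformIncrements

/-! ### Increments and support of the cutoff function. -/

section Cutoff

variable {d : ℕ}

theorem exists_fwdDiff_iter_le {b : E d → ℝ} {n : ℕ} (hb : ContDiff ℝ n b)
    (hs : HasCompactSupport b) :
    ∃ B : ℝ, 0 ≤ B ∧ ∀ σ, ∀ i ≤ n, ∀ x, |(fwdDiff σ)^[i] b x| ≤ B * ‖σ‖ ^ i := by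
  have h : ∀ i : ℕ, ∃ B : ℝ, 0 ≤ B ∧ (i ≤ n → ∀ σ x, |(fwdDiff σ)^[i] b x| ≤ B * ‖σ‖ ^ i) := by
    intro i
    by_cases hi : i ≤ n
    · obtain ⟨B, hB⟩ := (hs.iteratedFDeriv (𝕜 := ℝ) i).exists_bound_of_continuous
        (hb.continuous_iteratedFDeriv (by exact_mod_cast hi))
      exact ⟨B, (norm_nonneg _).trans (hB 0), fun _ σ x =>
        norm_fwdDiff_iter_le σ i (hb.of_le (by exact_mod_cast hi)) x fun t _ => hB _⟩
    · exact ⟨0, le_rfl, fun h => absurd h hi⟩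
  choose B hB0 hB using h
  refine ⟨∑ i ∈ Finset.range (n + 1), B i, Finset.sum_nonneg fun i _ => hB0 i,
    fun σ i hi x => (hB i hi σ x).trans ?_⟩
  gcongr
  exact Finset.single_le_sum (f := B) (fun i _ => hB0 i) (Finset.mem_range.2 (by omega))

theorem contDiff_cutoff {χ : E d → ℝ} (hχ : ContDiff ℝ (⊤ : ℕ∞) χ) (R : ℝ)
    (n : ℕ) : ContDiff ℝ n (cutoff χ R) :=
  (contDiff_infty.1 hχ n).comp (contDiff_const_smul _)

theorem cutoff_eq_zero {χ : E d → ℝ} (hχ : Function.support χ ⊆ Metric.ball 0 2) {R : ℝ}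
    (hR : 0 < R) {y : E d} (hy : 2 * R ≤ ‖y‖) : cutoff χ R y = 0 := by
  by_contra h
  have h1 : R⁻¹ • y ∈ Metric.ball (0 : E d) 2 := hχ h
  rw [mem_ball_zero_iff, norm_smul, Real.norm_of_nonneg (by positivity), inv_mul_lt_iff₀ hR] at h1
  linarith

theorem hasCompactSupport_cutoff {χ : E d → ℝ} (hχ : Function.support χ ⊆ Metric.ball 0 2) {R : ℝ}
    (hR : 0 < R) : HasCompactSupport (cutoff χ R) :=
  HasCompactSupport.intro (isCompact_closedBall (0 : E d) (2 * R)) fun x hx =>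
    cutoff_eq_zero hχ hR (by
      rw [mem_closedBall_zero_iff, not_le] at hx
      exact hx.le)

end Cutoff

/-! ### The drivers in coordinates, as combinations of scalar time integrals. -/

section Drivers

variable {d : ℕ} {Ω : Type*} {F : E d → Ω → E d} {v : E d} {χ : E d → ℝ} {R ε s t : ℝ}

theorem integral_euclidean_apply {f : ℝ → E d} (hf : ∀ k, Continuous fun u => f u k) (k : Fin d) :
    (∫ u in s..t, f u) k = ∫ u in s..t, f u k := by
  have h : Continuous f := (PiLp.continuous_toLp 2 _).comp (continuous_pi hf)
  exact ((EuclideanSpace.proj k : E d →L[ℝ] ℝ).intervalIntegral_comp_comm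
    (h.intervalIntegrable s t)).symm

theorem driverVLoc_apply (hF : ∀ ω, Continuous fun x => F x ω) (y : E d) (ω : Ω) (k : Fin d) :
    driverVLoc F v χ R ε s t y ω k
      = cutoff χ R y * timeInt v ε s t (fun x ω => F x ω k) y ω := by
  have hk : ∀ k : Fin d, Continuous fun x => F x ω k := fun k =>
    (EuclideanSpace.proj k : E d →L[ℝ] ℝ).continuous.comp (hF ω)
  rw [driverVLoc, PiLp.smul_apply, driverV,
    integral_euclidean_apply fun k => continuous_ray (g := fun x ω => F x ω k) (hk k) v y ε]
  rfl

theorem clm_euclidean_apply (L : E d →L[ℝ] E d) (w : E d) (k : Fin d) :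
    L w k = ∑ i, w i * L (EuclideanSpace.single i 1) k := by
  conv_lhs => rw [← (EuclideanSpace.basisFun (Fin d) ℝ).sum_repr w]
  simp [map_sum]

theorem fderiv_velLoc_apply (hF : ∀ ω, ContDiff ℝ 3 fun x => F x ω)
    (hχ : Differentiable ℝ (cutoff χ R)) (u : ℝ) (y w : E d) (ω : Ω) (k : Fin d) :
    fderiv ℝ (fun z => velLoc F v χ R ε u z ω) y w k
      = ∑ i, w i * (cutoff χ R y * (ε⁻¹ * partialField F i k (y + (u / ε ^ 2) • v) ω)
        + fderiv ℝ (cutoff χ R) y (EuclideanSpace.single i 1)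
          * (ε⁻¹ * F (y + (u / ε ^ 2) • v) ω k)) := by
  have hd : Differentiable ℝ fun x => F x ω := (hF ω).differentiable (by norm_num)
  have hv : DifferentiableAt ℝ (fun z => F (z + (u / ε ^ 2) • v) ω) y :=
    (hd _).comp y (by fun_prop)
  have h : fderiv ℝ (fun z => vel F v ε u z ω) y
      = ε⁻¹ • fderiv ℝ (fun x => F x ω) (y + (u / ε ^ 2) • v) := by
    simp only [vel]
    rw [fderiv_fun_const_smul hv,
      fderiv_comp_add_right (f := fun x => F x ω) ((u / ε ^ 2) • v)]
  have hv' : DifferentiableAt ℝ (fun z => vel F v ε u z ω) y := hv.const_smul ε⁻¹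
  simp only [velLoc]
  rw [fderiv_fun_smul (hχ y) hv', clm_euclidean_apply]
  refine Finset.sum_congr rfl fun i _ => ?_
  rw [h]
  simp [vel, partialField]

/-- By the product rule, localization gives `χ²` times the bracket of the unlocalized fields, plus
terms with coefficients `χ ∂_i χ` antisymmetric in the two times. All coefficients are deterministic
and independent of time, so they come out of the time integrals. -/
theorem lieBracket_velLoc_apply (hF : ∀ ω, ContDiff ℝ 3 fun x => F x ω)
    (hχ : Differentiable ℝ (cutoff χ R)) (u₁ u₂ : ℝ) (y : E d) (ω : Ω) (k : Fin d) :
    VectorField.lieBracket ℝ (fun y => velLoc F v χ R ε u₂ y ω)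
      (fun y => velLoc F v χ R ε u₁ y ω) y k
      = ∑ i, (cutoff χ R y ^ 2 *
          ((ε⁻¹ * F (y + (u₂ / ε ^ 2) • v) ω i)
            * (ε⁻¹ * partialField F i k (y + (u₁ / ε ^ 2) • v) ω)
          - (ε⁻¹ * partialField F i k (y + (u₂ / ε ^ 2) • v) ω)
            * (ε⁻¹ * F (y + (u₁ / ε ^ 2) • v) ω i))
        + cutoff χ R y * fderiv ℝ (cutoff χ R) y (EuclideanSpace.single i 1) *
          ((ε⁻¹ * F (y + (u₂ / ε ^ 2) • v) ω i) * (ε⁻¹ * F (y + (u₁ / ε ^ 2) • v) ω k)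
          - (ε⁻¹ * F (y + (u₂ / ε ^ 2) • v) ω k) * (ε⁻¹ * F (y + (u₁ / ε ^ 2) • v) ω i))) := by
  rw [VectorField.lieBracket_eq, PiLp.sub_apply, fderiv_velLoc_apply hF hχ,
    fderiv_velLoc_apply hF hχ, ← Finset.sum_sub_distrib]
  refine Finset.sum_congr rfl fun i _ => ?_
  simp only [velLoc, vel, PiLp.smul_apply, smul_eq_mul]
  ring

theorem driverWLoc_apply (hF : ∀ ω, ContDiff ℝ 3 fun x => F x ω)
    (hχ : Differentiable ℝ (cutoff χ R)) (y : E d) (ω : Ω) (k : Fin d) :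
    driverWLoc F v χ R ε s t y ω k
      = ∑ i, (cutoff χ R y ^ 2 *
          (timeInt₂ v ε s t (fun x ω => F x ω i) (partialField F i k) y ω
            - timeInt₂ v ε s t (partialField F i k) (fun x ω => F x ω i) y ω)
        + cutoff χ R y * fderiv ℝ (cutoff χ R) y (EuclideanSpace.single i 1) *
          (timeInt₂ v ε s t (fun x ω => F x ω i) (fun x ω => F x ω k) y ω
            - timeInt₂ v ε s t (fun x ω => F x ω k) (fun x ω => F x ω i) y ω)) := by
  have hk : ∀ k : Fin d, Continuous fun u => ε⁻¹ * F (y + (u / ε ^ 2) • v) ω k := fun k =>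
    continuous_ray (g := fun x ω => F x ω k)
      ((EuclideanSpace.proj k : E d →L[ℝ] ℝ).continuous.comp (hF ω).continuous) v y ε
  have hp : ∀ i k : Fin d, Continuous fun u => ε⁻¹ * partialField F i k (y + (u / ε ^ 2) • v) ω :=
    fun i k => continuous_ray (g := partialField F i k)
      ((EuclideanSpace.proj k : E d →L[ℝ] ℝ).continuous.comp
      (((hF ω).continuous_fderiv (by norm_num)).clm_apply continuous_const)) v y ε
  have hTk : ∀ k : Fin d, Continuous fun u => timeInt v ε s u (fun x ω => F x ω k) y ω := fun k =>
    continuous_primitive (hk k) s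
  have hTp : ∀ i k : Fin d, Continuous fun u => timeInt v ε s u (partialField F i k) y ω :=
    fun i k => continuous_primitive (hp i k) s
  have hint : ∀ {f : ℝ → ℝ}, Continuous f → ∀ s t, IntervalIntegrable f volume s t :=
    fun hf s t => hf.intervalIntegrable s t
  have hinner : ∀ (u₁ : ℝ) (k : Fin d), (∫ u₂ in s..u₁,
      VectorField.lieBracket ℝ (fun y => velLoc F v χ R ε u₂ y ω)
        (fun y => velLoc F v χ R ε u₁ y ω) y) k
      = ∑ i, (cutoff χ R y ^ 2 *
          (timeInt v ε s u₁ (fun x ω => F x ω i) y ω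
            * (ε⁻¹ * partialField F i k (y + (u₁ / ε ^ 2) • v) ω)
          - timeInt v ε s u₁ (partialField F i k) y ω
            * (ε⁻¹ * F (y + (u₁ / ε ^ 2) • v) ω i))
        + cutoff χ R y * fderiv ℝ (cutoff χ R) y (EuclideanSpace.single i 1) *
          (timeInt v ε s u₁ (fun x ω => F x ω i) y ω * (ε⁻¹ * F (y + (u₁ / ε ^ 2) • v) ω k)
          - timeInt v ε s u₁ (fun x ω => F x ω k) y ω
            * (ε⁻¹ * F (y + (u₁ / ε ^ 2) • v) ω i))) := by
    intro u₁ k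
    rw [integral_euclidean_apply]
    · simp_rw [lieBracket_velLoc_apply hF hχ]
      rw [intervalIntegral.integral_finsetSum fun i _ => hint (by fun_prop) _ _]
      refine Finset.sum_congr rfl fun i _ => ?_
      rw [intervalIntegral.integral_add (hint (by fun_prop) _ _) (hint (by fun_prop) _ _),
        intervalIntegral.integral_const_mul, intervalIntegral.integral_const_mul,
        intervalIntegral.integral_sub (hint (by fun_prop) _ _) (hint (by fun_prop) _ _),
        intervalIntegral.integral_sub (hint (by fun_prop) _ _) (hint (by fun_prop) _ _)]
      simp_rw [intervalIntegral.integral_mul_const]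
      rfl
    · intro k
      simp_rw [lieBracket_velLoc_apply hF hχ]
      fun_prop
  rw [driverWLoc, integral_euclidean_apply]
  · simp_rw [hinner]
    rw [intervalIntegral.integral_finsetSum fun i _ => hint (by fun_prop) _ _]
    refine Finset.sum_congr rfl fun i _ => ?_
    rw [intervalIntegral.integral_add (hint (by fun_prop) _ _) (hint (by fun_prop) _ _),
      intervalIntegral.integral_const_mul, intervalIntegral.integral_const_mul,
      intervalIntegral.integral_sub (hint (by fun_prop) _ _) (hint (by fun_prop) _ _),
      intervalIntegral.integral_sub (hint (by fun_prop) _ _) (hint (by fun_prop) _ _)]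
    rfl
  · intro k
    simp_rw [hinner]
    fun_prop

end Drivers

/-! ### Moment bounds for the drivers of a field with smooth paths. -/

section RegularFields

variable {d : ℕ} {Ω : Type*} [mΩ : MeasurableSpace Ω] {μ : Measure Ω} [IsProbabilityMeasure μ]
  {F : E d → Ω → E d} {v : E d} {κ r p ρ K K' : ℝ} {n : ℕ} {f g : E d → Ω → ℝ}

theorem uniformIncrements_timeInt (hF : ∀ x, Measurable (F x)) (hv : v ≠ 0)
    (hκ : 0 < κ) (hmix : ∫⁻ u in Ioi (0 : ℝ), mixingRate μ F u ^ κ < ∞) (hr : 0 < r) (hp : 3 < p)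
    (hpr : κ + 2 / r = 2 / p)
    (hg : ∀ σ : E d, ‖σ‖ ≤ 1 → IncrementBounds F μ r σ n ρ g K) (hρ : ρ + n ≤ 5) :
    UniformIncrements μ p (1 / 2) n fun ε s t => timeInt v ε s t g where
  meas ε s t y := by
    have h0 := hg 0 (by simp) 0 (by omega)
    exact measurable_timeInt (h0.measurable hF) h0.cont v ε s t y
  bound := by
    have hK : 0 ≤ K := by simpa using (hg 0 (by simp) 0 (by omega)).nonneg
    refine ⟨√(7 * p * (p - 1) * mixingLength μ F v κ) * K, by positivity,
      fun ε s t hε hst σ hσ i hi y => ?_⟩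
    rw [← Real.sqrt_eq_rpow]
    have hi' : (i : ℝ) ≤ n := by exact_mod_cast hi
    exact ((hg σ hσ).mono hi le_rfl).momentBound_timeInt hF hv hκ hmix hr hp hpr (by linarith)
      hε hst y

theorem uniformIncrements_timeInt₂ (hF : ∀ x, Measurable (F x)) (hv : v ≠ 0)
    (hκ : 0 < κ) (hmix : ∫⁻ u in Ioi (0 : ℝ), mixingRate μ F u ^ κ < ∞) (hr : 0 < r) (hp : 3 < p)
    (hpr : κ + 2 / r = 1 / p)
    (hf : ∀ σ : E d, ‖σ‖ ≤ 1 → IncrementBounds F μ r σ n ρ f K)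
    (hg : ∀ σ : E d, ‖σ‖ ≤ 1 → IncrementBounds F μ r σ n ρ g K') (hρ : ρ + n ≤ 5) :
    UniformIncrements μ p 1 n fun ε s t => timeInt₂ v ε s t f g where
  meas ε s t y := by
    have h0 := hf 0 (by simp) 0 (by omega)
    have h1 := hg 0 (by simp) 0 (by omega)
    exact measurable_timeInt₂ (h0.measurable hF) h0.cont (h1.measurable hF) h1.cont v ε s t y
  bound := by
    have hK : 0 ≤ K := by simpa using (hf 0 (by simp) 0 (by omega)).nonneg
    have hK' : 0 ≤ K' := by simpa using (hg 0 (by simp) 0 (by omega)).nonneg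
    have hℓ : 0 ≤ mixingLength μ F v κ := mixingLength_nonneg v κ
    have hc : 0 ≤ 98 * p ^ 2 * (p - 1) * (2 * p - 1) + 7 * p + 1 :=
      add_nonneg (add_nonneg (mul_nonneg (mul_nonneg (by positivity) (by linarith))
        (by linarith)) (by linarith)) zero_le_one
    refine ⟨2 ^ n * ((98 * p ^ 2 * (p - 1) * (2 * p - 1) + 7 * p + 1) * mixingLength μ F v κ
      * K * K'), by positivity, fun ε s t hε hst σ hσ i hi y => ?_⟩
    have hts : 0 ≤ t - s := by linarith
    have hi' : (i : ℝ) ≤ n := by exact_mod_cast hi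
    refine (((hf σ hσ).mono hi le_rfl).momentBound_timeInt₂ hF hv hκ hmix hr hp hpr hσ
      ((hg σ hσ).mono hi le_rfl) (by linarith) hε hst y).mono ?_
    rw [Real.rpow_one, mul_assoc (2 ^ n)]
    gcongr
    norm_num

variable {χ : E d → ℝ} {R : ℝ}

theorem RegularField.uniformIncrements_driverVLoc (hF : RegularField F μ r) (hv : v ≠ 0)
    (hκ : 0 < κ) (hmix : ∫⁻ u in Ioi (0 : ℝ), mixingRate μ F u ^ κ < ∞) (hp : 3 < p)
    (hpr : κ + 2 / r = 2 / p) (hχ : ContDiff ℝ (⊤ : ℕ∞) χ)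
    (hs : Function.support χ ⊆ Metric.ball 0 2) (hR : 0 < R) (k : Fin d) :
    UniformIncrements μ p (1 / 2) 3 fun ε s t y ω => driverVLoc F v χ R ε s t y ω k := by
  obtain ⟨B, hB, hb⟩ := exists_fwdDiff_iter_le (n := 3)
    (contDiff_cutoff hχ R 3) (hasCompactSupport_cutoff hs hR)
  simp_rw [driverVLoc_apply fun ω => (hF.smooth ω).continuous]
  exact (uniformIncrements_timeInt hF.meas hv hκ hmix (by linarith [hF.one_le]) hp hpr
    (fun σ hσ => hF.incrementBounds_coord k hσ) (by norm_num)).mul_left (by linarith) hB hb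

/-- The bracket consumes one of the three derivatives of `F`, which leaves increments of order 2. -/
theorem RegularField.uniformIncrements_driverWLoc (hF : RegularField F μ r) (hv : v ≠ 0)
    (hκ : 0 < κ) (hmix : ∫⁻ u in Ioi (0 : ℝ), mixingRate μ F u ^ κ < ∞) (hp : 3 < p)
    (hpr : κ + 2 / r = 1 / p) (hχ : ContDiff ℝ (⊤ : ℕ∞) χ)
    (hs : Function.support χ ⊆ Metric.ball 0 2) (hR : 0 < R) (k : Fin d) :
    UniformIncrements μ p 1 2 fun ε s t y ω => driverWLoc F v χ R ε s t y ω k := by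
  have hc := contDiff_cutoff hχ R
  have hc' : HasCompactSupport (cutoff χ R) := hasCompactSupport_cutoff hs hR
  have hr : 0 < r := by linarith [hF.one_le]
  have hp1 : 1 ≤ p := by linarith
  have hk := fun (k : Fin d) (σ : E d) (hσ : ‖σ‖ ≤ 1) =>
    (hF.incrementBounds_coord k hσ).mono (by norm_num : 2 ≤ 3) le_rfl
  have hpk := fun (i k : Fin d) (σ : E d) (hσ : ‖σ‖ ≤ 1) => hF.incrementBounds_partial i k hσ
  have hρ : (1 : ℝ) + (2 : ℕ) ≤ 5 := by norm_num
  simp_rw [driverWLoc_apply hF.smooth ((hc 1).differentiable (by simp))]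
  refine UniformIncrements.sum hp1 fun i _ => UniformIncrements.add hp1 ?_ ?_
  · obtain ⟨B, hB, hb⟩ := exists_fwdDiff_iter_le (n := 2) (b := fun y => cutoff χ R y ^ 2)
      ((hc 2).pow 2) (hc'.comp_left (g := (· ^ 2)) (by simp))
    exact ((uniformIncrements_timeInt₂ hF.meas hv hκ hmix hr hp hpr (hk i) (hpk i k) hρ).sub hp1
      (uniformIncrements_timeInt₂ hF.meas hv hκ hmix hr hp hpr (hpk i k) (hk i) hρ)).mul_left hp1
        hB hb
  · obtain ⟨B, hB, hb⟩ := exists_fwdDiff_iter_le (n := 2)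
      (b := fun y => cutoff χ R y * fderiv ℝ (cutoff χ R) y (EuclideanSpace.single i 1))
      ((hc 2).mul (((hc 3).fderiv_right (m := 2) (by norm_num)).clm_apply contDiff_const))
      hc'.mul_right
    exact ((uniformIncrements_timeInt₂ hF.meas hv hκ hmix hr hp hpr (hk i) (hk k) hρ).sub hp1
      (uniformIncrements_timeInt₂ hF.meas hv hκ hmix hr hp hpr (hk k) (hk i) hρ)).mul_left hp1
        hB hb

theorem RegularField.uniformMomentBounds {a₀ : ℝ} (hF : RegularField F μ (2 * a₀)) (hd : 1 ≤ d)
    (hv : v ≠ 0) (hκ : 0 < κ) (hκ' : κ < 1 / 3 - 1 / a₀)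
    (hmix : ∫⁻ u in Ioi (0 : ℝ), mixingRate μ F u ^ κ < ∞) (hχ : ContDiff ℝ (⊤ : ℕ∞) χ)
    (hs : Function.support χ ⊆ Metric.ball 0 2) (hR : 0 < R) {θ : ℝ} (hθ : θ < 1) (T : ℝ) :
    UniformMomentBounds μ T 2 θ (a₀ / (a₀ * κ + 1)) 3
      (fun ε s t => driverVLoc F v χ R ε s t) (fun ε s t => driverWLoc F v χ R ε s t) := by
  have ha₀ : 0 < a₀ := by linarith [hF.one_le]
  set a := a₀ / (a₀ * κ + 1) with ha
  -- This identity is the origin of `a`: with `r = 2a₀` it is both the balance `κ + 2/r = 2/p` at `p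
  -- = 2a` and the balance `κ + 2/r = 1/p` at `p = a`.
  have hinv : κ + 1 / a₀ = 1 / a := by rw [ha]; field_simp
  have ha0 : 0 < a := by rw [ha]; positivity
  have ha3 : 3 < a := by
    refine lt_of_one_div_lt_one_div ha0 ?_
    linarith
  have hinvV : κ + 2 / (2 * a₀) = 2 / (2 * a) := by
    rw [div_mul_cancel_left₀ two_ne_zero, div_mul_cancel_left₀ two_ne_zero, ← one_div, ← one_div,
      hinv]
  have hinvW : κ + 2 / (2 * a₀) = 1 / a := by
    rw [div_mul_cancel_left₀ two_ne_zero, ← one_div, hinv]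
  obtain ⟨C₁, hC₁, h₁⟩ := UniformIncrements.eLpNorm_incr_le (p := 2 * a) (by linarith) fun k =>
    hF.uniformIncrements_driverVLoc hv hκ hmix (by linarith) hinvV hχ hs hR k
  obtain ⟨C₂, hC₂, h₂⟩ := UniformIncrements.eLpNorm_incr_le (p := a) (by linarith) fun k =>
    hF.uniformIncrements_driverWLoc hv hκ hmix ha3 hinvW hχ hs hR k
  obtain ⟨C', hC'⟩ := exists_momentFunctional_le (ρ := 2 * R) hd ha0 hθ
    (add_nonneg hC₁ hC₂) μ
  refine ⟨C', fun ε hε _ s t _ hst _ => hC' _ _ s t hst (fun y => ?_) (fun σ hσ y => ?_)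
    (fun y => ?_) (fun σ hσ y => ?_) fun y ω hy => ?_⟩
  -- The undifferenced field is its increment of order 0, here with `σ = 0`.
  · refine (h₁ ε s t hε hst.le 0 (by simp) 0 (by norm_num) y).trans ?_
    rw [pow_zero, mul_one]
    gcongr
    exact le_add_of_nonneg_right hC₂
  · refine (h₁ ε s t hε hst.le σ hσ.le 3 le_rfl y).trans ?_
    gcongr
    exact le_add_of_nonneg_right hC₂
  · refine (h₂ ε s t hε hst.le 0 (by simp) 0 (by norm_num) y).trans ?_
    rw [pow_zero, mul_one]
    gcongr
    exact le_add_of_nonneg_left hC₁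
  · refine (h₂ ε s t hε hst.le σ hσ.le 2 le_rfl y).trans ?_
    gcongr
    exact le_add_of_nonneg_left hC₁
  · have h0 := cutoff_eq_zero hs hR hy
    refine ⟨by simp only [driverVLoc, h0, zero_smul], ?_⟩
    ext k
    rw [driverWLoc_apply hF.smooth ((contDiff_cutoff hχ R 1).differentiable (by simp))]
    simp [h0]

end RegularFields

/-! ### Reduction to a field with all paths smooth. -/

section Modification

variable {d : ℕ} {Ω : Type*} [mΩ : MeasurableSpace Ω] {μ : Measure Ω} {F G : E d → Ω → E d}

/-- Events of the modification differ from events of `F` over the same set `Λ` by null sets, so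
passing to the modification does not increase mixing coefficients. -/
theorem fieldSigma_le_eventuallyMeasurableSpace (h : ∀ᵐ ω ∂μ, ∀ x, F x ω = G x ω)
    (Λ : Set (E d)) :
    fieldSigma G Λ ≤ eventuallyMeasurableSpace (fieldSigma F Λ) (ae μ) := by
  refine iSup₂_le fun x hx => ?_
  rintro _ ⟨A, hA, rfl⟩
  refine ⟨F x ⁻¹' A, measurable_fieldSigma F hx hA, ?_⟩
  filter_upwards [h] with ω hω
  change (G x ω ∈ A) = (F x ω ∈ A)
  rw [hω x]

theorem mixingRate_le_of_ae_eq (h : ∀ᵐ ω ∂μ, ∀ x, F x ω = G x ω) (u : ℝ) :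
    mixingRate μ G u ≤ mixingRate μ F u := by
  refine iSup₂_mono fun Λ₁ _ => iSup₂_mono fun Λ₂ _ => iSup_mono fun _ => ?_
  refine iSup₂_le fun A hA => iSup₂_le fun B hB => ?_
  obtain ⟨A', hA', hAA'⟩ := fieldSigma_le_eventuallyMeasurableSpace h Λ₁ A hA
  obtain ⟨B', hB', hBB'⟩ := fieldSigma_le_eventuallyMeasurableSpace h Λ₂ B hB
  rw [measureReal_congr (hAA'.inter hBB'), measureReal_congr hAA', measureReal_congr hBB']
  exact le_iSup₂_of_le (i := A') (j := hA') (le_iSup₂_of_le (i := B') (j := hB') le_rfl)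

theorem momentFunctional_congr_ae {p r a : ℝ} {k s t} {V W V' W' : E d → Ω → E d}
    (hV : ∀ᵐ ω ∂μ, ∀ x, V x ω = V' x ω) (hW : ∀ᵐ ω ∂μ, ∀ x, W x ω = W' x ω) :
    momentFunctional μ p r a k s t V W = momentFunctional μ p r a k s t V' W' := by
  have hs : ∀ {X X' : E d → Ω → E d}, (∀ᵐ ω ∂μ, ∀ x, X x ω = X' x ω) → ∀ (c : ℝ) q y,
      eLpNorm (fun ω => c • X y ω) q μ = eLpNorm (fun ω => c • X' y ω) q μ := by
    intro X X' h c q y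
    refine eLpNorm_congr_ae ?_
    filter_upwards [h] with ω hω
    rw [hω]
  have hi : ∀ {X X' : E d → Ω → E d}, (∀ᵐ ω ∂μ, ∀ x, X x ω = X' x ω) → ∀ (k : ℕ) (σ : E d),
      ∀ᵐ ω ∂μ, ∀ y, incr k σ X y ω = incr k σ X' y ω := by
    intro X X' h k σ
    filter_upwards [h] with ω hω y
    rw [incr, incr, funext hω]
  simp only [momentFunctional, hs hV, hs hW, hs (hi hV _ _), hs (hi hW _ _)]

theorem UniformMomentBounds.congr_ae {T p r a : ℝ} {k : ℕ} {v : E d} {χ : E d → ℝ} {R : ℝ}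
    (h : ∀ᵐ ω ∂μ, ∀ x, F x ω = G x ω)
    (hG : UniformMomentBounds μ T p r a k (fun ε s t => driverVLoc G v χ R ε s t)
      (fun ε s t => driverWLoc G v χ R ε s t)) :
    UniformMomentBounds μ T p r a k (fun ε s t => driverVLoc F v χ R ε s t)
      (fun ε s t => driverWLoc F v χ R ε s t) := by
  obtain ⟨C, hC⟩ := hG
  refine ⟨C, fun ε hε hε1 s t hs hst ht => ?_⟩
  rw [momentFunctional_congr_ae (V' := driverVLoc G v χ R ε s t)
    (W' := driverWLoc G v χ R ε s t)]
  · exact hC ε hε hε1 s t hs hst ht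
  · filter_upwards [h] with ω hω x
    simp only [driverVLoc, driverV, vel, hω]
  · filter_upwards [h] with ω hω x
    simp only [driverWLoc, velLoc, vel, hω]

/-- A field which is almost surely smooth agrees almost surely with one which is smooth. -/
theorem exists_regularField {r : ℝ} (hr : 1 ≤ r) (hF : ∀ x, Measurable (F x))
    (hcent : ∀ x, ∫ ω, F x ω ∂μ = 0) (hstat : Stationary μ F)
    (hsmooth : ∀ᵐ ω ∂μ, ContDiff ℝ 3 fun x => F x ω)
    (hmom : ∫⁻ ω, ∑ k ∈ Finset.range 4, ⨆ x ∈ Metric.closedBall (0 : E d) 1,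
      ‖iteratedFDeriv ℝ k (fun z => F z ω) x‖ₑ ^ r ∂μ < ∞) :
    ∃ G : E d → Ω → E d, (∀ᵐ ω ∂μ, ∀ x, F x ω = G x ω) ∧ RegularField G μ r := by
  -- The set of non-smooth paths need not be measurable; it is enlarged to a measurable null set, on
  -- which the field is put equal to 0.
  set N := toMeasurable μ {ω | ¬ ContDiff ℝ 3 fun x => F x ω} with hN
  have hNm : MeasurableSet N := measurableSet_toMeasurable _ _
  have hN0 : ∀ᵐ ω ∂μ, ω ∉ N := by
    rw [ae_iff]
    simp only [not_not]
    change μ N = 0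
    rw [hN, measure_toMeasurable]
    exact hsmooth
  have hFG : ∀ᵐ ω ∂μ, ∀ x, F x ω = Nᶜ.indicator (F x) ω := by
    filter_upwards [hN0] with ω hω x
    rw [indicator_of_mem (by exact hω)]
  have hGm : ∀ x, Measurable (Nᶜ.indicator (F x)) := fun x => (hF x).indicator hNm.compl
  refine ⟨fun x => Nᶜ.indicator (F x), hFG, hGm, fun ω => ?_, fun x => ?_, fun h => ?_, hr, ?_⟩
  · by_cases hω : ω ∈ N
    · have : (fun x => Nᶜ.indicator (F x) ω) = fun _ => 0 := by
        ext1 x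
        exact indicator_of_notMem (by simpa using hω) _
      rw [this]
      exact contDiff_const
    · have : (fun x => Nᶜ.indicator (F x) ω) = fun x => F x ω := by
        ext1 x
        exact indicator_of_mem (by exact hω) _
      rw [this]
      by_contra hc
      exact hω (subset_toMeasurable _ _ hc)
  · rw [← hcent x]
    refine integral_congr_ae ?_
    filter_upwards [hFG] with ω hω
    exact (hω x).symm
  · have h1 : ∀ h : E d, IdentDistrib (fun ω x => Nᶜ.indicator (F (x + h)) ω)
        (fun ω x => F (x + h) ω) μ μ := by
      intro h
      refine IdentDistrib.of_ae_eq (measurable_pi_lambda _ fun x => hGm _).aemeasurable ?_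
      filter_upwards [hFG] with ω hω
      ext1 x
      exact (hω (x + h)).symm
    have h2 := h1 0
    simp only [add_zero] at h2
    exact ((h1 h).trans (hstat h)).trans h2.symm
  · refine lt_of_eq_of_lt (lintegral_congr_ae ?_) hmom
    filter_upwards [hFG] with ω hω
    simp only [hω]

end Modification

end StochTurb

theorem mainTheorem6 {d : ℕ} {Ω : Type*} [MeasurableSpace Ω] (μ : Measure Ω)
    [IsProbabilityMeasure μ]
    -- the mean velocity and the random field
    (v : StochTurb.E d) (hv : v ≠ 0)
    (F : StochTurb.E d → Ω → StochTurb.E d) (hF_meas : ∀ x, Measurable (F x))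
    -- the exponents
    (a₀ κ : ℝ) (ha₀ : max 3 (d : ℝ) < a₀)
    (hκ : κ ∈ Ioo 0 (min (1 / 3) (1 / (d : ℝ)) - 1 / a₀))
    -- (i) the field is centered and stationary
    (hF_centered : ∀ x, ∫ ω, F x ω ∂μ = 0)
    (hF_stationary : ∀ h : StochTurb.E d,
      IdentDistrib (fun ω x => F (x + h) ω) (fun ω x => F x ω) μ μ)
    -- (ii) regularity and moments
    (hF_smooth : ∀ᵐ ω ∂μ, ContDiff ℝ 3 (fun x => F x ω))
    (hF_moment : ∫⁻ ω, ∑ k ∈ Finset.range 4,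
      ⨆ x ∈ Metric.closedBall (0 : StochTurb.E d) 1,
        ‖iteratedFDeriv ℝ k (fun z => F z ω) x‖ₑ ^ (2 * a₀) ∂μ < ∞)
    -- (iii) mixing
    (hF_mixing : ∫⁻ u in Ioi (0 : ℝ), StochTurb.mixingRate μ F u ^ κ < ∞)
    -- the cutoff function
    (χ : StochTurb.E d → ℝ) (hχ_smooth : ContDiff ℝ (⊤ : ℕ∞) χ)
    (hχ_one : ∀ x ∈ Metric.ball (0 : StochTurb.E d) 1, χ x = 1)
    (hχ_supp : Function.support χ ⊆ Metric.ball 0 2)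
    -- the time horizon, the radius and the regularity index
    (T : ℝ) (hT : 0 < T) (R : ℝ) (hR : 0 < R) (r : ℝ) (hr : r ∈ Ioo (0 : ℝ) 1) :
    StochTurb.UniformMomentBounds μ T 2 r (a₀ / (a₀ * κ + 1)) 3
      (fun ε s t => StochTurb.driverVLoc F v χ R ε s t)
      (fun ε s t => StochTurb.driverWLoc F v χ R ε s t) := by
  obtain ⟨G, hFG, hG⟩ := StochTurb.exists_regularField (r := 2 * a₀)
    (by linarith [le_max_left 3 (d : ℝ)]) hF_meas hF_centered hF_stationary hF_smooth hF_moment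
  -- A nonzero vector `v` exists only in positive dimension.
  have hd : 1 ≤ d := by
    by_contra h
    obtain rfl : d = 0 := by omega
    exact hv (Subsingleton.elim _ _)
  refine StochTurb.UniformMomentBounds.congr_ae hFG
    (hG.uniformMomentBounds hd hv hκ.1 ?_ ?_ hχ_smooth hχ_supp hR hr.2 T)
  · linarith [hκ.2, min_le_left (1 / 3) (1 / (d : ℝ))]
  · refine lt_of_le_of_lt (lintegral_mono fun u => ?_) hF_mixing
    exact ENNReal.rpow_le_rpow (StochTurb.mixingRate_le_of_ae_eq hFG u) hκ.1.le
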